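/- Let $\mathcal C$ be a contextual category equipped with $\Sigma$-, $\Pi$- and intensional $\mathtt{Id}$-structures (formation, introduction, elimination and computation, all strictly stable under substitution), such that the $\Pi$-structure satisfies the $\eta$-rule and function extensionality holds. Call a map of $\mathcal C$ a fibration if it is isomorphic, as an arrow, to a finite composite of dependent projections $p_A\colon \Gamma.A\to\Gamma$, and call it anodyne if it has the left lifting property against all fibrations. Conventions. For context extensions $\Gamma.A$, $\Gamma.B$ write $[A,B]=\Pi(A,p_A^*B)$, let $\mathsf{isEquiv}_{A,B}=\mathsf{LInv}_{A,B}\times\mathsf{RInv}_{A,B}$ over $\Gamma.[A,B]$ be the type of pairs of a left inverse of $f:[A,B]$ (some $g:[B,A]$ with an element of $\mathsf{Id}_{[A,A]}(g f,\mathrm{id})$) and a right inverse (some $h:[B,A]$ with an element of $\mathsf{Id}_{[B,B]}(f h,\mathrm{id})$), and let $\mathsf{Equiv}(A,B)=\Sigma([A,B],\mathsf{isEquiv}_{A,B})$. A universe is a context $U.\mathsf{El}$ of length two. It is univalent if, over $U.p_U^*U$ (with variables $X,Y:U$), the type expressing that the function $\lambda p.\,\mathsf{idToEquiv}(X,Y,p)$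 from $\mathsf{Id}_U(X,Y)$ to $\mathsf{Equiv}(\mathsf{El}(X),\mathsf{El}(Y))$ is an equivalence has a section, where $\mathsf{idToEquiv}$ is obtained by $J$ from the identity equivalence. $\mathcal C$ has enough univalent universes if for every finite family of context extensions $\Gamma_i.A_i$ there is a univalent universe $U.\mathsf{El}$, closed under $\Pi$, $\Sigma$ and $\mathtt{Id}$ (codes strictly compatible with $\mathsf{El}$ and with substitution), and maps $\chi_i\colon\Gamma_i\to U$ with $A_i=\chi_i^*\mathsf{El}$. A tribe is a category with a subcategory of fibrations, containing all maps to a terminal object (which exists), such that pullbacks along fibrations exist, fibrations are stable under pullback, every map factors as an anodyne map followed by a fibration, and anodyne maps are stable under pullback along fibrations. It is a $\pi$-tribe if for every fibration $p\colon X\to Y$ the pullback functor $p^*\colon\mathcal C/Y\to\mathcal C/X$ has a partial right adjoint $\Pi_p$, defined on fibrations over $X$, taking them to fibrations over $Y$ and preserving homotopy equivalences. For a fibration $p\colon E\to B$ in a $\pi$-tribe let $\mathsf{Eq}_B(E)\to B\times B$ be the object of equivalences between $\pi_1^*p$ and $\pi_2^*p$: the object, constructed over $B\times B$ from internal homs and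 path objects, of maps together with a left and a right homotopy inverse and witnessing homotopies. The fibration $p$ is univalent if the map $\delta_E\colon B\to\mathsf{Eq}_B(E)$ over $B\times B$ given by $\mathrm{id}_E$, with itself as inverses and constant homotopies, is a homotopy equivalence. Let $S_p$ be the class of all pullbacks of $p$; it is closed if it is closed under composition and if $\Pi_g(f)\in S_p$ for all composable $f,g\in S_p$. A $\pi$-tribe has enough univalent fibrations if every fibration lies in $S_p$ for some univalent fibration $p$ such that $S_p$ is closed. Then: 1. $\mathcal C$ with these fibrations is a $\pi$-tribe. 2. If $U.\mathsf{El}$ is a univalent universe in $\mathcal C$, then $p_{\mathsf{El}}\colon U.\mathsf{El}\to U$ is a univalent fibration in this $\pi$-tribe. 3. If moreover the $\Sigma$-structure satisfies the $\eta$-rule, i.e. the pairing maps $\Gamma.A.B\to\Gamma.\Sigma(A,B)$ are isomorphisms, and $\mathcal C$ has enough univalent universes, then this $\pi$-tribe has enough univalent fibrations. -/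

import Mathlib

open CategoryTheory Limits

universe w v u

set_option linter.unusedSectionVars false

noncomputable section

/-! ## Contextual categories

A contextual category is given by a category with a terminal object `root`, for each object `Γ` the
context extensions `ext A` of `Γ` (indexed by `A : Ty Γ`), with dependent projections `proj A` and
strictly functorial canonical pullbacks, such that every object is obtained from `root` by a unique
finite chain of extensions. (In terms of a grading and a father map `ft`, the type `Ty Γ` is the
fibre of `ft` over `Γ`, and `len` is the grading.) -/

/-- Contextual categories ("categorical models of type theory"). -/
class ContextualCategory (C : Type u) [Category.{v} C] where
  /-- the context extensions of `Γ` -/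
  Ty : C → Type w
  /-- the extended context `Γ.A` -/
  ext : {Γ : C} → Ty Γ → C
  /-- the dependent projection `p_A : Γ.A ⟶ Γ` -/
  proj : {Γ : C} → (A : Ty Γ) → (ext A ⟶ Γ)
  /-- the canonical pullback `f^* A` -/
  sub : {Δ Γ : C} → (Δ ⟶ Γ) → Ty Γ → Ty Δ
  /-- the map `q_{f,A} : Δ.f^*A ⟶ Γ.A` -/
  q : {Δ Γ : C} → (f : Δ ⟶ Γ) → (A : Ty Γ) → (ext (sub f A) ⟶ ext A)
  isPullback : ∀ {Δ Γ : C} (f : Δ ⟶ Γ) (A : Ty Γ), IsPullback (q f A) (proj (sub f A)) (proj A) f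
  sub_id : ∀ {Γ : C} (A : Ty Γ), sub (𝟙 Γ) A = A
  q_id : ∀ {Γ : C} (A : Ty Γ), q (𝟙 Γ) A = eqToHom (by rw [sub_id])
  sub_comp : ∀ {Θ Δ Γ : C} (g : Θ ⟶ Δ) (f : Δ ⟶ Γ) (A : Ty Γ), sub (g ≫ f) A = sub g (sub f A)
  q_comp : ∀ {Θ Δ Γ : C} (g : Θ ⟶ Δ) (f : Δ ⟶ Γ) (A : Ty Γ),
    q (g ≫ f) A = eqToHom (by rw [sub_comp]) ≫ q g (sub f A) ≫ q f A
  /-- the empty context -/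
  root : C
  rootIsTerminal : IsTerminal root
  /-- the length of a context -/
  len : C → ℕ
  len_eq_zero_iff : ∀ Γ : C, len Γ = 0 ↔ Γ = root
  len_ext : ∀ {Γ : C} (A : Ty Γ), len (ext A) = len Γ + 1
  exists_ext : ∀ Γ : C, len Γ ≠ 0 → ∃ (Δ : C) (A : Ty Δ), ext A = Γ
  ext_injective : Function.Injective (fun X : Σ Γ : C, Ty Γ => ext X.2)

namespace ContextualCategory

variable {C : Type u} [Category.{v} C] [ContextualCategory.{w} C]

/-- The canonical identification `Γ.A = Γ.A'` for equal types `A = A'`. -/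
def extCast {Γ : C} {A A' : Ty Γ} (h : A = A') : ext A ⟶ ext A' := eqToHom (by rw [h])

@[simp] lemma extCast_refl {Γ : C} (A : Ty Γ) : extCast (rfl : A = A) = 𝟙 (ext A) := rfl

@[simp] lemma extCast_proj {Γ : C} {A A' : Ty Γ} (h : A = A') : extCast h ≫ proj A' = proj A := by
  subst h; simp

/-- Morphisms `Δ ⟶ Γ.A` lying over a given `σ : Δ ⟶ Γ`. -/
@[ext] structure Elt {Δ Γ : C} (σ : Δ ⟶ Γ) (A : Ty Γ) : Type v where
  hom : Δ ⟶ ext A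
  w : hom ≫ proj A = σ

/-- Sections of `p_A : Γ.A ⟶ Γ`. -/
abbrev Sec {Γ : C} (A : Ty Γ) : Type v := Elt (𝟙 Γ) A

/-- The section (over `τ`) of the canonical pullback `m^* A` determined by a map to `Γ.A`. -/
def lift {Δ Θ Γ : C} (m : Θ ⟶ Γ) (τ : Δ ⟶ Θ) {A : Ty Γ} (s : Δ ⟶ ext A)
    (h : s ≫ proj A = τ ≫ m) : Elt τ (sub m A) :=
  ⟨(isPullback m A).lift s τ h, (isPullback m A).lift_snd _ _ _⟩

@[simp] lemma lift_q {Δ Θ Γ : C} (m : Θ ⟶ Γ) (τ : Δ ⟶ Θ) {A : Ty Γ} (s : Δ ⟶ ext A)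
    (h : s ≫ proj A = τ ≫ m) : (lift m τ s h).1 ≫ q m A = s :=
  (isPullback m A).lift_fst _ _ _

@[simp] lemma lift_proj {Δ Θ Γ : C} (m : Θ ⟶ Γ) (τ : Δ ⟶ Θ) {A : Ty Γ} (s : Δ ⟶ ext A)
    (h : s ≫ proj A = τ ≫ m) : (lift m τ s h).1 ≫ proj (sub m A) = τ :=
  (isPullback m A).lift_snd _ _ _

lemma q_proj {Δ Γ : C} (f : Δ ⟶ Γ) (A : Ty Γ) : q f A ≫ proj A = proj (sub f A) ≫ f :=
  (isPullback f A).w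

/-- Transport of sections along an equality of types. -/
def Sec.cast {Γ : C} {A A' : Ty Γ} (h : A = A') (s : Sec A) : Sec A' :=
  ⟨s.1 ≫ extCast h, by rw [Category.assoc, extCast_proj]; exact s.2⟩

/-- The pullback `f^* s` of a section `s` of `A`. -/
def Sec.sub {Δ Γ : C} (f : Δ ⟶ Γ) {A : Ty Γ} (s : Sec A) : Sec (sub f A) :=
  lift f (𝟙 Δ) (f ≫ s.1) (by rw [Category.assoc, s.2, Category.comp_id, Category.id_comp])

/-- The weakening `p_A^* B` of `B` along `p_A`. -/
abbrev wk {Γ : C} (A B : Ty Γ) : Ty (ext A) := sub (proj A) B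

/-- The diagonal `Γ.A ⟶ Γ.A.p_A^*A`. -/
def diagSec {Γ : C} (A : Ty Γ) : Sec (wk A A) :=
  lift (proj A) (𝟙 (ext A)) (𝟙 (ext A)) rfl

/-- The map `(s, t) : Δ ⟶ Γ.A.p_A^*A`. -/
def pairElt {Δ Γ : C} {σ : Δ ⟶ Γ} {A : Ty Γ} (s t : Elt σ A) : Δ ⟶ ext (wk A A) :=
  (lift (proj A) s.1 t.1 (by rw [t.2, s.2])).1

/-- The map `Δ.f^*A.f^*A ⟶ Γ.A.A` induced by `f : Δ ⟶ Γ`. -/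
def dbl {Δ Γ : C} (f : Δ ⟶ Γ) (A : Ty Γ) :
    ext (wk (ContextualCategory.sub f A) (ContextualCategory.sub f A)) ⟶ ext (wk A A) :=
  (lift (proj A) (proj _ ≫ q f A) (q (proj _) (ContextualCategory.sub f A) ≫ q f A)
    (by simp only [Category.assoc, q_proj]; rw [← Category.assoc, q_proj, Category.assoc])).1

lemma lift_ext {Δ Θ Γ : C} (m : Θ ⟶ Γ) {A : Ty Γ} {x y : Δ ⟶ ext (sub m A)}
    (h₁ : x ≫ q m A = y ≫ q m A) (h₂ : x ≫ proj _ = y ≫ proj _) : x = y :=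
  (isPullback m A).hom_ext h₁ h₂

lemma Sec.cast_cast {Γ : C} {A A' : Ty Γ} (h : A = A') (s : Sec A) :
    Sec.cast h.symm (Sec.cast h s) = s := by
  subst h; apply Elt.ext; simp [Sec.cast]

lemma Sec.cast_cast' {Γ : C} {A A' : Ty Γ} (h : A' = A) (s : Sec A) :
    Sec.cast h (Sec.cast h.symm s) = s := by
  subst h; apply Elt.ext; simp [Sec.cast]

lemma q_extCast {Δ Γ : C} (m : Δ ⟶ Γ) {X X' : Ty Γ} (h : X = X') :
    q m X ≫ extCast h = extCast (by rw [h]) ≫ q m X' := by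
  subst h; simp

lemma q_comp' {Θ Δ Γ : C} (g : Θ ⟶ Δ) (f : Δ ⟶ Γ) (A : Ty Γ) :
    q g (sub f A) ≫ q f A = extCast (sub_comp g f A).symm ≫ q (g ≫ f) A := by
  rw [q_comp]; simp [extCast]

lemma extCast_trans {Γ : C} {A A' A'' : Ty Γ} (h : A = A') (h' : A' = A'') :
    extCast h ≫ extCast h' = extCast (h.trans h') := by
  subst h h'; simp

lemma extCast_trans_assoc {Γ : C} {A A' A'' : Ty Γ} (h : A = A') (h' : A' = A'') {Z : C}
    (z : ext A'' ⟶ Z) : extCast h ≫ extCast h' ≫ z = extCast (h.trans h') ≫ z := by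
  rw [← Category.assoc, extCast_trans]

end ContextualCategory

open ContextualCategory

/-! ## Logical structure on contextual categories -/

section Structures

variable (C : Type u) [Category.{v} C] [ContextualCategory.{w} C]

/-- A `Σ`-structure: formation, pairing, dependent elimination `split` with its computation rule,
all stable under canonical pullback. -/
class SigmaStructure where
  Sig : {Γ : C} → (A : Ty Γ) → Ty (ext A) → Ty Γ
  pair : {Γ : C} → (A : Ty Γ) → (B : Ty (ext A)) → Elt (proj B ≫ proj A) (Sig A B)
  split : {Γ : C} → (A : Ty Γ) → (B : Ty (ext A)) → (D : Ty (ext (Sig A B))) →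
    Elt (pair A B).1 D → Sec D
  pair_split : ∀ {Γ : C} (A : Ty Γ) (B : Ty (ext A)) (D : Ty (ext (Sig A B)))
    (d : Elt (pair A B).1 D), (pair A B).1 ≫ (split A B D d).1 = d.1
  sub_Sig : ∀ {Δ Γ : C} (f : Δ ⟶ Γ) (A : Ty Γ) (B : Ty (ext A)),
    sub f (Sig A B) = Sig (sub f A) (sub (q f A) B)
  sub_pair : ∀ {Δ Γ : C} (f : Δ ⟶ Γ) (A : Ty Γ) (B : Ty (ext A)),
    (pair (sub f A) (sub (q f A) B)).1 ≫ extCast (sub_Sig f A B).symm ≫ q f (Sig A B) =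
      q (q f A) B ≫ (pair A B).1
  sub_split : ∀ {Δ Γ : C} (f : Δ ⟶ Γ) (A : Ty Γ) (B : Ty (ext A)) (D : Ty (ext (Sig A B)))
    (d : Elt (pair A B).1 D),
    (split (sub f A) (sub (q f A) B) (sub (extCast (sub_Sig f A B).symm ≫ q f (Sig A B)) D)
      (lift _ _ (q (q f A) B ≫ d.1) (by rw [Category.assoc, d.2, sub_pair]))).1 ≫ q _ D =
      (extCast (sub_Sig f A B).symm ≫ q f (Sig A B)) ≫ (split A B D d).1

/-- The `Σ`-structure satisfies the `η`-rule: `Γ.A.B ⟶ Γ.Σ(A,B)` is an isomorphism. -/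
def SigmaEta [SigmaStructure C] : Prop :=
  ∀ {Γ : C} (A : Ty Γ) (B : Ty (ext A)), IsIso (SigmaStructure.pair A B).1

/-- An `Id`-structure: formation, reflexivity, and dependent elimination `J` with its computation
rule, all stable under canonical pullback. -/
class IdStructure where
  Id : {Γ : C} → (A : Ty Γ) → Ty (ext (wk A A))
  refl : {Γ : C} → (A : Ty Γ) → Elt (diagSec A).1 (Id A)
  J : {Γ : C} → (A : Ty Γ) → (D : Ty (ext (Id A))) → Elt (refl A).1 D → Sec D
  refl_J : ∀ {Γ : C} (A : Ty Γ) (D : Ty (ext (Id A))) (d : Elt (refl A).1 D),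
    (refl A).1 ≫ (J A D d).1 = d.1
  sub_Id : ∀ {Δ Γ : C} (f : Δ ⟶ Γ) (A : Ty Γ), sub (dbl f A) (Id A) = Id (sub f A)
  sub_refl : ∀ {Δ Γ : C} (f : Δ ⟶ Γ) (A : Ty Γ),
    (refl (sub f A)).1 ≫ extCast (sub_Id f A).symm ≫ q (dbl f A) (Id A) = q f A ≫ (refl A).1
  sub_J : ∀ {Δ Γ : C} (f : Δ ⟶ Γ) (A : Ty Γ) (D : Ty (ext (Id A))) (d : Elt (refl A).1 D),
    (J (sub f A) (sub (extCast (sub_Id f A).symm ≫ q (dbl f A) (Id A)) D)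
      (lift _ _ (q f A ≫ d.1) (by rw [Category.assoc, d.2, sub_refl]))).1 ≫ q _ D =
      (extCast (sub_Id f A).symm ≫ q (dbl f A) (Id A)) ≫ (J A D d).1

/-- A `Π`-structure: formation, abstraction, application, with the `β`-rule, all stable under
canonical pullback. -/
class PiStructure where
  Pi : {Γ : C} → (A : Ty Γ) → Ty (ext A) → Ty Γ
  lam : {Γ : C} → {A : Ty Γ} → {B : Ty (ext A)} → Sec B → Sec (Pi A B)
  app : {Γ : C} → {A : Ty Γ} → {B : Ty (ext A)} → Sec (Pi A B) → (a : Sec A) → Elt a.1 B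
  beta : ∀ {Γ : C} {A : Ty Γ} {B : Ty (ext A)} (b : Sec B) (a : Sec A),
    (app (lam b) a).1 = a.1 ≫ b.1
  sub_Pi : ∀ {Δ Γ : C} (f : Δ ⟶ Γ) (A : Ty Γ) (B : Ty (ext A)),
    sub f (Pi A B) = Pi (sub f A) (sub (q f A) B)
  sub_lam : ∀ {Δ Γ : C} (f : Δ ⟶ Γ) {A : Ty Γ} {B : Ty (ext A)} (b : Sec B),
    (Sec.sub f (lam b)).cast (sub_Pi f A B) = lam (Sec.sub (q f A) b)
  sub_app : ∀ {Δ Γ : C} (f : Δ ⟶ Γ) {A : Ty Γ} {B : Ty (ext A)} (k : Sec (Pi A B)) (a : Sec A),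
    (app ((Sec.sub f k).cast (sub_Pi f A B)) (Sec.sub f a)).1 ≫ q (q f A) B = f ≫ (app k a).1

end Structures

open SigmaStructure IdStructure PiStructure

section Functions

variable {C : Type u} [Category.{v} C] [ContextualCategory.{w} C] [PiStructure C]

/-- Application of `k : Δ ⟶ Γ.Π(A,B)` to `a : Δ ⟶ Γ.A`, both lying over `σ : Δ ⟶ Γ`: apply the
corresponding sections over `Δ`. -/
def applyOver {Δ Γ : C} {σ : Δ ⟶ Γ} {A : Ty Γ} {B : Ty (ext A)} (k : Elt σ (Pi A B))
    (a : Elt σ A) : Elt a.1 B :=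
  ⟨(app (Sec.cast (sub_Pi σ A B) (lift σ (𝟙 Δ) k.1 (by rw [k.2, Category.id_comp])))
      (lift σ (𝟙 Δ) a.1 (by rw [a.2, Category.id_comp]))).1 ≫ q (q σ A) B, by
    rw [Category.assoc, q_proj, ← Category.assoc, (app _ _).2, lift_q]⟩

/-- Abstraction of a map `b : Δ.σ^*A ⟶ Γ.A.B` lying over `q_{σ,A}`. -/
def lamOver {Δ Γ : C} {σ : Δ ⟶ Γ} {A : Ty Γ} {B : Ty (ext A)} (b : Elt (q σ A) B) :
    Elt σ (Pi A B) :=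
  ⟨((lam (lift (q σ A) (𝟙 _) b.1 (by rw [b.2, Category.id_comp]))).cast (sub_Pi σ A B).symm).1 ≫
      q σ (Pi A B), by
    rw [Category.assoc, q_proj, ← Category.assoc, (Sec.cast _ _).2, Category.id_comp]⟩

/-- For a section `k` of `Π(A,B)`, the section `app(k, x)` of `B` in the context `Γ.A`. -/
def appVar {Γ : C} {A : Ty Γ} {B : Ty (ext A)} (k : Sec (Pi A B)) : Sec B :=
  ⟨(applyOver (σ := proj A) ⟨proj A ≫ k.1, by rw [Category.assoc, k.2, Category.comp_id]⟩
      ⟨𝟙 _, Category.id_comp _⟩).1, (applyOver _ _).2⟩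

variable (C) in
/-- The `η`-rule for `Π`: `λ x. app(k, x) = k`. -/
def PiEta : Prop :=
  ∀ {Γ : C} {A : Ty Γ} {B : Ty (ext A)} (k : Sec (Pi A B)), lam (appVar k) = k

variable (C) in
/-- Function extensionality: two sections of `Π(A,B)` which are pointwise identified are
identified. -/
def FunExt [IdStructure C] : Prop :=
  ∀ {Γ : C} {A : Ty Γ} {B : Ty (ext A)} (f g : Sec (Pi A B)),
    Nonempty (Sec (sub (pairElt (appVar f) (appVar g)) (Id B))) →
    Nonempty (Sec (sub (pairElt f g) (Id (Pi A B))))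

/-- The ordinary function type `[A,B] = Π(A, p_A^* B)`. -/
abbrev arr {Γ : C} (A B : Ty Γ) : Ty Γ := Pi A (wk A B)

/-- Application for ordinary functions. -/
def applyArr {Δ Γ : C} {σ : Δ ⟶ Γ} {A B : Ty Γ} (k : Elt σ (arr A B)) (a : Elt σ A) : Elt σ B :=
  ⟨(applyOver k a).1 ≫ q (proj A) B, by
    rw [Category.assoc, q_proj, ← Category.assoc, (applyOver k a).2, a.2]⟩

/-- Abstraction for ordinary functions: `c : Δ.σ^*A ⟶ Γ.B` over `Γ` gives `Δ ⟶ Γ.[A,B]`. -/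
def lamArr {Δ Γ : C} {σ : Δ ⟶ Γ} {A B : Ty Γ} (c : Elt (proj (sub σ A) ≫ σ) B) :
    Elt σ (arr A B) :=
  lamOver (lift (proj A) (q σ A) c.1 (by rw [c.2, q_proj]))

/-- Restriction of `s : Δ ⟶ Γ.A` along `m : Θ ⟶ Δ`. -/
def Elt.pre {Θ Δ Γ : C} (m : Θ ⟶ Δ) {σ : Δ ⟶ Γ} {A : Ty Γ} (s : Elt σ A) : Elt (m ≫ σ) A :=
  ⟨m ≫ s.1, by rw [Category.assoc, s.2]⟩

/-- The variable `Δ.σ^*A ⟶ Γ.A`. -/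
def varElt {Δ Γ : C} (σ : Δ ⟶ Γ) (A : Ty Γ) : Elt (proj (sub σ A) ≫ σ) A :=
  ⟨q σ A, q_proj σ A⟩

/-- The identity function `λ x. x`. -/
def idArr {Γ : C} (A : Ty Γ) : Sec (arr A A) := lam (diagSec A)

/-- The composite `λ x. f (g x)` of `g : Δ ⟶ Γ.[A,B]` and `f : Δ ⟶ Γ.[B,D]` over `Γ`. -/
def compArr {Δ Γ : C} {σ : Δ ⟶ Γ} {A B D : Ty Γ} (g : Elt σ (arr A B)) (f : Elt σ (arr B D)) :
    Elt σ (arr A D) :=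
  lamArr (applyArr (Elt.pre (proj (sub σ A)) f)
    (applyArr (Elt.pre (proj (sub σ A)) g) (varElt σ A)))


/-! Facts needed to construct the canonical equivalence between equal types. -/

/-- `β` for generalised elements. -/
lemma applyOver_lamOver {Δ Γ : C} {σ : Δ ⟶ Γ} {A : Ty Γ} {B : Ty (ext A)}
    (b : Elt (q σ A) B) (a : Elt σ A) :
    (applyOver (lamOver b) a).1 =
      (lift σ (𝟙 Δ) a.1 (by rw [a.2, Category.id_comp])).1 ≫ b.1 := by
  have key : lift σ (𝟙 Δ) (lamOver b).1 (by rw [(lamOver b).2, Category.id_comp]) =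
      Sec.cast (sub_Pi σ A B).symm
        (lam (lift (q σ A) (𝟙 _) b.1 (by rw [b.2, Category.id_comp]))) := by
    apply Elt.ext
    apply lift_ext
    · rw [lift_q]; rfl
    · rw [lift_proj, (Sec.cast _ _).2]
  unfold applyOver
  simp only [key, Sec.cast_cast', beta, Category.assoc, lift_q]

lemma applyArr_lamArr {Δ Γ : C} {σ : Δ ⟶ Γ} {A B : Ty Γ} (c : Elt (proj (sub σ A) ≫ σ) B)
    (a : Elt σ A) :
    (applyArr (lamArr c) a).1 =
      (lift σ (𝟙 Δ) a.1 (by rw [a.2, Category.id_comp])).1 ≫ c.1 := by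
  unfold applyArr lamArr
  simp only [applyOver_lamOver, Category.assoc, lift_q]

lemma app_presentation {Δ Γ : C} {σ : Δ ⟶ Γ} {A : Ty Γ} {B : Ty (ext A)} (k : Elt σ (Pi A B))
    (a : Elt σ A) (X : Ty Δ) (hX : X = sub σ A) (r : ext X ⟶ ext A) (hr : r = extCast hX ≫ q σ A)
    (K : Sec (Pi X (sub r B))) (y : ext (Pi X (sub r B)) ⟶ ext (Pi A B))
    (hy : ∀ h : Pi X (sub r B) = sub σ (Pi A B), y = extCast h ≫ q σ (Pi A B))
    (hK : K.1 ≫ y = k.1) (a' : Sec X) (ha : a'.1 ≫ r = a.1) :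
    (app K a').1 ≫ q r B = (applyOver k a).1 := by
  subst hX
  simp only [extCast_refl, Category.id_comp] at hr
  subst hr
  have h₁ : K = Sec.cast (sub_Pi σ A B)
      (lift σ (𝟙 Δ) k.1 (by rw [k.2, Category.id_comp])) := by
    have : Sec.cast (sub_Pi σ A B).symm K =
        lift σ (𝟙 Δ) k.1 (by rw [k.2, Category.id_comp]) := by
      apply Elt.ext
      apply lift_ext
      · rw [lift_q, ← hK, hy (sub_Pi σ A B).symm]
        simp [Sec.cast]
      · rw [lift_proj, (Sec.cast _ _).2]
    rw [← this, Sec.cast_cast']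
  have h₂ : a' = lift σ (𝟙 Δ) a.1 (by rw [a.2, Category.id_comp]) := by
    apply Elt.ext
    apply lift_ext
    · rw [lift_q, ha]
    · rw [lift_proj, a'.2]
  subst h₁ h₂
  rfl

lemma extCast_pi {Γ : C} {A : Ty Γ} {B B' : Ty (ext A)} (h : B = B') (K : Sec (Pi A B))
    (a : Sec A) : (app (Sec.cast (by rw [h]) K : Sec (Pi A B')) a).1 =
      (app K a).1 ≫ extCast h := by
  subst h
  simp [Sec.cast]

/-- Naturality of application. -/
lemma pre_applyOver {Θ Δ Γ : C} (m : Θ ⟶ Δ) {σ : Δ ⟶ Γ} {A : Ty Γ} {B : Ty (ext A)}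
    (k : Elt σ (Pi A B)) (a : Elt σ A) :
    m ≫ (applyOver k a).1 = (applyOver (Elt.pre m k) (Elt.pre m a)).1 := by
  have hB : sub (q m (sub σ A)) (sub (q σ A) B) = sub (q m (sub σ A) ≫ q σ A) B :=
    (sub_comp _ _ _).symm
  set k₀ := Sec.cast (sub_Pi σ A B) (lift σ (𝟙 Δ) k.1 (by rw [k.2, Category.id_comp])) with hk₀
  set a₀ := lift σ (𝟙 Δ) a.1 (by rw [a.2, Category.id_comp]) with ha₀
  have e : (applyOver k a).1 = (app k₀ a₀).1 ≫ q (q σ A) B := rfl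
  rw [e, ← Category.assoc, ← sub_app m k₀ a₀, Category.assoc, q_comp', ← Category.assoc,
    ← extCast_pi hB]
  refine app_presentation (Elt.pre m k) (Elt.pre m a) _ (sub_comp m σ A).symm _ (q_comp' m σ A) _
    (extCast (by rw [← hB, ← sub_Pi, ← sub_Pi, ← sub_comp]) ≫ q (m ≫ σ) (Pi A B))
    (fun h => rfl) ?_ _ ?_
  · have hk : k₀.1 ≫ extCast (sub_Pi σ A B).symm ≫ q σ (Pi A B) = k.1 := by
      rw [hk₀]; simp only [Sec.cast, Category.assoc]
      rw [← Category.assoc (extCast _), extCast_trans]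
      simp
    have : Elt.pre m k = ⟨m ≫ k.1, (Elt.pre m k).2⟩ := rfl
    rw [this]
    change _ = m ≫ k.1
    rw [← hk]
    have h₁ : m ≫ k₀.1 = (Sec.sub m k₀).1 ≫ q m _ := by
      unfold Sec.sub; rw [lift_q]
    rw [← Category.assoc m, h₁, Category.assoc, ← Category.assoc (q m _), q_extCast,
      Category.assoc, q_comp' m σ (Pi A B)]
    simp only [Sec.cast, Category.assoc]
    simp only [extCast_trans_assoc]
  · change (Sec.sub m a₀).1 ≫ q m (sub σ A) ≫ q σ A = m ≫ a.1
    rw [← Category.assoc]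
    unfold Sec.sub
    rw [lift_q, Category.assoc, ha₀, lift_q]

lemma lam_presentation {Δ Γ : C} {σ : Δ ⟶ Γ} {A : Ty Γ} {B : Ty (ext A)} (b : Elt (q σ A) B)
    (X : Ty Δ) (hX : X = sub σ A) (r : ext X ⟶ ext A) (hr : r = extCast hX ≫ q σ A)
    (b' : Sec (sub r B)) (hb : b'.1 ≫ q r B = extCast hX ≫ b.1)
    (y : ext (Pi X (sub r B)) ⟶ ext (Pi A B))
    (hy : ∀ h : Pi X (sub r B) = sub σ (Pi A B), y = extCast h ≫ q σ (Pi A B)) :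
    (lam b').1 ≫ y = (lamOver b).1 := by
  subst hX
  simp only [extCast_refl, Category.id_comp] at hr hb
  subst hr
  rw [hy (sub_Pi σ A B).symm]
  have : b' = lift (q σ A) (𝟙 _) b.1 (by rw [b.2, Category.id_comp]) := by
    apply Elt.ext
    apply lift_ext
    · rw [lift_q, hb]
    · rw [lift_proj, b'.2]
  subst this
  simp [lamOver, Sec.cast]

lemma extCast_lam {Γ : C} {A : Ty Γ} {B B' : Ty (ext A)} (h : B = B') (b : Sec B) :
    (lam b).1 ≫ extCast (by rw [h]) = (lam (Sec.cast h b)).1 := by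
  subst h
  simp [Sec.cast]

/-- Naturality of abstraction. -/
lemma pre_lamOver {Θ Δ Γ : C} (m : Θ ⟶ Δ) {σ : Δ ⟶ Γ} {A : Ty Γ} {B : Ty (ext A)}
    (b : Elt (q σ A) B) (h : (extCast (sub_comp m σ A) ≫ q m (sub σ A) ≫ b.1) ≫ proj B =
      q (m ≫ σ) A) :
    m ≫ (lamOver b).1 =
      (lamOver ⟨extCast (sub_comp m σ A) ≫ q m (sub σ A) ≫ b.1, h⟩ : Elt (m ≫ σ) (Pi A B)).1 := by
  have hB : sub (q m (sub σ A)) (sub (q σ A) B) = sub (q m (sub σ A) ≫ q σ A) B :=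
    (sub_comp _ _ _).symm
  set b₀ := lift (q σ A) (𝟙 _) b.1 (by rw [b.2, Category.id_comp]) with hb₀
  have e : (lamOver b).1 = (lam b₀).1 ≫ extCast (sub_Pi σ A B).symm ≫ q σ (Pi A B) := by
    simp [lamOver, Sec.cast, hb₀]
  have h₁ : m ≫ (lam b₀).1 = (Sec.sub m (lam b₀)).1 ≫ q m _ := by
    unfold Sec.sub; rw [lift_q]
  have h₂ : Sec.sub m (lam b₀) = Sec.cast (sub_Pi _ _ _).symm (lam (Sec.sub (q m _) b₀)) := by
    rw [← sub_lam, Sec.cast_cast]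
  rw [e, ← Category.assoc, h₁, h₂, Category.assoc, ← Category.assoc (q m _), q_extCast,
    Category.assoc, q_comp']
  rw [← lam_presentation (σ := m ≫ σ) _ _ (sub_comp m σ A).symm _ (q_comp' m σ A)
    (Sec.cast hB (Sec.sub (q m _) b₀)) ?_ (extCast (by rw [← hB, ← sub_Pi, ← sub_Pi, ← sub_comp])
      ≫ q (m ≫ σ) (Pi A B)) (fun h => rfl), ← extCast_lam]
  · simp only [Sec.cast, Category.assoc]
    congr 1
    simp only [← Category.assoc, extCast_trans]
  · have hq : extCast hB ≫ q (q m (sub σ A) ≫ q σ A) B = q (q m (sub σ A)) _ ≫ q (q σ A) B :=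
      (q_comp' (q m (sub σ A)) (q σ A) B).symm
    simp only [Sec.cast, Category.assoc]
    rw [hq, ← Category.assoc]
    have : (Sec.sub (q m (sub σ A)) b₀).1 ≫ q (q m (sub σ A)) _ = q m (sub σ A) ≫ b₀.1 := by
      unfold Sec.sub; rw [lift_q]
    rw [this, Category.assoc, hb₀, lift_q, ← Category.assoc (extCast _), extCast_trans,
      extCast_refl, Category.id_comp]

/-- Application of the restriction of an abstraction. -/
lemma applyArr_pre_lamArr {Θ Δ Γ : C} (m : Θ ⟶ Δ) {σ : Δ ⟶ Γ} {A B : Ty Γ}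
    (c : Elt (proj (sub σ A) ≫ σ) B) (a : Elt (m ≫ σ) A) :
    (applyArr (Elt.pre m (lamArr c)) a).hom = (lift σ m a.hom a.w).hom ≫ c.hom := by
  have h₁ : (lift (m ≫ σ) (𝟙 Θ) a.hom (by rw [a.w, Category.id_comp])).hom ≫
      extCast (sub_comp m σ A) ≫ q m (sub σ A) = (lift σ m a.hom a.w).hom := by
    apply lift_ext
    · simp only [Category.assoc, lift_q]
      rw [q_comp', extCast_trans_assoc, extCast_refl, Category.id_comp (q _ _), lift_q]
    · simp only [Category.assoc, q_proj, lift_proj]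
      rw [← Category.assoc (extCast _), extCast_proj, ← Category.assoc, lift_proj,
        Category.id_comp]
  have hw : (extCast (sub_comp m σ A) ≫ q m (sub σ A) ≫
      (lift (proj A) (q σ A) c.hom (by rw [c.w, q_proj])).hom) ≫ proj (wk A B) =
      q (m ≫ σ) A := by
    rw [Category.assoc, Category.assoc, lift_proj, q_comp', extCast_trans_assoc, extCast_refl,
      Category.id_comp]
  have h₂ : Elt.pre m (lamArr c) = lamOver ⟨_, hw⟩ := by
    apply Elt.ext
    exact pre_lamOver m _ hw
  rw [h₂, ← h₁]
  unfold applyArr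
  simp only [applyOver_lamOver, Category.assoc, lift_q]

lemma pre_applyArr {Θ Δ Γ : C} (m : Θ ⟶ Δ) {σ : Δ ⟶ Γ} {A B : Ty Γ}
    (k : Elt σ (arr A B)) (a : Elt σ A) :
    m ≫ (applyArr k a).hom = (applyArr (Elt.pre m k) (Elt.pre m a)).hom := by
  unfold applyArr
  simp only [← Category.assoc, pre_applyOver]

lemma pre_lamArr {Θ Δ Γ : C} (m : Θ ⟶ Δ) {σ : Δ ⟶ Γ} {A B : Ty Γ}
    (c : Elt (proj (sub σ A) ≫ σ) B) (c' : Elt (proj (sub (m ≫ σ) A) ≫ m ≫ σ) B)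
    (h : c'.hom = extCast (sub_comp m σ A) ≫ q m (sub σ A) ≫ c.hom) :
    m ≫ (lamArr c).hom = (lamArr c').hom := by
  have hw : (extCast (sub_comp m σ A) ≫ q m (sub σ A) ≫
      (lift (proj A) (q σ A) c.hom (by rw [c.w, q_proj])).hom) ≫ proj (wk A B) =
      q (m ≫ σ) A := by
    rw [Category.assoc, Category.assoc, lift_proj, q_comp', extCast_trans_assoc, extCast_refl,
      Category.id_comp]
  unfold lamArr
  rw [pre_lamOver m _ hw]
  congr 2
  apply Elt.ext
  apply lift_ext
  · simp only [Category.assoc, lift_q, h]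
  · rw [hw, lift_proj]

lemma applyArr_congr {Δ Γ : C} {σ σ' : Δ ⟶ Γ} (hσ : σ = σ') {A B : Ty Γ} {k : Elt σ (arr A B)}
    {k' : Elt σ' (arr A B)} {a : Elt σ A} {a' : Elt σ' A} (hk : k.hom = k'.hom)
    (ha : a.hom = a'.hom) : (applyArr k a).hom = (applyArr k' a').hom := by
  subst hσ
  rw [Elt.ext hk, Elt.ext ha]

lemma pre_compArr {Θ Δ Γ : C} (m : Θ ⟶ Δ) {σ : Δ ⟶ Γ} {A B D : Ty Γ} (g : Elt σ (arr A B))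
    (f : Elt σ (arr B D)) :
    m ≫ (compArr g f).hom = (compArr (Elt.pre m g) (Elt.pre m f)).hom := by
  unfold compArr
  apply pre_lamArr
  have hn : (extCast (sub_comp m σ A) ≫ q m (sub σ A)) ≫ proj (sub σ A) =
      proj (sub (m ≫ σ) A) ≫ m := by
    rw [Category.assoc, q_proj, ← Category.assoc, extCast_proj]
  have hσ : (extCast (sub_comp m σ A) ≫ q m (sub σ A)) ≫ proj (sub σ A) ≫ σ =
      proj (sub (m ≫ σ) A) ≫ m ≫ σ := by
    rw [← Category.assoc, hn, Category.assoc]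
  rw [← Category.assoc (extCast _), pre_applyArr]
  refine (applyArr_congr hσ ?_ ?_).symm
  · simp only [Elt.pre]
    rw [← Category.assoc, hn, Category.assoc]
  · change _ ≫ (applyArr _ _).hom = _
    rw [pre_applyArr]
    refine applyArr_congr hσ ?_ ?_
    · simp only [Elt.pre]
      rw [← Category.assoc, hn, Category.assoc]
    · change (extCast (sub_comp m σ A) ≫ q m (sub σ A)) ≫ q σ A = q (m ≫ σ) A
      rw [Category.assoc, q_comp', extCast_trans_assoc, extCast_refl, Category.id_comp]

lemma compArr_congr {Δ Γ : C} {σ σ' : Δ ⟶ Γ} (hσ : σ = σ') {A B D : Ty Γ} {g : Elt σ (arr A B)}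
    {g' : Elt σ' (arr A B)} {f : Elt σ (arr B D)} {f' : Elt σ' (arr B D)} (hg : g.hom = g'.hom)
    (hf : f.hom = f'.hom) : (compArr g f).hom = (compArr g' f').hom := by
  subst hσ
  rw [Elt.ext hg, Elt.ext hf]

/-- The function `Δ ⟶ Γ.[A,B]` over `σ` which is the identity along an equality
`σ^*A = σ^*B`. -/
def castFn {Δ Γ : C} (σ : Δ ⟶ Γ) {A B : Ty Γ} (h : sub σ A = sub σ B) : Elt σ (arr A B) :=
  lamArr ⟨extCast h ≫ q σ B, by rw [Category.assoc, q_proj, ← Category.assoc, extCast_proj]⟩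

/-- The identity function of `A`, over `σ`. -/
def idOver {Δ Γ : C} (σ : Δ ⟶ Γ) (A : Ty Γ) : Elt σ (arr A A) :=
  ⟨σ ≫ (idArr A).hom, by rw [Category.assoc, (idArr A).w, Category.comp_id]⟩

lemma compArr_castFn {Δ Γ : C} (σ : Δ ⟶ Γ) {A B : Ty Γ} (h : sub σ A = sub σ B) :
    compArr (castFn σ h) (castFn σ h.symm) = idOver σ A := by
  have h₁ : (applyArr (Elt.pre (proj (sub σ A)) (castFn σ h)) (varElt σ A)).hom =
      extCast h ≫ q σ B := by
    unfold castFn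
    rw [applyArr_pre_lamArr]
    have : (lift σ (proj (sub σ A)) (varElt σ A).hom (varElt σ A).w).hom = 𝟙 _ := by
      apply lift_ext
      · rw [lift_q, Category.id_comp]; rfl
      · rw [lift_proj, Category.id_comp]
    rw [this, Category.id_comp]
  have h₂ : (applyArr (Elt.pre (proj (sub σ A)) (castFn σ h.symm))
      (applyArr (Elt.pre (proj (sub σ A)) (castFn σ h)) (varElt σ A))).hom = q σ A := by
    nth_rw 1 [castFn]
    rw [applyArr_pre_lamArr]
    have : (lift σ (proj (sub σ A))
        (applyArr (Elt.pre (proj (sub σ A)) (castFn σ h)) (varElt σ A)).hom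
        (applyArr (Elt.pre (proj (sub σ A)) (castFn σ h)) (varElt σ A)).w).hom = extCast h := by
      apply lift_ext
      · rw [lift_q, h₁]
      · rw [lift_proj, extCast_proj]
    rw [this, extCast_trans_assoc, extCast_refl, Category.id_comp]
  have h₃ : Sec.sub (q σ A) (diagSec A) = lift (q σ A) (𝟙 _)
      (lift (proj A) (q σ A) (q σ A) rfl).hom (by rw [lift_proj, Category.id_comp]) := by
    unfold Sec.sub
    congr 1
    unfold diagSec
    apply lift_ext
    · rw [Category.assoc, lift_q, lift_q, Category.comp_id]
    · rw [Category.assoc, lift_proj, lift_proj, Category.comp_id]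
  apply Elt.ext
  unfold compArr lamArr lamOver idOver idArr
  simp only [h₂, ← h₃, ← sub_lam, Sec.cast_cast]
  unfold Sec.sub
  rw [lift_q]

end Functions

/-! ## Equivalences and univalence in a contextual category -/

section Univalence

variable {C : Type u} [Category.{v} C] [ContextualCategory.{w} C]
variable [SigmaStructure C] [IdStructure C] [PiStructure C]

/-- The identity type `Id_A(s,t)` of two generalised elements of `A`. -/
def idTy {Δ Γ : C} {σ : Δ ⟶ Γ} {A : Ty Γ} (s t : Elt σ A) : Ty Δ := sub (pairElt s t) (Id A)

/-- The context `Γ.[A,B].p^*[B,A]` over `Γ`. -/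
abbrev fnPairProj {Γ : C} (A B : Ty Γ) : ext (wk (arr A B) (arr B A)) ⟶ Γ :=
  proj (wk (arr A B) (arr B A)) ≫ proj (arr A B)

/-- The first variable `f` of the context `Γ.[A,B].p^*[B,A]`. -/
def fnVar {Γ : C} (A B : Ty Γ) : Elt (fnPairProj A B) (arr A B) :=
  ⟨proj (wk (arr A B) (arr B A)), rfl⟩

/-- The second variable `g` of the context `Γ.[A,B].p^*[B,A]`. -/
def fnVar' {Γ : C} (A B : Ty Γ) : Elt (fnPairProj A B) (arr B A) :=
  varElt (proj (arr A B)) (arr B A)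

/-- `RInv_{A,B}`, in the context `f : [A,B]`: the type of `g : [B,A]` with an identification of
`f ∘ g` and the identity of `B`. -/
def RInv {Γ : C} (A B : Ty Γ) : Ty (ext (arr A B)) :=
  Sig (wk (arr A B) (arr B A))
    (idTy (compArr (fnVar' A B) (fnVar A B)) (idOver (fnPairProj A B) B))

/-- `LInv_{A,B}`, in the context `f : [A,B]`: the type of `g : [B,A]` with an identification of
`g ∘ f` and the identity of `A`. -/
def LInv {Γ : C} (A B : Ty Γ) : Ty (ext (arr A B)) :=
  Sig (wk (arr A B) (arr B A))
    (idTy (compArr (fnVar A B) (fnVar' A B)) (idOver (fnPairProj A B) A))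

/-- `isEquiv_{A,B} = LInv_{A,B} × RInv_{A,B}`, in the context `f : [A,B]`. -/
def IsEquivTy {Γ : C} (A B : Ty Γ) : Ty (ext (arr A B)) :=
  Sig (LInv A B) (wk (LInv A B) (RInv A B))

/-- `Equiv(A,B) = Σ([A,B], isEquiv_{A,B})`. -/
def EquivTy {Γ : C} (A B : Ty Γ) : Ty Γ := Sig (arr A B) (IsEquivTy A B)

/-- Pairing for generalised elements. -/
def pairOver {Δ Γ : C} {σ : Δ ⟶ Γ} {A : Ty Γ} {B : Ty (ext A)} (a : Elt σ A) (b : Elt a.hom B) :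
    Elt σ (Sig A B) :=
  ⟨b.hom ≫ (pair A B).hom, by rw [Category.assoc, (pair A B).w, ← Category.assoc, b.w, a.w]⟩

/-- Reflexivity for generalised elements that are equal. -/
def reflOver {Θ Δ Γ : C} (m : Θ ⟶ Δ) {σ : Δ ⟶ Γ} {A : Ty Γ} (s t : Elt σ A)
    (h : m ≫ s.hom = m ≫ t.hom) : Elt m (idTy s t) :=
  lift (pairElt s t) m ((m ≫ s.hom) ≫ (refl A).hom) (by
    rw [Category.assoc, (refl A).w]
    apply lift_ext
    · unfold diagSec pairElt
      simp only [Category.assoc, lift_q, Category.comp_id, h]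
    · unfold diagSec pairElt
      simp only [Category.assoc, lift_proj, Category.comp_id])

/-- The map `(f, g) : Δ ⟶ Γ.[A,B].p^*[B,A]`. -/
def fnPair {Δ Γ : C} {σ : Δ ⟶ Γ} {A B : Ty Γ} (f : Elt σ (arr A B)) (g : Elt σ (arr B A)) :
    Elt f.hom (wk (arr A B) (arr B A)) :=
  lift (proj (arr A B)) f.hom g.hom (by rw [g.w, f.w])

lemma fnPair_hom_fnVar {Δ Γ : C} {σ : Δ ⟶ Γ} {A B : Ty Γ} (f : Elt σ (arr A B))
    (g : Elt σ (arr B A)) : (fnPair f g).hom ≫ (fnVar A B).hom = f.hom := lift_proj _ _ _ _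

lemma fnPair_hom_fnVar' {Δ Γ : C} {σ : Δ ⟶ Γ} {A B : Ty Γ} (f : Elt σ (arr A B))
    (g : Elt σ (arr B A)) : (fnPair f g).hom ≫ (fnVar' A B).hom = g.hom := lift_q _ _ _ _

lemma fnPair_hom_proj {Δ Γ : C} {σ : Δ ⟶ Γ} {A B : Ty Γ} (f : Elt σ (arr A B))
    (g : Elt σ (arr B A)) : (fnPair f g).hom ≫ fnPairProj A B = σ := by
  rw [← Category.assoc, (fnPair f g).w, f.w]

/-- The identity equivalence along an equality `σ^*A = σ^*B`, as a map `Δ ⟶ Γ.Equiv(A,B)` over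
`σ`: the identity function, with itself as left and right inverse, and reflexivity. For `σ = 𝟙`
and `A = B` this is the canonical section of `Equiv(A,A)`. -/
def castEquiv {Δ Γ : C} (σ : Δ ⟶ Γ) {A B : Ty Γ} (h : sub σ A = sub σ B) :
    Elt σ (EquivTy A B) :=
  let m := fnPair (castFn σ h) (castFn σ h.symm)
  let l : Elt (castFn σ h).hom (LInv A B) := pairOver m (reflOver m.hom _ _ (by
    rw [pre_compArr, compArr_congr (fnPair_hom_proj _ _) (g' := castFn σ h)
      (f' := castFn σ h.symm) (fnPair_hom_fnVar _ _) (fnPair_hom_fnVar' _ _), compArr_castFn]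
    exact (by rw [← Category.assoc, fnPair_hom_proj] :
      m.hom ≫ fnPairProj A B ≫ (idArr A).hom = σ ≫ (idArr A).hom).symm))
  let r : Elt (castFn σ h).hom (RInv A B) := pairOver m (reflOver m.hom _ _ (by
    rw [pre_compArr, compArr_congr (fnPair_hom_proj _ _) (g' := castFn σ h.symm)
      (f' := castFn σ h) (fnPair_hom_fnVar' _ _) (fnPair_hom_fnVar _ _), compArr_castFn]
    exact (by rw [← Category.assoc, fnPair_hom_proj] :
      m.hom ≫ fnPairProj A B ≫ (idArr B).hom = σ ≫ (idArr B).hom).symm))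
  pairOver (castFn σ h) (pairOver l (lift (proj (LInv A B)) l.hom r.hom (by rw [r.w, l.w])))

/-- For `A` over `Γ` and `B` over `Γ.A`, the type `Equiv(B(x), B(y))` in the context
`Γ, x : A, y : A`. -/
def famEquiv {Γ : C} (A : Ty Γ) (B : Ty (ext A)) : Ty (ext (wk A A)) :=
  EquivTy (sub (proj (wk A A)) B) (sub (q (proj A) A) B)

lemma diagSec_fam {Γ : C} (A : Ty Γ) (B : Ty (ext A)) :
    sub (diagSec A).hom (sub (proj (wk A A)) B) = sub (diagSec A).hom (sub (q (proj A) A) B) := by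
  have h : (diagSec A).hom ≫ q (proj A) A = 𝟙 _ := lift_q _ _ _ _
  rw [← sub_comp, ← sub_comp, (diagSec A).w, h]

/-- The map `idToEquiv`, defined by `J` from the identity equivalence. -/
def idToEquiv {Γ : C} (A : Ty Γ) (B : Ty (ext A)) : Sec (wk (Id A) (famEquiv A B)) :=
  J A (wk (Id A) (famEquiv A B))
    (lift (proj (Id A)) (refl A).hom
      (castEquiv (diagSec A).hom (diagSec_fam A B)).hom
      ((Elt.w _).trans (refl A).w.symm))

/-- `isUvt(A,B)`: the type, in the context `Γ, x : A, y : A`, expressing that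
`λ p. idToEquiv(x,y,p)` is an equivalence from `Id_A(x,y)` to `Equiv(B(x),B(y))`. -/
def IsUvt {Γ : C} (A : Ty Γ) (B : Ty (ext A)) : Ty (ext (wk A A)) :=
  sub (lam (idToEquiv A B) : Sec (arr (Id A) (famEquiv A B))).hom
    (IsEquivTy (Id A) (famEquiv A B))

/-- A universe `U.El` (a context of length two) is univalent if `isUvt(U,El)` has a section. -/
def IsUnivalentUniverse (U : Ty (root : C)) (El : Ty (ext U)) : Prop := Nonempty (Sec (IsUvt U El))

end Univalence

/-! ## Universes closed under the type constructors -/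

section Universes

variable {C : Type u} [Category.{v} C] [ContextualCategory.{w} C]
variable [SigmaStructure C] [IdStructure C] [PiStructure C]

/-- Closure of a universe `U.El` under `Π`, `Σ` and `Id`: codes for the respective types, strictly
compatible with `El` and stable under substitution. -/
structure UniverseClosed (U : Ty (root : C)) (El : Ty (ext U)) where
  pi : {Γ : C} → (a : Γ ⟶ ext U) → (ext (sub a El) ⟶ ext U) → (Γ ⟶ ext U)
  El_pi : ∀ {Γ : C} (a : Γ ⟶ ext U) (b : ext (sub a El) ⟶ ext U),
    sub (pi a b) El = Pi (sub a El) (sub b El)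
  pre_pi : ∀ {Δ Γ : C} (f : Δ ⟶ Γ) (a : Γ ⟶ ext U) (b : ext (sub a El) ⟶ ext U),
    f ≫ pi a b = pi (f ≫ a) (extCast (sub_comp f a El) ≫ q f (sub a El) ≫ b)
  sigma : {Γ : C} → (a : Γ ⟶ ext U) → (ext (sub a El) ⟶ ext U) → (Γ ⟶ ext U)
  El_sigma : ∀ {Γ : C} (a : Γ ⟶ ext U) (b : ext (sub a El) ⟶ ext U),
    sub (sigma a b) El = Sig (sub a El) (sub b El)
  pre_sigma : ∀ {Δ Γ : C} (f : Δ ⟶ Γ) (a : Γ ⟶ ext U) (b : ext (sub a El) ⟶ ext U),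
    f ≫ sigma a b = sigma (f ≫ a) (extCast (sub_comp f a El) ≫ q f (sub a El) ≫ b)
  id : {Γ : C} → (a : Γ ⟶ ext U) → (ext (wk (sub a El) (sub a El)) ⟶ ext U)
  El_id : ∀ {Γ : C} (a : Γ ⟶ ext U), sub (id a) El = Id (sub a El)
  pre_id : ∀ {Δ Γ : C} (f : Δ ⟶ Γ) (a : Γ ⟶ ext U),
    eqToHom (by rw [sub_comp]) ≫ dbl f (sub a El) ≫ id a = id (f ≫ a)

variable (C) in
/-- Enough univalent universes: every finite family of context extensions is obtained by
canonical pullback from a univalent universe closed under the type constructors. -/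
def HasEnoughUnivalentUniverses : Prop :=
  ∀ (n : ℕ) (Γ : Fin n → C) (A : ∀ i, Ty (Γ i)),
    ∃ (U : Ty (root : C)) (El : Ty (ext U)),
      Nonempty (UniverseClosed U El) ∧ IsUnivalentUniverse U El ∧
        ∀ i, ∃ χ : Γ i ⟶ ext U, sub χ El = A i

end Universes

/-- Finite composites of dependent projections. -/
inductive IsProjComposite {C : Type u} [Category.{v} C] [ContextualCategory.{w} C] :
    {Γ Δ : C} → (Γ ⟶ Δ) → Prop
  | id (Γ : C) : IsProjComposite (𝟙 Γ)
  | comp {Γ Δ : C} (A : Ty Γ) (f : Γ ⟶ Δ) : IsProjComposite f → IsProjComposite (proj A ≫ f)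

/-- The fibrations of a contextual category: the maps isomorphic (as arrows) to a composite of
dependent projections. -/
def fibrations (C : Type u) [Category.{v} C] [ContextualCategory.{w} C] : MorphismProperty C :=
  MorphismProperty.isoClosure (fun _ _ f => IsProjComposite f)

/-! ## Tribes -/

namespace Tribe

section Homotopy

variable {D : Type u} [Category.{v} D] (Fib : MorphismProperty D)

/-- Anodyne maps: the maps with the left lifting property against all fibrations. -/
abbrev Anodyne : MorphismProperty D := Fib.llp

/-- A path object of `A`: a factorisation of the diagonal `A ⟶ A × A` into an anodyne map followed
by a fibration. -/
structure PathObject (A : D) where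
  sq : BinaryFan A A
  isLimit : IsLimit sq
  obj : D
  r : A ⟶ obj
  ends : obj ⟶ sq.pt
  anodyne : Anodyne Fib r
  fib : Fib ends
  r_fst : r ≫ ends ≫ sq.fst = 𝟙 A
  r_snd : r ≫ ends ≫ sq.snd = 𝟙 A

variable {Fib}

/-- The source projection of a path object. -/
def PathObject.d₀ {A : D} (P : PathObject Fib A) : P.obj ⟶ A := P.ends ≫ P.sq.fst

/-- The target projection of a path object. -/
def PathObject.d₁ {A : D} (P : PathObject Fib A) : P.obj ⟶ A := P.ends ≫ P.sq.snd

variable (Fib)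

/-- The homotopy relation. -/
def Homotopic {X Y : D} (f g : X ⟶ Y) : Prop :=
  ∃ (P : PathObject Fib Y) (H : X ⟶ P.obj), H ≫ P.d₀ = f ∧ H ≫ P.d₁ = g

/-- Homotopy equivalences. -/
def IsHomotopyEquiv {X Y : D} (f : X ⟶ Y) : Prop :=
  ∃ g : Y ⟶ X, Homotopic Fib (f ≫ g) (𝟙 X) ∧ Homotopic Fib (g ≫ f) (𝟙 Y)

end Homotopy

section InternalHom

variable {D : Type u} [Category.{v} D]

/-- An internal hom object of `A` and `B`, with the universal property of the counit
`ev : obj × A ⟶ B`. -/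
structure InternalHom (A B : D) where
  obj : D
  prod : BinaryFan obj A
  isLimit : IsLimit prod
  ev : prod.pt ⟶ B
  universal : ∀ {Z : D} (c : BinaryFan Z A), IsLimit c → ∀ g : c.pt ⟶ B,
    ∃! k : Z ⟶ obj, isLimit.lift (BinaryFan.mk (c.fst ≫ k) c.snd) ≫ ev = g

/-- Evaluation of `k : Z ⟶ Hom(A,B)` at `a : Z ⟶ A`. -/
def InternalHom.apply {A B : D} (H : InternalHom A B) {Z : D} (k : Z ⟶ H.obj) (a : Z ⟶ A) :
    Z ⟶ B :=
  H.isLimit.lift (BinaryFan.mk k a) ≫ H.ev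

/-- The object of right homotopy inverses: the pullback of
`(∂₀_*, ∂₁_*) : Hom(B,P_B) ⟶ Hom(B,B) × Hom(B,B)` along
`(c_{B,A,B}, const_B) : Hom(A,B) × Hom(B,A) ⟶ Hom(B,B) × Hom(B,B)`. The internal composition map
`c`, the constant map at the identity and the postcomposition maps `∂ᵢ_*` are
determined by their effect on generalised elements. -/
structure RInvObject {Fib : MorphismProperty D} {A B : D} (P : PathObject Fib B)
    (HAB : InternalHom A B) (HBA : InternalHom B A) where
  HBB : InternalHom B B
  HBP : InternalHom B P.obj
  prod : BinaryFan HAB.obj HBA.obj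
  prodIsLimit : IsLimit prod
  sq : BinaryFan HBB.obj HBB.obj
  sqIsLimit : IsLimit sq
  compConst : prod.pt ⟶ sq.pt
  compConst_fst : ∀ {Z : D} (k : Z ⟶ prod.pt) (b : Z ⟶ B),
    HBB.apply (k ≫ compConst ≫ sq.fst) b = HAB.apply (k ≫ prod.fst) (HBA.apply (k ≫ prod.snd) b)
  compConst_snd : ∀ {Z : D} (k : Z ⟶ prod.pt) (b : Z ⟶ B),
    HBB.apply (k ≫ compConst ≫ sq.snd) b = b
  ends : HBP.obj ⟶ sq.pt
  ends_fst : ∀ {Z : D} (k : Z ⟶ HBP.obj) (b : Z ⟶ B),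
    HBB.apply (k ≫ ends ≫ sq.fst) b = HBP.apply k b ≫ P.d₀
  ends_snd : ∀ {Z : D} (k : Z ⟶ HBP.obj) (b : Z ⟶ B),
    HBB.apply (k ≫ ends ≫ sq.snd) b = HBP.apply k b ≫ P.d₁
  obj : D
  toPath : obj ⟶ HBP.obj
  toProd : obj ⟶ prod.pt
  isPullback : IsPullback toPath toProd ends compConst

/-- An object of equivalences `Eq(A,B)`: the pullback of `LInv(A,B)` and `RInv(A,B)` over
`Hom(A,B)`. Here `LInv(A,B)` is `RInv(B,A)`, projected to the factor `Hom(A,B)`. -/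
structure EqObject (Fib : MorphismProperty D) (A B : D) where
  PA : PathObject Fib A
  PB : PathObject Fib B
  HAB : InternalHom A B
  HBA : InternalHom B A
  rInv : RInvObject PB HAB HBA
  lInv : RInvObject PA HBA HAB
  obj : D
  toL : obj ⟶ lInv.obj
  toR : obj ⟶ rInv.obj
  isPullback : IsPullback toL toR (lInv.toProd ≫ lInv.prod.snd) (rInv.toProd ≫ rInv.prod.fst)

namespace EqObject

variable {Fib : MorphismProperty D} {A B : D} (Q : EqObject Fib A B)

/-- The underlying map. -/
def map : Q.obj ⟶ Q.HAB.obj := Q.toR ≫ Q.rInv.toProd ≫ Q.rInv.prod.fst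

/-- The right homotopy inverse. -/
def right : Q.obj ⟶ Q.HBA.obj := Q.toR ≫ Q.rInv.toProd ≫ Q.rInv.prod.snd

/-- The left homotopy inverse. -/
def left : Q.obj ⟶ Q.HBA.obj := Q.toL ≫ Q.lInv.toProd ≫ Q.lInv.prod.fst

/-- The homotopy for the right inverse. -/
def rightHomotopy : Q.obj ⟶ Q.rInv.HBP.obj := Q.toR ≫ Q.rInv.toPath

/-- The homotopy for the left inverse. -/
def leftHomotopy : Q.obj ⟶ Q.lInv.HBP.obj := Q.toL ≫ Q.lInv.toPath

end EqObject

end InternalHom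

section Tribes

variable {C : Type u} [Category.{v} C] (Fib : MorphismProperty C)

/-- Tribes. -/
structure IsTribe : Prop where
  isMultiplicative : Fib.IsMultiplicative
  exists_terminal : HasTerminal C
  terminal_fib : ∀ {X T : C}, IsTerminal T → ∀ f : X ⟶ T, Fib f
  exists_pullback : ∀ {X Y Z : C} (f : X ⟶ Z) (g : Y ⟶ Z), Fib g → HasPullback f g
  stable : Fib.IsStableUnderBaseChange
  factorisation : ∀ {X Y : C} (f : X ⟶ Y), ∃ (Z : C) (i : X ⟶ Z) (p : Z ⟶ Y),
    Anodyne Fib i ∧ Fib p ∧ i ≫ p = f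
  anodyne_stable : ∀ {P X Y Z : C} {fst : P ⟶ X} {snd : P ⟶ Y} {i : X ⟶ Z} {p : Y ⟶ Z},
    IsPullback fst snd i p → Fib p → Anodyne Fib i → Anodyne Fib snd

/-- A value `Π_p(q)` of the partially defined right adjoint to the pullback functor
`p^* : C/Y ⟶ C/X`, with its counit `ev` from the pullback `pb` of `Π_p(q)` along `p`. -/
structure DependentProduct {X Y E : C} (p : X ⟶ Y) (q : E ⟶ X) where
  obj : C
  hom : obj ⟶ Y
  pb : C
  fst : pb ⟶ obj
  snd : pb ⟶ X
  isPullback : IsPullback fst snd hom p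
  ev : pb ⟶ E
  ev_comp : ev ≫ q = snd
  universal : ∀ {Z V : C} (f : Z ⟶ Y) (v₁ : V ⟶ Z) (v₂ : V ⟶ X), IsPullback v₁ v₂ f p →
    ∀ g : V ⟶ E, g ≫ q = v₂ → ∃! k : Z ⟶ obj, k ≫ hom = f ∧
      ∃ m : V ⟶ pb, m ≫ fst = v₁ ≫ k ∧ m ≫ snd = v₂ ∧ m ≫ ev = g

/-- `π`-tribes: tribes in which `Π_p(q)` exists and is a fibration for all composable fibrations
`q` and `p`, and in which `Π_p` preserves homotopy equivalences between fibrant slices. (The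
path objects and homotopies of the fibrant slice over `X` are those of `Over X` with respect to
the maps whose underlying map is a fibration.) -/
structure IsPiTribe : Prop extends IsTribe Fib where
  exists_pi : ∀ {X Y E : C} (p : X ⟶ Y) (q : E ⟶ X), Fib p → Fib q →
    ∃ P : DependentProduct p q, Fib P.hom
  pi_preserves : ∀ {X Y E₁ E₂ : C} (p : X ⟶ Y) (q₁ : E₁ ⟶ X) (q₂ : E₂ ⟶ X), Fib p → Fib q₁ →
    Fib q₂ → ∀ (e : E₁ ⟶ E₂) (he : e ≫ q₂ = q₁),
    IsHomotopyEquiv (Fib.over (X := X)) (Over.homMk e he : Over.mk q₁ ⟶ Over.mk q₂) →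
    ∀ (P₁ : DependentProduct p q₁) (P₂ : DependentProduct p q₂) (k : P₁.obj ⟶ P₂.obj)
      (hk : k ≫ P₂.hom = P₁.hom) (m : P₁.pb ⟶ P₂.pb), m ≫ P₂.fst = P₁.fst ≫ k →
      m ≫ P₂.snd = P₁.snd → m ≫ P₂.ev = P₁.ev ≫ e →
      IsHomotopyEquiv (Fib.over (X := Y)) (Over.homMk k hk : Over.mk P₁.hom ⟶ Over.mk P₂.hom)

/-- The data entering the definition of univalence of `p : E ⟶ B`: the pullbacks `π₁^*p` and
`π₂^*p` over `B × B`, the object of equivalences `Eq_B(E) = Eq_{B × B}(π₁^*p, π₂^*p)`, and the map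
`δ : B ⟶ Eq_B(E)` over `B × B` which classifies the identity of `E`, with itself as left and right
inverse and with constant homotopies. -/
structure UnivalenceData {E B : C} (p : E ⟶ B) where
  sq : BinaryFan B B
  isLimit : IsLimit sq
  E₁ : Over sq.pt
  E₂ : Over sq.pt
  s₁ : E₁.left ⟶ E
  s₂ : E₂.left ⟶ E
  isPullback₁ : IsPullback s₁ E₁.hom p sq.fst
  isPullback₂ : IsPullback s₂ E₂.hom p sq.snd
  Q : EqObject (Fib.over (X := sq.pt)) E₁ E₂
  /-- the diagonal of `B` -/
  dia : B ⟶ sq.pt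
  dia_fst : dia ≫ sq.fst = 𝟙 B
  dia_snd : dia ≫ sq.snd = 𝟙 B
  δ : Over.mk dia ⟶ Q.obj
  /-- the canonical maps from `E`, the pullback of `E₁` and of `E₂` along the diagonal -/
  i₁ : Over.mk (p ≫ dia) ⟶ E₁
  i₁_s₁ : i₁.left ≫ s₁ = 𝟙 E
  i₂ : Over.mk (p ≫ dia) ⟶ E₂
  i₂_s₂ : i₂.left ≫ s₂ = 𝟙 E
  δ_map : Q.HAB.apply ((Over.homMk p rfl : Over.mk (p ≫ dia) ⟶ Over.mk dia) ≫ δ ≫ Q.map) i₁ = i₂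
  δ_right : Q.HBA.apply ((Over.homMk p rfl : Over.mk (p ≫ dia) ⟶ Over.mk dia) ≫ δ ≫ Q.right) i₂ = i₁
  δ_left : Q.HBA.apply ((Over.homMk p rfl : Over.mk (p ≫ dia) ⟶ Over.mk dia) ≫ δ ≫ Q.left) i₂ = i₁
  δ_rightHomotopy : Q.rInv.HBP.apply
    ((Over.homMk p rfl : Over.mk (p ≫ dia) ⟶ Over.mk dia) ≫ δ ≫ Q.rightHomotopy) i₂ = i₂ ≫ Q.PB.r
  δ_leftHomotopy : Q.lInv.HBP.apply
    ((Over.homMk p rfl : Over.mk (p ≫ dia) ⟶ Over.mk dia) ≫ δ ≫ Q.leftHomotopy) i₁ = i₁ ≫ Q.PA.r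

/-- Univalent fibrations: `δ : B ⟶ Eq_B(E)` is a homotopy equivalence. (In a `π`-tribe the data
exist, and the condition does not depend on their choice.) -/
def IsUnivalentFibration {E B : C} (p : E ⟶ B) : Prop :=
  Fib p ∧ ∃ d : UnivalenceData Fib p, IsHomotopyEquiv Fib d.δ.left

/-- The class `S_p` of all pullbacks of `p`. -/
def pullbacksOf {E B : C} (p : E ⟶ B) : MorphismProperty C := fun A X f =>
  ∃ (t : A ⟶ E) (χ : X ⟶ B), IsPullback t f p χ

/-- A local class `S` is closed if it is closed under composition and under the
dependent products `Π_p(f)` along members `p` of `S`. -/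
def IsClosedClass (S : MorphismProperty C) : Prop :=
  S.IsStableUnderComposition ∧
    ∀ {X Y A : C} (p : X ⟶ Y) (f : A ⟶ X), S p → S f → ∀ P : DependentProduct p f, S P.hom

/-- Enough univalent fibrations: every fibration is a pullback of a univalent fibration `p` for
which `S_p` is closed. -/
def HasEnoughUnivalentFibrations : Prop :=
  ∀ {A X : C} (f : A ⟶ X), Fib f → ∃ (E B : C) (p : E ⟶ B),
    IsUnivalentFibration Fib p ∧ pullbacksOf p f ∧ IsClosedClass (pullbacksOf p)

end Tribes

end Tribe

end

/-! ## Fibrations, anodyne maps and fibrewise homotopy -/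

namespace Tribe

section Clan

variable {D : Type u} [Category.{v} D] {Fib : MorphismProperty D}

/-! The fibrations are, up to isomorphism, chains of dependent projections, so closure properties
and lifting can be checked one projection at a time (`fibrations_induction`,
`anodyne_of_exists_sec`). In this language `J` with its computation rule says exactly that
reflexivity is anodyne (`anodyne_refl`), and `Π` with β and η is the universal property of the
dependent product of two projections (`piProduct`). Iterating in the domain and then in the base
gives dependent products for all fibrations. Transposing lifting problems through them shows that
anodyne maps are stable under pullback along fibrations (`anodyne_stable_of_exists_pi`), and this
stability yields transport along paths.

Factorisations come by induction on the length of the codomain: a map into `Γ.A` is factored over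
`Γ`, extended along the anodyne part to a section, and the paths out of that section are adjoined
(`exists_based_path`).

That `Π` preserves homotopy equivalences is function extensionality, phrased as `Extensional`:
homotopic transposes have homotopic adjuncts. It holds for `Π`-types by hypothesis and passes to
retracts and to composite bases. This is enough because, by `Σ`, every fibration that is not an
isomorphism is a retract of a projection (`isIso_or_exists_retract`). The relation `FibreHomotopic`
quantifies over all reflexive fibrations, so it depends on no choice of path object and is available
before path objects have been constructed.

For univalence, two notions of equivalence must be compared. The tribe's object of equivalences is
built from exponentials of path objects, that is, from pointwise identifications; the type `EquivTy`
uses identity types of function types and nested sums, without η for `Σ`. It suffices to produce a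
comparison map with a section up to homotopy (`exists_eqObject_comparison`). Indeed `δ` is the
composite of reflexivity, `idToEquivMap` and this comparison. Reflexivity has a homotopy section
because it is anodyne, `idToEquivMap` because the universe is univalent. Homotopy sections compose,
and `δ` has a strict retraction, namely the projection to the base; a split monomorphism with a
homotopy section is a homotopy equivalence (`HasHomotopySection.isHomotopyEquiv`).

With η for `Σ`, a chain of projections collapses to one, so each fibration is an isomorphism or a
pullback of the projection of a universe. The codes for `Σ` and `Π` close the latter class;
isomorphisms are the pullbacks of the identity of the terminal object, which is univalent for
trivial reasons. -/

/-- Classes of fibrations closed under composition and under pullback along arbitrary maps. -/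
structure IsClan (Fib : MorphismProperty D) : Prop where
  isMultiplicative : Fib.IsMultiplicative
  exists_pullback : ∀ {X Y Z : D} (f : X ⟶ Z) (g : Y ⟶ Z), Fib g →
    ∃ (P : D) (a : P ⟶ X) (b : P ⟶ Y), IsPullback a b f g
  stable : Fib.IsStableUnderBaseChange

lemma IsClan.comp (hc : IsClan Fib) {X Y Z : D} {f : X ⟶ Y} {g : Y ⟶ Z} (hf : Fib f)
    (hg : Fib g) : Fib (f ≫ g) :=
  have := hc.isMultiplicative
  Fib.comp_mem _ _ hf hg

lemma IsClan.base_change (hc : IsClan Fib) {P X Y Z : D} {a : P ⟶ X} {b : P ⟶ Y} {f : X ⟶ Z}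
    {g : Y ⟶ Z} (h : IsPullback a b f g) (hf : Fib f) : Fib b :=
  have := hc.stable
  Fib.of_isPullback h hf

lemma exists_lift {A B X Y : D} {i : A ⟶ B} {p : X ⟶ Y} (hi : Anodyne Fib i) (hp : Fib p)
    {t : A ⟶ X} {b : B ⟶ Y} (h : t ≫ p = i ≫ b) : ∃ l : B ⟶ X, i ≫ l = t ∧ l ≫ p = b := by
  have := hi p hp
  have sq : CommSq t i p b := ⟨h⟩
  exact ⟨sq.lift, sq.fac_left, sq.fac_right⟩

lemma anodyne_of_exists_lift {A B : D} {i : A ⟶ B}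
    (H : ∀ {X Y : D} (p : X ⟶ Y), Fib p → ∀ (t : A ⟶ X) (b : B ⟶ Y), t ≫ p = i ≫ b →
      ∃ l : B ⟶ X, i ≫ l = t ∧ l ≫ p = b) : Anodyne Fib i := fun _ _ p hp =>
  ⟨fun {t b} sq => by
    obtain ⟨l, h₁, h₂⟩ := H p hp t b sq.w
    exact ⟨⟨⟨l, h₁, h₂⟩⟩⟩⟩

/-- To check that a map is anodyne it suffices to extend partial sections of fibrations over its
codomain. -/
lemma anodyne_of_exists_section (hc : IsClan Fib) {A B : D} {i : A ⟶ B}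
    (H : ∀ {X : D} (p : X ⟶ B), Fib p → ∀ (t : A ⟶ X), t ≫ p = i →
      ∃ l : B ⟶ X, i ≫ l = t ∧ l ≫ p = 𝟙 B) : Anodyne Fib i := by
  refine anodyne_of_exists_lift fun {X Y} p hp t b h => ?_
  obtain ⟨P, x, y, hP⟩ := hc.exists_pullback b p hp
  obtain ⟨l, h₁, h₂⟩ := H x (hc.base_change hP.flip hp) (hP.lift i t h.symm) (by simp)
  refine ⟨l ≫ y, by rw [reassoc_of% h₁]; simp, ?_⟩
  rw [Category.assoc, ← hP.w, reassoc_of% h₂]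

lemma anodyne_comp {X Y Z : D} {i : X ⟶ Y} {j : Y ⟶ Z} (hi : Anodyne Fib i)
    (hj : Anodyne Fib j) : Anodyne Fib (i ≫ j) :=
  have : (Fib.llp).IsMultiplicative := inferInstance
  Fib.llp.comp_mem _ _ hi hj

lemma anodyne_of_isIso {X Y : D} (i : X ⟶ Y) [IsIso i] : Anodyne Fib i :=
  fun _ _ _ _ => inferInstance

/-- Stability of anodyne maps under pullback along fibrations follows from the existence of
dependent products. -/
theorem anodyne_stable_of_exists_pi (hc : IsClan Fib)
    (hpi : ∀ {X Y E : D} (p : X ⟶ Y) (q : E ⟶ X), Fib p → Fib q →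
      ∃ P : DependentProduct p q, Fib P.hom)
    {P X Y Z : D} {fst : P ⟶ X} {snd : P ⟶ Y} {i : X ⟶ Z} {p : Y ⟶ Z}
    (h : IsPullback fst snd i p) (hp : Fib p) (hi : Anodyne Fib i) : Anodyne Fib snd := by
  refine anodyne_of_exists_section hc fun {E} q hq t ht => ?_
  -- A partial section `t` of `q` on the pullback of `i` is the transpose of a partial section of
  -- `Π_p(q)` on `i`. The latter extends because `i` is anodyne, and its extension is transposed
  -- back.
  obtain ⟨Q, hQ⟩ := hpi p q hp hq
  obtain ⟨k, ⟨hk, m, hm₁, hm₂, hm₃⟩, -⟩ := Q.universal i fst snd h t ht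
  obtain ⟨l, hl₁, hl₂⟩ := exists_lift hi hQ (t := k) (b := 𝟙 Z) (by simpa using hk)
  have hw : (p ≫ l) ≫ Q.hom = 𝟙 Y ≫ p := by simp [hl₂]
  have hm : snd ≫ Q.isPullback.lift (p ≫ l) (𝟙 Y) hw = m := by
    apply Q.isPullback.hom_ext
    · rw [Category.assoc, IsPullback.lift_fst, hm₁, ← h.w_assoc, hl₁]
    · rw [Category.assoc, IsPullback.lift_snd, hm₂, Category.comp_id]
  refine ⟨Q.isPullback.lift (p ≫ l) (𝟙 Y) hw ≫ Q.ev, ?_, ?_⟩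
  · rw [reassoc_of% hm, hm₃]
  · rw [Category.assoc, Q.ev_comp, IsPullback.lift_snd]

/-- Stability of anodyne maps under pullback along fibrations. -/
def Frobenius (Fib : MorphismProperty D) : Prop :=
  ∀ {P X Y Z : D} {fst : P ⟶ X} {snd : P ⟶ Y} {i : X ⟶ Z} {p : Y ⟶ Z},
    IsPullback fst snd i p → Fib p → Anodyne Fib i → Anodyne Fib snd

/-- The map `F ⟶ F ×_E P` given by an anodyne section `r` of `d₀ : P ⟶ E` is anodyne. -/
lemma anodyne_section_pullback (hc : IsClan Fib) (hF : Frobenius Fib) {F E P W : D}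
    {q : F ⟶ E} (hq : Fib q) {r : E ⟶ P} (hr : Anodyne Fib r) {d₀ : P ⟶ E} (h₀ : r ≫ d₀ = 𝟙 E)
    {a : W ⟶ F} {b : W ⟶ P} (hW : IsPullback a b q d₀) {s : F ⟶ W} (ha : s ≫ a = 𝟙 F)
    (hb : s ≫ b = q ≫ r) : Anodyne Fib s := by
  -- `s` is the base change of `r` along `b`, and `b` is a fibration as a base change of `q`.
  have : IsPullback q s r b := by
    refine (IsPullback.of_right ?_ hb hW).flip
    rw [ha, h₀]
    exact IsPullback.of_horiz_isIso ⟨by simp⟩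
  exact hF this (hc.base_change hW hq) hr

/-- Transport along paths in a fibration, computing strictly on reflexivity. -/
lemma exists_transport (hc : IsClan Fib) (hF : Frobenius Fib) {F E P W : D}
    {q : F ⟶ E} (hq : Fib q) {r : E ⟶ P} (hr : Anodyne Fib r) {d₀ d₁ : P ⟶ E}
    (h₀ : r ≫ d₀ = 𝟙 E) (h₁ : r ≫ d₁ = 𝟙 E) {a : W ⟶ F} {b : W ⟶ P}
    (hW : IsPullback a b q d₀) :
    ∃ τ : W ⟶ F, τ ≫ q = b ≫ d₁ ∧
      hW.lift (𝟙 F) (q ≫ r) (by simp [h₀]) ≫ τ = 𝟙 F := by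
  obtain ⟨τ, h, h'⟩ := exists_lift (anodyne_section_pullback hc hF hq hr h₀ hW
    (s := hW.lift (𝟙 F) (q ≫ r) (by simp [h₀])) (by simp) (by simp)) hq (t := 𝟙 F)
    (b := b ≫ d₁) (by simp [h₁])
  exact ⟨τ, h', h⟩

/-- A fibration with a section up to homotopy has a section. -/
lemma exists_section_of_homotopy (hc : IsClan Fib) (hF : Frobenius Fib) {F E P : D}
    {q : F ⟶ E} (hq : Fib q) {r : E ⟶ P} (hr : Anodyne Fib r) {d₀ d₁ : P ⟶ E}
    (h₀ : r ≫ d₀ = 𝟙 E) (h₁ : r ≫ d₁ = 𝟙 E) (t : E ⟶ F) (H : E ⟶ P) (hH₀ : H ≫ d₀ = t ≫ q)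
    (hH₁ : H ≫ d₁ = 𝟙 E) : ∃ s : E ⟶ F, s ≫ q = 𝟙 E := by
  obtain ⟨W, b, a, hW⟩ := hc.exists_pullback d₀ q hq
  obtain ⟨τ, hτ, -⟩ := exists_transport hc hF hq hr h₀ h₁ hW.flip
  -- The point `t` lies over the source of `H`; transporting it along `H` moves it over the target,
  -- which is the identity.
  exact ⟨hW.lift H t hH₀ ≫ τ, by simp [hτ, hH₁]⟩

/-- A strong deformation retract is anodyne, where the homotopy takes place in an object `T` of
which the codomain is a retract. -/
lemma anodyne_of_deformation (hc : IsClan Fib) (hF : Frobenius Fib) {A B T P : D}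
    {u : A ⟶ B} (π : B ⟶ A) (hu : u ≫ π = 𝟙 A) (s : B ⟶ T) (ρ : T ⟶ B) (hs : s ≫ ρ = 𝟙 B)
    {r : T ⟶ P} (hr : Anodyne Fib r) {d₀ d₁ : P ⟶ T} (h₀ : r ≫ d₀ = 𝟙 T)
    (h₁ : r ≫ d₁ = 𝟙 T) (H : B ⟶ P) (hH₀ : H ≫ d₀ = π ≫ u ≫ s) (hH₁ : H ≫ d₁ = s)
    (hH : u ≫ H = u ≫ s ≫ r) : Anodyne Fib u := by
  refine anodyne_of_exists_section hc fun {X} p hp t ht => ?_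
  -- Paths are only given in `T`, so the fibration is first pulled back to `T` along `ρ`. The
  -- extension of `t` is then `π ≫ t` transported along `H`.
  obtain ⟨F, q, y, hF'⟩ := hc.exists_pullback ρ p hp
  have hq : Fib q := hc.base_change hF'.flip hp
  obtain ⟨W, b, a, hW⟩ := hc.exists_pullback d₀ q hq
  obtain ⟨τ, hτ, hτ'⟩ := exists_transport hc hF hq hr h₀ h₁ hW.flip
  have e₁ : (π ≫ u ≫ s) ≫ ρ = (π ≫ t) ≫ p := by simp [hs, ht]
  let c : B ⟶ W := hW.lift H (hF'.lift (π ≫ u ≫ s) (π ≫ t) e₁) (by simp [hH₀])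
  -- On `A` the homotopy is reflexivity, where transport is strictly the identity; hence the
  -- extension restricts to `t` on the nose.
  refine ⟨c ≫ τ ≫ y, ?_, ?_⟩
  · have : u ≫ c = hF'.lift (u ≫ s) t (by simp [hs, ht]) ≫
        hW.flip.lift (𝟙 F) (q ≫ r) (by simp [h₀]) := by
      apply hW.hom_ext
      · simp [c, hH]
      · simp only [c, Category.assoc, IsPullback.lift_snd, IsPullback.lift_fst]
        apply hF'.hom_ext
        · simp [reassoc_of% hu]
        · simp [reassoc_of% hu]
    rw [reassoc_of% this, reassoc_of% hτ']
    simp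
  · have : (c ≫ τ) ≫ q = s := by simp [hτ, c, hH₁]
    rw [Category.assoc, Category.assoc, ← hF'.w, ← Category.assoc, ← Category.assoc, this, hs]

/-- Two maps into the total space of `q : E ⟶ X` are fibrewise homotopic if they are related by
every reflexive fibration over `E ×_X E`. -/
def FibreHomotopic (Fib : MorphismProperty D) {X E Z : D} (q : E ⟶ X) (a b : Z ⟶ E) : Prop :=
  a ≫ q = b ≫ q ∧ ∀ {K P : D} (π₀ π₁ : K ⟶ E), IsPullback π₀ π₁ q q →
    ∀ (e : P ⟶ K) (r : E ⟶ P), Fib e → r ≫ e ≫ π₀ = 𝟙 E → r ≫ e ≫ π₁ = 𝟙 E →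
      ∃ H : Z ⟶ P, H ≫ e ≫ π₀ = a ∧ H ≫ e ≫ π₁ = b

/-! ### Calculus of fibrewise homotopies -/

namespace FibreHomotopic

lemma rfl' {X E Z : D} (q : E ⟶ X) (a : Z ⟶ E) : FibreHomotopic Fib q a a :=
  ⟨rfl, fun _ _ _ e r _ h₀ h₁ => ⟨a ≫ r, by simp [h₀], by simp [h₁]⟩⟩

lemma of_eq {X E Z : D} (q : E ⟶ X) {a b : Z ⟶ E} (h : a = b) : FibreHomotopic Fib q a b :=
  h ▸ rfl' q a

lemma pre {X E Z Z' : D} {q : E ⟶ X} {a b : Z ⟶ E} (h : FibreHomotopic Fib q a b)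
    (m : Z' ⟶ Z) : FibreHomotopic Fib q (m ≫ a) (m ≫ b) :=
  ⟨by simp [h.1], fun π₀ π₁ hK e r he h₀ h₁ => by
    obtain ⟨H, h₀, h₁⟩ := h.2 π₀ π₁ hK e r he h₀ h₁
    exact ⟨m ≫ H, by simp [h₀], by simp [h₁]⟩⟩

/-- A reflexive fibration over `E ×_X E` pulls back along `t × t` to a reflexive fibration over `E'
×_X' E'`; a witness for the pulled back relation projects to one for the original. -/
lemma map (hc : IsClan Fib) {X E X' E' Z : D} {q' : E' ⟶ X'} (hq' : Fib q') {q : E ⟶ X}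
    {a b : Z ⟶ E'} (h : FibreHomotopic Fib q' a b) (t : E' ⟶ E) (σ : X' ⟶ X)
    (w : t ≫ q = q' ≫ σ) : FibreHomotopic Fib q (a ≫ t) (b ≫ t) := by
  refine ⟨by simp [w, reassoc_of% h.1], fun {K P} π₀ π₁ hK e r he h₀ h₁ => ?_⟩
  obtain ⟨K', x₀, x₁, hK'⟩ := hc.exists_pullback q' q' hq'
  let k : K' ⟶ K := hK.lift (x₀ ≫ t) (x₁ ≫ t) (by simp [w, hK'.w_assoc])
  obtain ⟨P', e', g, hP'⟩ := hc.exists_pullback k e he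
  have hr : (hK'.lift (𝟙 E') (𝟙 E') rfl) ≫ k = (t ≫ r) ≫ e := by
    apply hK.hom_ext <;> simp [k, h₀, h₁]
  obtain ⟨H, H₀, H₁⟩ := h.2 x₀ x₁ hK' e' (hP'.lift _ _ hr) (hc.base_change hP'.flip he)
    (by simp) (by simp)
  refine ⟨H ≫ g, ?_, ?_⟩
  · rw [← H₀]; simp [← hP'.w_assoc, k]
  · rw [← H₁]; simp [← hP'.w_assoc, k]

/-- A relation generated by an anodyne `r` is the least reflexive one: lifting the reflexivity of
any other reflexive fibration against `r` maps `P` into it. -/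
lemma of_anodyne {X E Z P : D} {q : E ⟶ X} {r : E ⟶ P} (hr : Anodyne Fib r) {d₀ d₁ : P ⟶ E}
    (h₀ : r ≫ d₀ = 𝟙 E) (h₁ : r ≫ d₁ = 𝟙 E) (h : d₀ ≫ q = d₁ ≫ q) (H : Z ⟶ P) :
    FibreHomotopic Fib q (H ≫ d₀) (H ≫ d₁) := by
  refine ⟨by simp [h], fun {K P'} π₀ π₁ hK e' r' he' h₀' h₁' => ?_⟩
  obtain ⟨l, hl, hl'⟩ := exists_lift hr he' (t := r') (b := hK.lift d₀ d₁ h)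
    (by apply hK.hom_ext <;> simp [h₀, h₁, h₀', h₁'])
  exact ⟨H ≫ l, by simp [reassoc_of% hl'], by simp [reassoc_of% hl']⟩

/-- Maps which agree on an anodyne map are homotopic. -/
lemma of_anodyne_comp_eq {X E Z A : D} {q : E ⟶ X} {i : A ⟶ Z} (hi : Anodyne Fib i)
    {a b : Z ⟶ E} (h : i ≫ a = i ≫ b) (hq : a ≫ q = b ≫ q) : FibreHomotopic Fib q a b := by
  refine ⟨hq, fun {K P'} π₀ π₁ hK e' r' he' h₀' h₁' => ?_⟩
  obtain ⟨l, hl, hl'⟩ := exists_lift hi he' (t := i ≫ a ≫ r') (b := hK.lift a b hq)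
    (by apply hK.hom_ext <;> simp [h₀', h₁', h])
  exact ⟨l, by simp [reassoc_of% hl'], by simp [reassoc_of% hl']⟩

/-- The second homotopy is realised in a genuine path object `P`, the first in the arbitrary
relation `P'`. Pairs consisting of an element of `P'` and a path from its target contain `P'` as an
anodyne subobject, by pullback of `r`, so the identity of `P'` extends to them with the new
endpoints. This moves the target of the first homotopy along the second. -/
lemma trans (hc : IsClan Fib) (hF : Frobenius Fib) {X E Z P K₀ : D} {q : E ⟶ X} (hq : Fib q)
    {x₀ x₁ : K₀ ⟶ E} (hK₀ : IsPullback x₀ x₁ q q) {p : P ⟶ K₀} (hp : Fib p)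
    {r : E ⟶ P} (hr : Anodyne Fib r) (h₀ : r ≫ p ≫ x₀ = 𝟙 E) (h₁ : r ≫ p ≫ x₁ = 𝟙 E)
    {a b c : Z ⟶ E} (h : FibreHomotopic Fib q a b) (h' : FibreHomotopic Fib q b c) :
    FibreHomotopic Fib q a c := by
  refine ⟨h.1.trans h'.1, fun {K P'} π₀ π₁ hK e' r' he' h₀' h₁' => ?_⟩
  obtain ⟨H, H₀, H₁⟩ := h.2 π₀ π₁ hK e' r' he' h₀' h₁'
  obtain ⟨H', H₀', H₁'⟩ := h'.2 x₀ x₁ hK₀ p r hp h₀ h₁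
  have hd : Fib (e' ≫ π₁) := hc.comp he' (hc.base_change hK hq)
  obtain ⟨W, y, x, hW⟩ := hc.exists_pullback (p ≫ x₀) (e' ≫ π₁) hd
  have hs := anodyne_section_pullback hc hF hd hr h₀ hW.flip
    (s := hW.lift ((e' ≫ π₁) ≫ r) (𝟙 _) (by simp [h₀])) (by simp) (by simp)
  have hw : (x ≫ e' ≫ π₀) ≫ q = (y ≫ p ≫ x₁) ≫ q := by
    have := hW.w
    simp only [Category.assoc] at this ⊢
    rw [hK.w, ← hK₀.w, reassoc_of% this]
  obtain ⟨l, hl, hl'⟩ := exists_lift hs he' (t := 𝟙 P') (b := hK.lift _ _ hw)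
    (by apply hK.hom_ext <;> simp [h₁])
  refine ⟨hW.lift H' H (by simp [H₀', H₁]) ≫ l, ?_, ?_⟩
  · simp [reassoc_of% hl', H₀]
  · simp [reassoc_of% hl', H₁']

end FibreHomotopic

end Clan

end Tribe

/-! ## Dependent products -/

namespace Tribe

section DependentProducts

variable {D : Type u} [Category.{v} D] {Fib : MorphismProperty D}

namespace DependentProduct

lemma hom_ext {X Y E : D} {p : X ⟶ Y} {q : E ⟶ X} (P : DependentProduct p q) {Z V : D}
    {k k' : Z ⟶ P.obj} (hk : k ≫ P.hom = k' ≫ P.hom) {v₁ : V ⟶ Z} {v₂ : V ⟶ X}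
    (hV : IsPullback v₁ v₂ (k ≫ P.hom) p) (m m' : V ⟶ P.pb) (h₁ : m ≫ P.fst = v₁ ≫ k)
    (h₂ : m ≫ P.snd = v₂) (h₁' : m' ≫ P.fst = v₁ ≫ k') (h₂' : m' ≫ P.snd = v₂)
    (h : m ≫ P.ev = m' ≫ P.ev) : k = k' := by
  obtain ⟨l, -, hl⟩ := P.universal (k ≫ P.hom) v₁ v₂ hV (m ≫ P.ev) (by rw [Category.assoc,
    P.ev_comp, h₂])
  rw [hl k ⟨rfl, m, h₁, h₂, rfl⟩, hl k' ⟨hk.symm, m', h₁', h₂', h.symm⟩]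

/-- The dependent product of a composite `q₂ ≫ q₁` along `p`. -/
def compDomain {X Y E₁ E₂ W : D} {p : X ⟶ Y} {q₁ : E₁ ⟶ X} {q₂ : E₂ ⟶ E₁}
    (P₁ : DependentProduct p q₁) {x : W ⟶ E₂} {w : W ⟶ P₁.pb} (hW : IsPullback x w q₂ P₁.ev)
    (P₂ : DependentProduct P₁.fst w) : DependentProduct p (q₂ ≫ q₁) where
  obj := P₂.obj
  hom := P₂.hom ≫ P₁.hom
  pb := P₂.pb
  fst := P₂.fst
  snd := P₂.snd ≫ P₁.snd
  isPullback := P₂.isPullback.flip.paste_horiz P₁.isPullback.flip |>.flip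
  ev := P₂.ev ≫ x
  ev_comp := by
    have := hW.w
    rw [Category.assoc, ← Category.assoc x, this, Category.assoc, P₁.ev_comp, ← Category.assoc,
      P₂.ev_comp]
  universal := fun {Z V} f v₁ v₂ hV g hg => by
    -- The image of `g` in `E₁` is transposed first. Then `V` becomes the pullback of `P₁.fst` along
    -- `k₁`, and `g` itself can be transposed along `P₁.fst`.
    obtain ⟨k₁, ⟨hk₁, m₁, h₁, h₂, h₃⟩, hu₁⟩ := P₁.universal f v₁ v₂ hV (g ≫ q₂) (by simpa using hg)
    have hV' : IsPullback v₁ m₁ k₁ P₁.fst := by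
      refine (IsPullback.of_right (t := P₁.isPullback.flip) ?_ h₁).flip
      rw [h₂, hk₁]; exact hV.flip
    obtain ⟨k, ⟨hk, m, h₁', h₂', h₃'⟩, hu⟩ := P₂.universal k₁ v₁ m₁ hV' (hW.lift g m₁ h₃.symm)
      (by simp)
    refine ⟨k, ⟨by rw [← hk₁, ← hk, Category.assoc], m, h₁', by rw [← Category.assoc, h₂', h₂],
      by rw [← Category.assoc, h₃']; simp⟩, ?_⟩
    rintro k' ⟨hk', m', h₄, h₅, h₆⟩
    have e : k' ≫ P₂.hom = k₁ := by
      refine hu₁ _ ⟨by simpa using hk', m' ≫ P₂.snd, ?_, by simpa using h₅, ?_⟩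
      · rw [Category.assoc, ← P₂.isPullback.w, reassoc_of% h₄]
      · rw [← h₆, Category.assoc, Category.assoc, Category.assoc, hW.w, ← P₂.ev_comp,
          Category.assoc]
    have e' : m' ≫ P₂.snd = m₁ := by
      apply P₁.isPullback.hom_ext
      · rw [Category.assoc, ← P₂.isPullback.w, reassoc_of% h₄, e, h₁]
      · rw [Category.assoc, h₅, h₂]
    refine hu _ ⟨e, m', h₄, e', ?_⟩
    apply hW.hom_ext
    · simpa using h₆
    · simp [P₂.ev_comp, e']

/-- The dependent product along a composite `p₁ ≫ p₂`. -/
def compBase {X Y Z E W : D} {p₁ : X ⟶ Y} {p₂ : Y ⟶ Z} {q : E ⟶ X}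
    (hp₂ : ∀ {T : D} (f : T ⟶ Z), ∃ (U : D) (a : U ⟶ T) (b : U ⟶ Y), IsPullback a b f p₂)
    (P₁ : DependentProduct p₁ q) (P₂ : DependentProduct p₂ P₁.hom)
    {a : W ⟶ P₂.pb} {b : W ⟶ P₁.pb} (hW : IsPullback a b P₂.ev P₁.fst) :
    DependentProduct (p₁ ≫ p₂) q where
  obj := P₂.obj
  hom := P₂.hom
  pb := W
  fst := a ≫ P₂.fst
  snd := b ≫ P₁.snd
  isPullback := by
    have h := hW.flip.paste_horiz P₁.isPullback.flip
    rw [P₂.ev_comp] at h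
    exact (h.flip.paste_horiz P₂.isPullback)
  ev := b ≫ P₁.ev
  ev_comp := by rw [Category.assoc, P₁.ev_comp]
  universal := fun {T V} f v₁ v₂ hV g hg => by
    -- `U` is the intermediate stage: `V` lies over it by a base change of `p₁`, and it lies over
    -- `T` by a base change of `p₂`, so `g` is transposed twice.
    obtain ⟨U, u₁, u₂, hU⟩ := hp₂ f
    let c : V ⟶ U := hU.lift v₁ (v₂ ≫ p₁) (by simpa using hV.w)
    have hc : IsPullback c v₂ u₂ p₁ := by
      refine (IsPullback.of_bot (t := hU.flip) ?_ (by simp [c])).flip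
      simpa [c] using hV.flip
    obtain ⟨k₁, ⟨hk₁, m₁, h₁, h₂, h₃⟩, hu₁⟩ := P₁.universal u₂ c v₂ hc g hg
    obtain ⟨k, ⟨hk, m₂, h₁', h₂', h₃'⟩, hu⟩ := P₂.universal f u₁ u₂ hU k₁ hk₁
    refine ⟨k, ⟨hk, hW.lift (c ≫ m₂) m₁ (by rw [Category.assoc, h₃', h₁]), ?_, ?_, ?_⟩, ?_⟩
    · simp [h₁', c]
    · simp [h₂]
    · simp [h₃]
    rintro k' ⟨hk', m', h₄, h₅, h₆⟩
    -- A competitor `k'` determines its own map on `U`. Uniqueness along `p₁` identifies its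
    -- evaluation with `k₁`, after which uniqueness along `p₂` applies.
    let m₂' : U ⟶ P₂.pb := P₂.isPullback.lift (u₁ ≫ k') u₂ (by rw [Category.assoc, hk', hU.w])
    have e : m' ≫ a = c ≫ m₂' := by
      apply P₂.isPullback.hom_ext
      · simpa [m₂', c] using h₄
      · simp only [Category.assoc, m₂', IsPullback.lift_snd, c]
        rw [← P₂.ev_comp, hW.w_assoc, P₁.isPullback.w, ← h₅]
        simp
    refine hu _ ⟨hk', m₂', by simp [m₂'], by simp [m₂'], ?_⟩
    refine hu₁ _ ⟨by rw [Category.assoc, P₂.ev_comp]; simp [m₂'], m' ≫ b, ?_, by simpa using h₅,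
      by simpa using h₆⟩
    rw [Category.assoc, ← hW.w, reassoc_of% e]

/-- Dependent products are invariant under isomorphism of their data. -/
def ofIso {X Y E X' E' : D} {p : X ⟶ Y} {q : E ⟶ X} {p' : X' ⟶ Y} {q' : E' ⟶ X'}
    (P : DependentProduct p' q') (e : X ≅ X') (he : e.hom ≫ p' = p) (d : E ≅ E')
    (hd : d.hom ≫ q' = q ≫ e.hom) : DependentProduct p q where
  obj := P.obj
  hom := P.hom
  pb := P.pb
  fst := P.fst
  snd := P.snd ≫ e.inv
  isPullback := by
    refine P.isPullback.of_iso (Iso.refl _) (Iso.refl _) e.symm (Iso.refl _) ?_ ?_ ?_ ?_ <;>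
      simp [← he]
  ev := P.ev ≫ d.inv
  ev_comp := by
    rw [← P.ev_comp, Category.assoc, Category.assoc, ← cancel_mono e.hom]
    simp [← hd]
  universal := fun {Z V} f v₁ v₂ hV g hg => by
    have hV' : IsPullback v₁ (v₂ ≫ e.hom) f p' := by
      refine hV.of_iso (Iso.refl _) (Iso.refl _) e (Iso.refl _) ?_ ?_ ?_ ?_ <;> simp [← he]
    obtain ⟨k, ⟨hk, m, h₁, h₂, h₃⟩, hu⟩ := P.universal f v₁ (v₂ ≫ e.hom) hV' (g ≫ d.hom)
      (by rw [Category.assoc, hd, reassoc_of% hg])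
    refine ⟨k, ⟨hk, m, h₁, by rw [reassoc_of% h₂]; simp, by rw [reassoc_of% h₃]; simp⟩, ?_⟩
    rintro k' ⟨hk', m', h₄, h₅, h₆⟩
    exact hu _ ⟨hk', m', h₄, by rw [← h₅]; simp, by rw [← h₆]; simp⟩

/-- Dependent products along isomorphisms. -/
noncomputable def ofIsIsoBase {X Y E : D} (p : X ⟶ Y) [IsIso p] (q : E ⟶ X) :
    DependentProduct p q where
  obj := E
  hom := q ≫ p
  pb := E
  fst := 𝟙 E
  snd := q
  isPullback := IsPullback.of_horiz_isIso ⟨by simp⟩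
  ev := 𝟙 E
  ev_comp := by simp
  universal := fun {Z V} f v₁ v₂ hV g hg => by
    have : IsIso v₁ := hV.isIso_fst_of_isIso
    refine ⟨inv v₁ ≫ g, ⟨by simp [reassoc_of% hg, ← hV.w], g, by simp, hg, by simp⟩, ?_⟩
    rintro k ⟨-, m, h₁, -, h₃⟩
    simp only [Category.comp_id] at h₁ h₃
    simp [← h₃, h₁]

/-- Dependent products of isomorphisms. -/
noncomputable def ofIsIso {X Y E : D} (p : X ⟶ Y) (q : E ⟶ X) [IsIso q] : DependentProduct p q where
  obj := Y
  hom := 𝟙 Y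
  pb := X
  fst := p
  snd := 𝟙 X
  isPullback := IsPullback.of_horiz_isIso ⟨by simp⟩ |>.flip
  ev := inv q
  ev_comp := by simp
  universal := fun {Z V} f v₁ v₂ hV g hg => by
    refine ⟨f, ⟨by simp, v₂, hV.w.symm, by simp, by simp [← hg]⟩, ?_⟩
    rintro k ⟨h, -⟩
    simpa using h

/-! ### Extensionality of dependent products -/

variable (Fib) in
/-- Function extensionality for dependent products: homotopic transposes have homotopic
adjuncts. -/
def Extensional {X Y E : D} {p : X ⟶ Y} {q : E ⟶ X} (P : DependentProduct p q) : Prop :=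
  ∀ {Z V : D} (k k' : Z ⟶ P.obj) (v₁ : V ⟶ Z) (m m' : V ⟶ P.pb),
    IsPullback v₁ (m ≫ P.snd) (k ≫ P.hom) p → k ≫ P.hom = k' ≫ P.hom → m ≫ P.fst = v₁ ≫ k →
    m' ≫ P.fst = v₁ ≫ k' → m ≫ P.snd = m' ≫ P.snd →
    FibreHomotopic Fib q (m ≫ P.ev) (m' ≫ P.ev) → FibreHomotopic Fib P.hom k k'

/-- The functoriality of dependent products. -/
lemma exists_map {X Y E E' : D} {p : X ⟶ Y} {q : E ⟶ X} {q' : E' ⟶ X}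
    (P : DependentProduct p q) (P' : DependentProduct p q') (s : E ⟶ E') (hs : s ≫ q' = q) :
    ∃ (S : P.obj ⟶ P'.obj) (m : P.pb ⟶ P'.pb), S ≫ P'.hom = P.hom ∧ m ≫ P'.fst = P.fst ≫ S ∧
      m ≫ P'.snd = P.snd ∧ m ≫ P'.ev = P.ev ≫ s := by
  obtain ⟨S, ⟨h, m, h₁, h₂, h₃⟩, -⟩ := P'.universal P.hom P.fst P.snd P.isPullback (P.ev ≫ s)
    (by rw [Category.assoc, hs, P.ev_comp])
  exact ⟨S, m, h, h₁, h₂, h₃⟩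

lemma map_comp_eq_id {X Y E E' : D} {p : X ⟶ Y} {q : E ⟶ X} {q' : E' ⟶ X}
    (P : DependentProduct p q) (P' : DependentProduct p q') {s : E ⟶ E'} {r : E' ⟶ E}
    (hsr : s ≫ r = 𝟙 E) {S : P.obj ⟶ P'.obj} {m : P.pb ⟶ P'.pb} (h : S ≫ P'.hom = P.hom)
    (h₁ : m ≫ P'.fst = P.fst ≫ S) (h₂ : m ≫ P'.snd = P.snd) (h₃ : m ≫ P'.ev = P.ev ≫ s)
    {R : P'.obj ⟶ P.obj} {n : P'.pb ⟶ P.pb} (h' : R ≫ P.hom = P'.hom)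
    (h₁' : n ≫ P.fst = P'.fst ≫ R) (h₂' : n ≫ P.snd = P'.snd) (h₃' : n ≫ P.ev = P'.ev ≫ r) :
    S ≫ R = 𝟙 _ := by
  refine P.hom_ext (V := P.pb) (v₁ := P.fst) (v₂ := P.snd) (by simp [h, h']) ?_ (m ≫ n) (𝟙 _)
    (by simp [h₁', reassoc_of% h₁]) (by simp [h₂', h₂]) (by simp) (by simp)
    (by simp [h₃', reassoc_of% h₃, hsr])
  simpa [h, h'] using P.isPullback

/-- `Π_p` is functorial, so `P` is a retract of `P'` over `Y`: a homotopy of transposes is pushed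
forward along `s`, turned into one of adjuncts in `P'`, and brought back along the retraction. With
`s` and `r` identities this also shows independence of the choice of dependent product. -/
lemma Extensional.of_retract (hc : IsClan Fib) {X Y E E' : D} {p : X ⟶ Y} {q : E ⟶ X}
    {q' : E' ⟶ X} (hq : Fib q) {P : DependentProduct p q} {P' : DependentProduct p q'}
    (hP' : Fib P'.hom) (h : P'.Extensional Fib) {s : E ⟶ E'} (hs : s ≫ q' = q) {r : E' ⟶ E}
    (hr : r ≫ q = q') (hsr : s ≫ r = 𝟙 E) : P.Extensional Fib := by
  obtain ⟨S, n, hS, h₁, h₂, h₃⟩ := exists_map P P' s hs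
  obtain ⟨R, n', hR, h₁', h₂', h₃'⟩ := exists_map P' P r hr
  have hSR := map_comp_eq_id P P' hsr hS h₁ h₂ h₃ hR h₁' h₂' h₃'
  intro Z V k k' v₁ m m' hV hk hm hm' hmm H
  have := h (k ≫ S) (k' ≫ S) v₁ (m ≫ n) (m' ≫ n) (by simpa [h₂, hS] using hV)
    (by simpa [hS] using hk) (by simp [h₁, reassoc_of% hm]) (by simp [h₁, reassoc_of% hm'])
    (by simpa [h₂] using hmm)
    (by simpa [h₃] using H.map hc hq s (𝟙 X) (by simp [hs]))
  simpa [hSR] using this.map hc hP' R (𝟙 Y) (by simp [hR])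

lemma Extensional.ofIso (hc : IsClan Fib) {X Y E X' E' : D} {p : X ⟶ Y} {q : E ⟶ X}
    {p' : X' ⟶ Y} {q' : E' ⟶ X'} {P : DependentProduct p' q'} (hP : P.Extensional Fib)
    (hq : Fib q) (e : X ≅ X')
    (he : e.hom ≫ p' = p) (d : E ≅ E') (hd : d.hom ≫ q' = q ≫ e.hom) :
    (P.ofIso e he d hd).Extensional Fib := by
  intro Z V (k : Z ⟶ P.obj) k' v₁ (m : V ⟶ P.pb) (m' : V ⟶ P.pb) hV hk hm hm' hmm H
  refine hP k k' v₁ m m' ?_ hk hm hm' ?_ ?_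
  · refine hV.of_iso (Iso.refl _) (Iso.refl _) e (Iso.refl _) ?_ ?_ ?_ ?_ <;>
      simp [← he, DependentProduct.ofIso]
  · simpa [DependentProduct.ofIso] using congrArg (· ≫ e.hom) hmm
  · have := H.map hc hq d.hom e.hom hd
    simpa [DependentProduct.ofIso] using this

lemma Extensional.ofIsIsoBase (hc : IsClan Fib) {X Y E : D} (p : X ⟶ Y) [IsIso p] (q : E ⟶ X)
    (hq : Fib q) : (ofIsIsoBase p q).Extensional Fib := by
  intro Z V (k : Z ⟶ E) (k' : Z ⟶ E) v₁ (m : V ⟶ E) (m' : V ⟶ E) hV hk hm hm' hmm H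
  have : IsIso v₁ := hV.isIso_fst_of_isIso
  have := (H.map hc hq (𝟙 E) p (by simp) (q := q ≫ p)).pre (inv v₁)
  simp only [DependentProduct.ofIsIsoBase, Category.comp_id] at hm hm' this ⊢
  simpa [hm, hm'] using this

lemma Extensional.ofIsIso {X Y E : D} (p : X ⟶ Y) (q : E ⟶ X) [IsIso q] :
    (ofIsIso p q).Extensional Fib := by
  intro Z V (k : Z ⟶ Y) (k' : Z ⟶ Y) v₁ m m' hV hk hm hm' hmm H
  exact FibreHomotopic.of_eq _ (by simpa [DependentProduct.ofIsIso] using hk)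

/-- On the intermediate pullback `U` along `p₂`, the two maps have adjuncts `n ≫ P₂.ev` and `n' ≫
P₂.ev` in `Π_{p₁}(q)`. These are homotopic by extensionality along `p₁`, and then extensionality
along `p₂` applies. -/
lemma Extensional.compBase {X Y Z E W : D} {p₁ : X ⟶ Y} {p₂ : Y ⟶ Z} {q : E ⟶ X}
    (hp₂ : ∀ {T : D} (f : T ⟶ Z), ∃ (U : D) (a : U ⟶ T) (b : U ⟶ Y), IsPullback a b f p₂)
    {P₁ : DependentProduct p₁ q} {P₂ : DependentProduct p₂ P₁.hom}
    (h₁ : P₁.Extensional Fib) (h₂ : P₂.Extensional Fib)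
    {a : W ⟶ P₂.pb} {b : W ⟶ P₁.pb} (hW : IsPullback a b P₂.ev P₁.fst) :
    (compBase hp₂ P₁ P₂ hW).Extensional Fib := by
  intro T V k k' v₁ m m' hV hk hm hm' hmm H
  simp only [DependentProduct.compBase] at k k' m m' hV hk hm hm' hmm H ⊢
  obtain ⟨U, u₁, u₂, hU⟩ := hp₂ (k ≫ P₂.hom)
  let c : V ⟶ U := hU.lift v₁ ((m ≫ b ≫ P₁.snd) ≫ p₁) (by simpa using hV.w)
  have hc : IsPullback c (m ≫ b ≫ P₁.snd) u₂ p₁ := by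
    refine (IsPullback.of_bot (t := hU.flip) ?_ (by simp [c])).flip
    simpa [c] using hV.flip
  let n : U ⟶ P₂.pb := P₂.isPullback.lift (u₁ ≫ k) u₂ (by rw [Category.assoc, hU.w])
  let n' : U ⟶ P₂.pb := P₂.isPullback.lift (u₁ ≫ k') u₂ (by rw [Category.assoc, ← hk, hU.w])
  have e : m ≫ a = c ≫ n := by
    apply P₂.isPullback.hom_ext
    · simpa [n, c] using hm
    · simp only [Category.assoc, n, IsPullback.lift_snd, c]
      rw [← P₂.ev_comp, hW.w_assoc, P₁.isPullback.w]
  have e' : m' ≫ a = c ≫ n' := by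
    apply P₂.isPullback.hom_ext
    · simpa [n', c] using hm'
    · simp only [Category.assoc, n', IsPullback.lift_snd, c]
      rw [← P₂.ev_comp, hW.w_assoc, P₁.isPullback.w]
      simpa using (congrArg (· ≫ p₁) hmm).symm
  refine h₂ k k' u₁ n n' (by simpa [n] using hU) hk (by simp [n]) (by simp [n']) (by simp [n, n'])
    ?_
  refine h₁ (n ≫ P₂.ev) (n' ≫ P₂.ev) c (m ≫ b) (m' ≫ b) ?_ ?_ ?_ ?_ (by simpa using hmm)
    (by simpa using H)
  · simpa [P₂.ev_comp, n] using hc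
  · simp [P₂.ev_comp, n, n']
  · rw [Category.assoc, ← hW.w, reassoc_of% e]
  · rw [Category.assoc, ← hW.w, reassoc_of% e']

end DependentProduct

end DependentProducts

end Tribe

/-! ## Comparison with homotopies in slices -/

namespace Tribe

section Slices

variable {D : Type u} [Category.{v} D] {Fib : MorphismProperty D}

/-- A fibre product over `X` is a product in the slice over `X`. -/
noncomputable def overFanIsLimit {X : D} {S A B : Over X} {a : S ⟶ A} {b : S ⟶ B}
    (h : IsPullback a.left b.left A.hom B.hom) : IsLimit (BinaryFan.mk a b) :=
  BinaryFan.IsLimit.mk _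
    (fun f g => Over.homMk (h.lift f.left g.left ((Over.w f).trans (Over.w g).symm)) (by
      change _ ≫ S.hom = _
      rw [← Over.w a, IsPullback.lift_fst_assoc, Over.w]))
    (fun f g => by ext; exact h.lift_fst _ _ _) (fun f g => by ext; exact h.lift_snd _ _ _)
    (fun f g m h₁ h₂ => by
      ext
      apply h.hom_ext
      · exact (congrArg (fun f => f.left) h₁).trans (h.lift_fst _ _ _).symm
      · exact (congrArg (fun f => f.left) h₂).trans (h.lift_snd _ _ _).symm)

/-- A pullback over a terminal object is a product. -/
noncomputable def fanIsLimit {T S A B : D} (hT : IsTerminal T) {a : S ⟶ A} {b : S ⟶ B} {t : A ⟶ T}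
    {t' : B ⟶ T} (h : IsPullback a b t t') : IsLimit (BinaryFan.mk a b) :=
  BinaryFan.IsLimit.mk _ (fun f g => h.lift f g (hT.hom_ext _ _))
    (fun f g => h.lift_fst _ _ _) (fun f g => h.lift_snd _ _ _) (fun f g m h₁ h₂ => by
      apply h.hom_ext
      · exact h₁.trans (h.lift_fst _ _ _).symm
      · exact h₂.trans (h.lift_snd _ _ _).symm)

/-- A diagonal filler in the ambient category lies over `X` automatically, because its composite
with `p` does. -/
lemma anodyne_over {X : D} {A B : Over X} {i : A ⟶ B} (hi : Anodyne Fib i.left) :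
    Anodyne (Fib.over (X := X)) i := by
  refine anodyne_of_exists_lift fun {E F} p hp t b h => ?_
  obtain ⟨l, h₁, h₂⟩ := exists_lift hi (p := p.left) hp (t := t.left) (b := b.left)
    (by simpa using congrArg (fun f => f.left) h)
  refine ⟨Over.homMk l (by rw [← Over.w p, reassoc_of% h₂, Over.w]), ?_, ?_⟩
  · ext; simpa using h₁
  · ext; simpa using h₂

/-- The path object in the slice over `X` of a fibration `q : E ⟶ X` given by an anodyne-fibration
factorisation of its diagonal. -/
noncomputable def overPathObject {X E K P : D} {q : E ⟶ X} {π₀ π₁ : K ⟶ E}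
    (hK : IsPullback π₀ π₁ q q)
    {e : P ⟶ K} (he : Fib e) {r : E ⟶ P} (hr : Anodyne Fib r) (h₀ : r ≫ e ≫ π₀ = 𝟙 E)
    (h₁ : r ≫ e ≫ π₁ = 𝟙 E) : PathObject (Fib.over (X := X)) (Over.mk q) where
  sq := BinaryFan.mk (P := Over.mk (π₀ ≫ q)) (Over.homMk π₀) (Over.homMk π₁ hK.w.symm)
  isLimit := overFanIsLimit hK
  obj := Over.mk (e ≫ π₀ ≫ q)
  r := Over.homMk r (by simp [reassoc_of% h₀])
  ends := Over.homMk e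
  anodyne := anodyne_over hr
  fib := he
  r_fst := by ext; simpa using h₀
  r_snd := by ext; simpa using h₁

lemma homotopic_over_of_fibreHomotopic {X E K P : D} {q : E ⟶ X} {π₀ π₁ : K ⟶ E}
    (hK : IsPullback π₀ π₁ q q)
    {e : P ⟶ K} (he : Fib e) {r : E ⟶ P} (hr : Anodyne Fib r) (h₀ : r ≫ e ≫ π₀ = 𝟙 E)
    (h₁ : r ≫ e ≫ π₁ = 𝟙 E) {Z : Over X} {a b : Z ⟶ Over.mk q}
    (h : FibreHomotopic Fib q a.left b.left) : Homotopic (Fib.over (X := X)) a b := by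
  obtain ⟨H, h₂, h₃⟩ := h.2 π₀ π₁ hK e r he h₀ h₁
  refine ⟨overPathObject hK he hr h₀ h₁, Over.homMk H ?_, ?_, ?_⟩
  · have := Over.w a
    simp only [overPathObject, Over.mk_hom] at this ⊢
    rw [← this, ← h₂]; simp
  · ext; exact h₂
  · ext; exact h₃

/-- The path object is only anodyne in the slice. This suffices, since a reflexive fibration over `E
×_X E` is itself a fibration of the slice over `X`. -/
lemma FibreHomotopic.of_homotopic_over {X E : D} {q : E ⟶ X} {Z : Over X}
    {a b : Z ⟶ Over.mk q} (h : Homotopic (Fib.over (X := X)) a b) :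
    FibreHomotopic Fib q a.left b.left := by
  refine ⟨(Over.w a).trans (Over.w b).symm, fun {K P'} π₀ π₁ hK e' r' he' h₀' h₁' => ?_⟩
  obtain ⟨P, H, rfl, rfl⟩ := h
  have w : P.d₀.left ≫ q = P.d₁.left ≫ q := (Over.w P.d₀).trans (Over.w P.d₁).symm
  have e₀ : P.r.left ≫ P.d₀.left = 𝟙 E := congrArg (fun f => f.left) P.r_fst
  have e₁ : P.r.left ≫ P.d₁.left = 𝟙 E := congrArg (fun f => f.left) P.r_snd
  obtain ⟨l, hl, hl'⟩ := exists_lift P.anodyne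
    (p := (Over.homMk e' rfl : Over.mk (e' ≫ π₀ ≫ q) ⟶ Over.mk (π₀ ≫ q))) he'
    (t := Over.homMk r' (by simp [reassoc_of% h₀']))
    (b := Over.homMk (hK.lift P.d₀.left P.d₁.left w) (by simpa using Over.w P.d₀))
    (by
      ext
      apply hK.hom_ext
      · simp [h₀', e₀]
      · simp [h₁', e₁])
  have hl'' : l.left ≫ e' = hK.lift P.d₀.left P.d₁.left w := congrArg (fun f => f.left) hl'
  exact ⟨H.left ≫ l.left, by simp [reassoc_of% hl''], by simp [reassoc_of% hl'']⟩

/-- Diagonals of fibrations factor as an anodyne map followed by a fibration. -/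
def HasPaths (Fib : MorphismProperty D) : Prop :=
  ∀ {X E : D} (q : E ⟶ X), Fib q → ∃ (K P : D) (π₀ π₁ : K ⟶ E) (e : P ⟶ K) (r : E ⟶ P),
    IsPullback π₀ π₁ q q ∧ Fib e ∧ Anodyne Fib r ∧ r ≫ e ≫ π₀ = 𝟙 E ∧ r ≫ e ≫ π₁ = 𝟙 E

lemma hasPaths_of_factorisation (hc : IsClan Fib)
    (h : ∀ {X Y : D} (f : X ⟶ Y), ∃ (Z : D) (i : X ⟶ Z) (p : Z ⟶ Y),
      Anodyne Fib i ∧ Fib p ∧ i ≫ p = f) : HasPaths Fib := by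
  intro X E q hq
  obtain ⟨K, π₀, π₁, hK⟩ := hc.exists_pullback q q hq
  obtain ⟨P, r, e, hr, he, h⟩ := h (hK.lift (𝟙 E) (𝟙 E) rfl)
  exact ⟨K, P, π₀, π₁, e, r, hK, he, hr, by simp [reassoc_of% h], by simp [reassoc_of% h]⟩

lemma HasPaths.homotopic_over (hP : HasPaths Fib) {X E : D} {q : E ⟶ X} (hq : Fib q)
    {Z : Over X} {a b : Z ⟶ Over.mk q} (h : FibreHomotopic Fib q a.left b.left) :
    Homotopic (Fib.over (X := X)) a b := by
  obtain ⟨K, P, π₀, π₁, e, r, hK, he, hr, h₀, h₁⟩ := hP q hq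
  exact homotopic_over_of_fibreHomotopic hK he hr h₀ h₁ h

lemma HasPaths.homotopic (hP : HasPaths Fib) {T : D} (hT : IsTerminal T) {E Z : D} {q : E ⟶ T}
    (hq : Fib q) {a b : Z ⟶ E} (h : FibreHomotopic Fib q a b) : Homotopic Fib a b := by
  obtain ⟨K, P, π₀, π₁, e, r, hK, he, hr, h₀, h₁⟩ := hP q hq
  obtain ⟨H, h₂, h₃⟩ := h.2 π₀ π₁ hK e r he h₀ h₁
  exact ⟨⟨_, fanIsLimit hT hK, P, r, e, hr, he, h₀, h₁⟩, H, h₂, h₃⟩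

lemma HasPaths.trans (hP : HasPaths Fib) (hc : IsClan Fib) (hF : Frobenius Fib) {X E Z : D}
    {q : E ⟶ X} (hq : Fib q) {a b c : Z ⟶ E} (h : FibreHomotopic Fib q a b)
    (h' : FibreHomotopic Fib q b c) : FibreHomotopic Fib q a c := by
  obtain ⟨K, P, π₀, π₁, e, r, hK, he, hr, h₀, h₁⟩ := hP q hq
  exact h.trans hc hF hq hK he hr h₀ h₁ h'

/-- Extensional dependent products preserve homotopy equivalences. -/
lemma isHomotopyEquiv_pi (hP : HasPaths Fib) {X Y E₁ E₂ : D} (p : X ⟶ Y)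
    (q₁ : E₁ ⟶ X) (q₂ : E₂ ⟶ X) (e : E₁ ⟶ E₂)
    (he : e ≫ q₂ = q₁)
    (heq : IsHomotopyEquiv (Fib.over (X := X)) (Over.homMk e he : Over.mk q₁ ⟶ Over.mk q₂))
    (P₁ : DependentProduct p q₁) (P₂ : DependentProduct p q₂) (hP₁ : Fib P₁.hom)
    (hP₂ : Fib P₂.hom) (h₁ : P₁.Extensional Fib) (h₂ : P₂.Extensional Fib)
    (k : P₁.obj ⟶ P₂.obj) (hk : k ≫ P₂.hom = P₁.hom) (m : P₁.pb ⟶ P₂.pb)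
    (hm₁ : m ≫ P₂.fst = P₁.fst ≫ k) (hm₂ : m ≫ P₂.snd = P₁.snd)
    (hm₃ : m ≫ P₂.ev = P₁.ev ≫ e) :
    IsHomotopyEquiv (Fib.over (X := Y)) (Over.homMk k hk : Over.mk P₁.hom ⟶ Over.mk P₂.hom) := by
  obtain ⟨g, hg, hg'⟩ := heq
  have hg₂ : g.left ≫ q₁ = q₂ := Over.w g
  -- The homotopy inverse is `Π_p` applied to the homotopy inverse `g`. The transposes of the two
  -- composites with `k` are evaluation followed by the composites of `e` and `g`, so extensionality
  -- gives both homotopies.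
  obtain ⟨G, n, hG, hn₁, hn₂, hn₃⟩ := DependentProduct.exists_map P₂ P₁ g.left hg₂
  refine ⟨Over.homMk G hG, ?_, ?_⟩
  · apply hP.homotopic_over hP₁
    refine h₁ (k ≫ G) (𝟙 _) P₁.fst (m ≫ n) (𝟙 _) ?_ (by simp [hG, hk])
      (by simp [hn₁, reassoc_of% hm₁]) (by simp) (by simp [hn₂, hm₂]) ?_
    · simpa [hn₂, hm₂, hG, hk] using P₁.isPullback
    · simpa [hn₃, reassoc_of% hm₃] using (FibreHomotopic.of_homotopic_over hg).pre P₁.ev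
  · apply hP.homotopic_over hP₂
    refine h₂ (G ≫ k) (𝟙 _) P₂.fst (n ≫ m) (𝟙 _) ?_ (by simp [hG, hk])
      (by simp [hm₁, reassoc_of% hn₁]) (by simp) (by simp [hn₂, hm₂]) ?_
    · simpa [hn₂, hm₂, hG, hk] using P₂.isPullback
    · simpa [hm₃, reassoc_of% hn₃] using (FibreHomotopic.of_homotopic_over hg').pre P₂.ev

end Slices

end Tribe

/-! ## The clan of a contextual category -/

section ContextualClan

open ContextualCategory Tribe

variable {C : Type u} [Category.{v} C] [ContextualCategory.{w} C]

/-- Maps isomorphic over their codomain to a dependent projection. -/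
def IsDisplay {X Y : C} (p : X ⟶ Y) : Prop :=
  ∃ (A : Ty Y) (e : X ≅ ext A), e.hom ≫ proj A = p

lemma isDisplay_proj {Γ : C} (A : Ty Γ) : IsDisplay (proj A) := ⟨A, Iso.refl _, by simp⟩

lemma isDisplay_of_isPullback_proj {P X Y : C} {A : Ty Y} {a : P ⟶ ext A} {b : P ⟶ X}
    {f : X ⟶ Y} (h : IsPullback a b (proj A) f) : IsDisplay b :=
  ⟨sub f A, h.isoIsPullback _ _ (ContextualCategory.isPullback f A), by simp⟩

lemma IsDisplay.base_change {P X Y Z : C} {a : P ⟶ X} {b : P ⟶ Y} {f : X ⟶ Z} {g : Y ⟶ Z}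
    (h : IsPullback a b f g) (hf : IsDisplay f) : IsDisplay b := by
  obtain ⟨A, e, rfl⟩ := hf
  exact isDisplay_of_isPullback_proj (a := a ≫ e.hom) (f := g)
    (h.of_iso (Iso.refl _) e (Iso.refl _) (Iso.refl _) (by simp) (by simp) (by simp) (by simp))

lemma IsDisplay.exists_pullback {X Y Z : C} (f : X ⟶ Z) {g : Y ⟶ Z} (hg : IsDisplay g) :
    ∃ (P : C) (a : P ⟶ X) (b : P ⟶ Y), IsPullback a b f g := by
  obtain ⟨A, e, rfl⟩ := hg
  exact ⟨ext (sub f A), proj _, q f A ≫ e.inv, ((ContextualCategory.isPullback f A).of_iso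
    (Iso.refl _) e.symm (Iso.refl _) (Iso.refl _) (by simp) (by simp) (by simp) (by simp)).flip⟩

lemma IsDisplay.comp_iso {X Y Z : C} {p : X ⟶ Y} (hp : IsDisplay p) (e : Y ≅ Z) :
    IsDisplay (p ≫ e.hom) :=
  hp.base_change (a := 𝟙 X) (g := e.inv) (IsPullback.of_horiz_isIso ⟨by simp⟩)

lemma fibrations_of_isIso {X Y : C} (f : X ⟶ Y) [IsIso f] : fibrations C f :=
  ⟨Y, Y, 𝟙 Y, .id Y, ⟨Arrow.isoMk (asIso f).symm (Iso.refl _) (by simp)⟩⟩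

/-- Once `f` is replaced by a strict composite `f'`, the type over the source of `f` is pulled back
along the isomorphism to the source of `f'`, where it contributes one more projection. -/
lemma IsDisplay.comp_fibrations {X Y Z : C} {p : X ⟶ Y} {f : Y ⟶ Z} (hp : IsDisplay p)
    (hf : fibrations C f) : fibrations C (p ≫ f) := by
  obtain ⟨Y', Z', f', hf', ⟨i⟩⟩ := hf
  let a : Y' ≅ Y := Arrow.leftFunc.mapIso i
  let b : Z' ≅ Z := Arrow.rightFunc.mapIso i
  have w : a.hom ≫ f = f' ≫ b.hom := i.hom.w
  obtain ⟨A, e, rfl⟩ := hp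
  have : IsIso (q a.hom A) := (ContextualCategory.isPullback a.hom A).isIso_fst_of_isIso
  refine ⟨_, _, proj (sub a.hom A) ≫ f', .comp _ _ hf',
    ⟨Arrow.isoMk (asIso (q a.hom A) ≪≫ e.symm) b ?_⟩⟩
  simp only [Iso.trans_hom, asIso_hom, Iso.symm_hom, Arrow.mk_hom, Category.assoc,
    Iso.inv_hom_id_assoc, ← w]
  rw [← Category.assoc, q_proj, Category.assoc, Category.assoc]

/-- Induction on fibrations. -/
lemma fibrations_induction {R : ∀ {X Y : C} (_ : X ⟶ Y), Prop}
    (iso : ∀ {X Y : C} (f : X ⟶ Y) [IsIso f], R f)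
    (comp : ∀ {X Y Z : C} (p : X ⟶ Y) (f : Y ⟶ Z), IsDisplay p → fibrations C f → R f →
      R (p ≫ f)) {X Y : C} {f : X ⟶ Y} (hf : fibrations C f) : R f := by
  obtain ⟨X', Y', f', hf', ⟨i⟩⟩ := hf
  let a : X' ≅ X := Arrow.leftFunc.mapIso i
  let b : Y' ≅ Y := Arrow.rightFunc.mapIso i
  have w : a.hom ≫ f = f' ≫ b.hom := i.hom.w
  -- The motive is not assumed invariant under isomorphism, so isomorphisms at both ends are carried
  -- through the induction; the one at the source is absorbed into the next display map.
  have key : ∀ {Γ Δ : C} {g : Γ ⟶ Δ}, IsProjComposite g → ∀ {Γ' Δ' : C} (a : Γ' ≅ Γ)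
      (b : Δ ≅ Δ'), R (a.hom ≫ g ≫ b.hom) := by
    intro Γ Δ g hg
    induction hg with
    | id Γ => intro Γ' Δ' a b; exact iso _
    | comp A g hg ih =>
      intro Γ' Δ' a b
      have := comp (a.hom ≫ proj A) (g ≫ b.hom) ⟨A, a, rfl⟩
        ⟨_, _, g, hg, ⟨Arrow.isoMk (Iso.refl _) b (by simp)⟩⟩ (by simpa using ih (Iso.refl _) b)
      simpa using this
  have e : f = a.symm.hom ≫ f' ≫ b.hom := by rw [← w]; simp
  rw [e]
  exact key hf' _ _

lemma IsDisplay.fibrations {X Y : C} {p : X ⟶ Y} (hp : IsDisplay p) : fibrations C p := by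
  simpa using hp.comp_fibrations (fibrations_of_isIso (𝟙 Y))

lemma fibrations_proj {Γ : C} (A : Ty Γ) : fibrations C (proj A) := (isDisplay_proj A).fibrations

instance fibrations_respectsIso : (fibrations C).RespectsIso :=
  MorphismProperty.isoClosure_respectsIso _

lemma fibrations_comp {X Y Z : C} {f : X ⟶ Y} {g : Y ⟶ Z} (hf : fibrations C f) :
    fibrations C g → fibrations C (f ≫ g) := by
  revert Z
  refine fibrations_induction (R := fun {X Y} f => ∀ {Z : C} {g : Y ⟶ Z}, fibrations C g →
    fibrations C (f ≫ g)) ?_ ?_ hf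
  · intro X Y f _ Z g hg
    exact MorphismProperty.RespectsIso.precomp _ f g hg
  · intro X Y Z p f hp _ ih W g hg
    rw [Category.assoc]
    exact hp.comp_fibrations (ih hg)

lemma fibrations_exists_pullback {Y Z : C} {g : Y ⟶ Z} (hg : fibrations C g) :
    ∀ {X : C} (f : X ⟶ Z), ∃ (P : C) (a : P ⟶ X) (b : P ⟶ Y), IsPullback a b f g ∧
      fibrations C a := by
  refine fibrations_induction (R := fun {Y Z} g => ∀ {X : C} (f : X ⟶ Z), ∃ (P : C)
    (a : P ⟶ X) (b : P ⟶ Y), IsPullback a b f g ∧ fibrations C a) ?_ ?_ hg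
  · intro Y Z g _ X f
    exact ⟨X, 𝟙 X, f ≫ inv g, (IsPullback.of_vert_isIso ⟨by simp⟩).flip,
      fibrations_of_isIso _⟩
  · intro W Y Z p g hp _ ih X f
    obtain ⟨P, a, b, h, ha⟩ := ih f
    obtain ⟨Q, a', b', h'⟩ := hp.exists_pullback b
    exact ⟨Q, a' ≫ a, b', (h'.flip.paste_vert h.flip).flip,
      (hp.base_change h'.flip).comp_fibrations ha⟩

variable (C) in
lemma fibrations_isClan : IsClan (fibrations C) where
  isMultiplicative :=
    { id_mem := fun X => fibrations_of_isIso (𝟙 X)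
      comp_mem := fun _ _ hf hg => fibrations_comp hf hg }
  exists_pullback := fun f g hg => by
    obtain ⟨P, a, b, h, -⟩ := fibrations_exists_pullback hg f
    exact ⟨P, a, b, h⟩
  stable := .mk' (fun X Y S f g _ hg => by
    obtain ⟨P, a, b, h, ha⟩ := fibrations_exists_pullback hg f
    have : pullback.fst f g = (h.isoPullback).inv ≫ a := by simp
    rw [this]
    exact MorphismProperty.RespectsIso.precomp _ _ _ ha)

/-- Every context is reached from the empty one by finitely many extensions; the induction is on its
length. -/
lemma fibrations_root {X : C} (f : X ⟶ root) : fibrations C f := by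
  obtain ⟨n, hn⟩ : ∃ n, len X = n := ⟨_, rfl⟩
  induction n generalizing X with
  | zero =>
    obtain rfl := (len_eq_zero_iff X).1 hn
    rw [rootIsTerminal.hom_ext f (𝟙 _)]
    exact fibrations_of_isIso _
  | succ n ih =>
    obtain ⟨Δ, A, rfl⟩ := exists_ext X (by omega)
    rw [len_ext] at hn
    rw [rootIsTerminal.hom_ext f (proj A ≫ rootIsTerminal.from Δ)]
    exact (isDisplay_proj A).comp_fibrations (ih _ (by omega))

lemma fibrations_terminal {X T : C} (hT : IsTerminal T) (f : X ⟶ T) : fibrations C f := by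
  have : f = rootIsTerminal.from X ≫ hT.from root := hT.hom_ext _ _
  have i : IsIso (hT.from (root : C)) :=
    ⟨rootIsTerminal.from T, rootIsTerminal.hom_ext _ _, hT.hom_ext _ _⟩
  rw [this]
  exact fibrations_comp (fibrations_root _) (fibrations_of_isIso _)

/-- Left lifting against fibrations can be checked on types over the codomain. -/
lemma anodyne_of_exists_sec {X Z : C} (i : X ⟶ Z)
    (h : ∀ (A : Ty Z) (d : Elt i A), ∃ s : Sec A, i ≫ s.1 = d.1) :
    Anodyne (fibrations C) i := by
  refine anodyne_of_exists_lift fun {E F} p hp => ?_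
  refine fibrations_induction (R := fun {E F} p => ∀ (t : X ⟶ E) (b : Z ⟶ F), t ≫ p = i ≫ b →
    ∃ l, i ≫ l = t ∧ l ≫ p = b) ?_ ?_ hp
  · intro E F p _ t b hw
    exact ⟨b ≫ inv p, by simp [← reassoc_of% hw], by simp⟩
  · intro E F G p f hp _ ih t b hw
    -- The problem is first solved against `f`. The solution `l` turns the remaining problem into
    -- extending a partial section of a type pulled back to `Z` along `l`.
    obtain ⟨l, h₁, h₂⟩ := ih (t ≫ p) b (by simpa using hw)
    obtain ⟨A, e, rfl⟩ := hp
    obtain ⟨s, hs⟩ := h (sub l A) (lift l i (t ≫ e.hom) (by simp [h₁]))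
    refine ⟨s.1 ≫ q l A ≫ e.inv, ?_, ?_⟩
    · rw [reassoc_of% hs, ← Category.assoc, lift_q]; simp
    · rw [← h₂, Category.assoc, Category.assoc, Category.assoc, e.inv_hom_id_assoc,
        reassoc_of% (q_proj l A),
        reassoc_of% s.2]

end ContextualClan

/-! ## Identity types and sums -/

section IdentityTypes

open ContextualCategory Tribe SigmaStructure IdStructure PiStructure

variable {C : Type u} [Category.{v} C] [ContextualCategory.{w} C]

lemma isPullback_wk {Γ : C} (A : Ty Γ) :
    IsPullback (proj (wk A A)) (q (proj A) A) (proj A) (proj A) :=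
  (ContextualCategory.isPullback (proj A) A).flip

@[simp] lemma pairElt_proj {Δ Γ : C} {σ : Δ ⟶ Γ} {A : Ty Γ} (s t : Elt σ A) :
    pairElt s t ≫ proj (wk A A) = s.1 := lift_proj _ _ _ _

@[simp] lemma pairElt_q {Δ Γ : C} {σ : Δ ⟶ Γ} {A : Ty Γ} (s t : Elt σ A) :
    pairElt s t ≫ q (proj A) A = t.1 := lift_q _ _ _ _

@[simp] lemma diagSec_q {Γ : C} (A : Ty Γ) : (diagSec A).1 ≫ q (proj A) A = 𝟙 _ := lift_q _ _ _ _

@[simp] lemma dbl_proj {Δ Γ : C} (f : Δ ⟶ Γ) (A : Ty Γ) :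
    dbl f A ≫ proj (wk A A) = proj (wk (sub f A) (sub f A)) ≫ q f A := lift_proj _ _ _ _

@[simp] lemma dbl_q {Δ Γ : C} (f : Δ ⟶ Γ) (A : Ty Γ) :
    dbl f A ≫ q (proj A) A = q (proj (sub f A)) (sub f A) ≫ q f A := lift_q _ _ _ _

/-! ### Identity types as path objects -/

section

variable [IdStructure C]

/-- `J` extends partial sections of types along reflexivity, strictly by its computation rule, and
types over the codomain are all that has to be tested. -/
lemma anodyne_refl {Γ : C} (A : Ty Γ) : Anodyne (fibrations C) (refl A).1 :=
  anodyne_of_exists_sec _ fun D d => ⟨J A D d, refl_J A D d⟩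

/-- The source of an identification. -/
def idSrc {Γ : C} (A : Ty Γ) : ext (Id A) ⟶ ext A := proj (Id A) ≫ proj (wk A A)

/-- The target of an identification. -/
def idTgt {Γ : C} (A : Ty Γ) : ext (Id A) ⟶ ext A := proj (Id A) ≫ q (proj A) A

lemma idSrc_proj {Γ : C} (A : Ty Γ) : idSrc A ≫ proj A = idTgt A ≫ proj A := by
  simp [idSrc, idTgt, q_proj]

@[simp] lemma refl_idSrc {Γ : C} (A : Ty Γ) : (refl A).1 ≫ idSrc A = 𝟙 _ := by
  rw [idSrc, ← Category.assoc, (refl A).2, (diagSec A).2]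

@[simp] lemma refl_idTgt {Γ : C} (A : Ty Γ) : (refl A).1 ≫ idTgt A = 𝟙 _ := by
  rw [idTgt, ← Category.assoc, (refl A).2, diagSec_q]

/-- Identified maps into `Γ.A`. -/
def IdHomotopic {Γ Z : C} (A : Ty Γ) (s t : Z ⟶ ext A) : Prop :=
  ∃ H : Z ⟶ ext (Id A), H ≫ idSrc A = s ∧ H ≫ idTgt A = t

lemma q_pairElt_idSrc {Δ Γ : C} {σ : Δ ⟶ Γ} {B : Ty Γ} (s t : Elt σ B) :
    q (pairElt s t) (Id B) ≫ idSrc B = proj _ ≫ s.1 := by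
  rw [idSrc, reassoc_of% (q_proj (pairElt s t) (Id B)), pairElt_proj]

lemma q_pairElt_idTgt {Δ Γ : C} {σ : Δ ⟶ Γ} {B : Ty Γ} (s t : Elt σ B) :
    q (pairElt s t) (Id B) ≫ idTgt B = proj _ ≫ t.1 := by
  rw [idTgt, reassoc_of% (q_proj (pairElt s t) (Id B)), pairElt_q]

/-- The structure map of the path object of a context extension. -/
abbrev idProj {Θ : C} (B : Ty Θ) : ext (Id B) ⟶ Θ := proj (Id B) ≫ proj (wk B B) ≫ proj B

lemma idSrc_proj' {Θ : C} (B : Ty Θ) : idSrc B ≫ proj B = idProj B := Category.assoc _ _ _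

lemma idTgt_proj {Θ : C} (B : Ty Θ) : idTgt B ≫ proj B = idProj B := by
  rw [← idSrc_proj, idSrc_proj']

lemma IdHomotopic.fibreHomotopic {Γ Z : C} {A : Ty Γ} {s t : Z ⟶ ext A}
    (h : IdHomotopic A s t) : FibreHomotopic (fibrations C) (proj A) s t := by
  obtain ⟨H, rfl, rfl⟩ := h
  exact FibreHomotopic.of_anodyne (anodyne_refl A) (refl_idSrc A) (refl_idTgt A) (idSrc_proj A) H

/-- `Id A` is itself one of the reflexive fibrations over which fibrewise homotopy quantifies. -/
lemma idHomotopic_of_fibreHomotopic {Γ Z : C} {A : Ty Γ} {s t : Z ⟶ ext A}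
    (h : FibreHomotopic (fibrations C) (proj A) s t) : IdHomotopic A s t :=
  h.2 _ _ (isPullback_wk A) (proj (Id A)) (refl A).1 (fibrations_proj _) (refl_idSrc A)
    (refl_idTgt A)

lemma IdHomotopic.of_elt {Δ Γ Θ : C} {σ : Δ ⟶ Γ} {A : Ty Γ} {s t : Elt σ A} {m : Θ ⟶ Δ}
    (h : Elt m (sub (pairElt s t) (Id A))) : IdHomotopic A (m ≫ s.1) (m ≫ t.1) := by
  refine ⟨h.1 ≫ q _ _, ?_, ?_⟩
  · rw [Category.assoc, idSrc, reassoc_of% (q_proj (pairElt s t) (Id A)), pairElt_proj,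
      reassoc_of% h.2]
  · rw [Category.assoc, idTgt, reassoc_of% (q_proj (pairElt s t) (Id A)), pairElt_q,
      reassoc_of% h.2]

lemma IdHomotopic.exists_sec {Δ Γ : C} {σ : Δ ⟶ Γ} {A : Ty Γ} {s t : Elt σ A}
    (h : IdHomotopic A s.1 t.1) : Nonempty (Sec (sub (pairElt s t) (Id A))) := by
  obtain ⟨H, h₀, h₁⟩ := h
  refine ⟨lift _ (𝟙 _) H ?_⟩
  apply (isPullback_wk A).hom_ext
  · rw [Category.id_comp, pairElt_proj, Category.assoc, ← h₀]; rfl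
  · rw [Category.id_comp, pairElt_q, Category.assoc, ← h₁]; rfl

/-- The map `ext (Id (f^* A)) ⟶ ext (Id A)`. -/
noncomputable def idMap {Δ Γ : C} (f : Δ ⟶ Γ) (A : Ty Γ) : ext (Id (sub f A)) ⟶ ext (Id A) :=
  extCast (sub_Id f A).symm ≫ q (dbl f A) (Id A)

lemma isPullback_idMap {Δ Γ : C} (f : Δ ⟶ Γ) (A : Ty Γ) :
    IsPullback (idMap f A) (proj (Id (sub f A))) (proj (Id A)) (dbl f A) := by
  have : IsIso (extCast (sub_Id f A).symm) := by unfold extCast; infer_instance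
  refine (ContextualCategory.isPullback (dbl f A) (Id A)).of_iso
    (asIso (extCast (sub_Id f A).symm)).symm (Iso.refl _) (Iso.refl _) (Iso.refl _) ?_ ?_ ?_ ?_
  · simp [idMap]
  · simp
  · simp
  · simp

lemma refl_idMap {Δ Γ : C} (f : Δ ⟶ Γ) (A : Ty Γ) :
    (refl (sub f A)).1 ≫ idMap f A = q f A ≫ (refl A).1 := sub_refl f A

/-- Identifications in a pulled back type are identifications in the original type. -/
lemma exists_idMap_lift {Δ Γ Z : C} {f : Δ ⟶ Γ} {A : Ty Γ} {s t : Z ⟶ ext (sub f A)}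
    (h : s ≫ proj _ = t ≫ proj _) {H : Z ⟶ ext (Id A)} (h₀ : H ≫ idSrc A = s ≫ q f A)
    (h₁ : H ≫ idTgt A = t ≫ q f A) :
    ∃ K : Z ⟶ ext (Id (sub f A)), K ≫ idMap f A = H ∧ K ≫ idSrc _ = s ∧ K ≫ idTgt _ = t := by
  let st : Z ⟶ ext (wk (sub f A) (sub f A)) := (isPullback_wk (sub f A)).lift s t h
  have w : H ≫ proj (Id A) = st ≫ dbl f A := by
    apply (isPullback_wk A).hom_ext
    · rw [Category.assoc, Category.assoc, dbl_proj, IsPullback.lift_fst_assoc]; exact h₀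
    · rw [Category.assoc, Category.assoc, dbl_q, IsPullback.lift_snd_assoc]; exact h₁
  refine ⟨(isPullback_idMap f A).lift H st w, IsPullback.lift_fst _ _ _ _, ?_, ?_⟩
  · rw [idSrc, IsPullback.lift_snd_assoc, IsPullback.lift_fst]
  · rw [idTgt, IsPullback.lift_snd_assoc, IsPullback.lift_snd]

lemma IdHomotopic.lift {Δ Γ Z : C} {f : Δ ⟶ Γ} {A : Ty Γ} {s t : Z ⟶ ext (sub f A)}
    (h : s ≫ proj _ = t ≫ proj _) (H : IdHomotopic A (s ≫ q f A) (t ≫ q f A)) :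
    IdHomotopic (sub f A) s t := by
  obtain ⟨H, h₀, h₁⟩ := H
  obtain ⟨K, -, h₂⟩ := exists_idMap_lift h h₀ h₁
  exact ⟨K, h₂⟩

end

/-! ### Sums without the η-rule -/

section

variable [SigmaStructure C]

/-- The first projection of a sum. -/
noncomputable def sigFst {Γ : C} (A : Ty Γ) (B : Ty (ext A)) : ext (Sig A B) ⟶ ext A :=
  (split A B (sub (proj (Sig A B)) A)
    (lift (proj (Sig A B)) (pair A B).1 (proj B) (by rw [(pair A B).2]))).1 ≫ q _ A

lemma pair_sigFst {Γ : C} (A : Ty Γ) (B : Ty (ext A)) :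
    (pair A B).1 ≫ sigFst A B = proj B := by
  rw [sigFst, ← Category.assoc, pair_split, lift_q]

lemma sigFst_proj {Γ : C} (A : Ty Γ) (B : Ty (ext A)) :
    sigFst A B ≫ proj A = proj (Sig A B) := by
  rw [sigFst, Category.assoc, q_proj, ← Category.assoc, (split _ _ _ _).2, Category.id_comp]

/-- The projections of a sum, as a map to the context extension by both components. -/
noncomputable def unpair {Γ : C} (A : Ty Γ) (B : Ty (ext A)) : ext (Sig A B) ⟶ ext B :=
  (split A B (sub (sigFst A B) B)
    (lift (sigFst A B) (pair A B).1 (𝟙 _) (by rw [Category.id_comp, pair_sigFst]))).1 ≫ q _ B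

@[simp] lemma pair_unpair {Γ : C} (A : Ty Γ) (B : Ty (ext A)) :
    (pair A B).1 ≫ unpair A B = 𝟙 _ := by
  rw [unpair, ← Category.assoc, pair_split, lift_q]

lemma unpair_proj_proj {Γ : C} (A : Ty Γ) (B : Ty (ext A)) :
    unpair A B ≫ proj B ≫ proj A = proj (Sig A B) := by
  rw [unpair, Category.assoc, reassoc_of% (q_proj (sigFst A B) B), reassoc_of% (split _ _ _ _).2,
    sigFst_proj]

lemma pairOver_unpair {Δ Γ : C} {σ : Δ ⟶ Γ} {A : Ty Γ} {B : Ty (ext A)} (a : Elt σ A)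
    (b : Elt a.hom B) : (pairOver a b).1 ≫ unpair A B = b.1 := by
  simp [pairOver]

/-- Every fibration which is not an isomorphism is a retract of a dependent projection. -/
lemma isIso_or_exists_retract {X E : C} {f : E ⟶ X} (hf : fibrations C f) :
    IsIso f ∨ ∃ (T : Ty X) (s : E ⟶ ext T) (r : ext T ⟶ E), s ≫ r = 𝟙 E ∧ s ≫ proj T = f ∧
      r ≫ f = proj T := by
  refine fibrations_induction (R := fun {E X} f => IsIso f ∨ ∃ (T : Ty X) (s : E ⟶ ext T)
    (r : ext T ⟶ E), s ≫ r = 𝟙 E ∧ s ≫ proj T = f ∧ r ≫ f = proj T) ?_ ?_ hf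
  · intro E X f hf
    exact Or.inl hf
  · intro E Y X p f hp _ ih
    right
    obtain ⟨B, e, rfl⟩ := hp
    rcases ih with hf | ⟨T, s, r, hsr, hs, hr⟩
    -- In the absence of a unit type an isomorphism need not come from a type; here it is used to
    -- move `B` to the base instead.
    · have : IsIso (q (inv f) B) := (ContextualCategory.isPullback (inv f) B).isIso_fst_of_isIso
      have w : inv (q (inv f) B) ≫ proj (sub (inv f) B) = proj B ≫ f := by
        rw [IsIso.inv_comp_eq, ← Category.assoc, q_proj, Category.assoc, IsIso.inv_hom_id,
          Category.comp_id]
      exact ⟨sub (inv f) B, e.hom ≫ inv (q (inv f) B), q (inv f) B ≫ e.inv, by simp,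
        by simp [w], by simp [← w]⟩
    -- `B` is pulled back along the retraction `r` to a family over `T`, and the resulting two-step
    -- extension is a retract of the extension by the sum, since `unpair` strictly undoes `pair`.
    · let l := (lift r (proj B ≫ s) (𝟙 (ext B)) (by simp [hsr])).1
      have hl : l ≫ q r B = 𝟙 _ := lift_q _ _ _ _
      have hl' : l ≫ proj _ = proj B ≫ s := lift_proj _ _ _ _
      have hu := unpair_proj_proj T (sub r B)
      refine ⟨Sig T (sub r B), e.hom ≫ l ≫ (pair T (sub r B)).1,
        unpair T (sub r B) ≫ q r B ≫ e.inv, ?_, ?_, ?_⟩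
      · simp [reassoc_of% (pair_unpair T (sub r B)), reassoc_of% hl]
      · simp [(pair T (sub r B)).2, reassoc_of% hl', hs]
      · rw [← hu, ← hr]
        simp [reassoc_of% (q_proj r B)]

end

end IdentityTypes

/-! ## Dependent products in a contextual category -/

section Products

open ContextualCategory Tribe SigmaStructure IdStructure PiStructure

variable {C : Type u} [Category.{v} C] [ContextualCategory.{w} C] [PiStructure C]

lemma applyOver_congr {Δ Γ : C} {σ σ' : Δ ⟶ Γ} (hσ : σ = σ') {A : Ty Γ} {B : Ty (ext A)}
    {k : Elt σ (Pi A B)} {k' : Elt σ' (Pi A B)} {a : Elt σ A} {a' : Elt σ' A}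
    (hk : k.hom = k'.hom) (ha : a.hom = a'.hom) :
    (applyOver k a).hom = (applyOver k' a').hom := by
  subst hσ
  rw [Elt.ext hk]
  obtain rfl := Elt.ext ha
  rfl

/-- The transpose `Δ.σ^*A ⟶ Γ.A.B` of a map `Δ ⟶ Γ.Π(A,B)`. -/
noncomputable def transpose {Δ Γ : C} {σ : Δ ⟶ Γ} {A : Ty Γ} {B : Ty (ext A)}
    (k : Elt σ (Pi A B)) : Elt (q σ A) B :=
  ⟨(applyOver (Elt.pre (proj (sub σ A)) k) (varElt σ A)).1, (applyOver _ _).2⟩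

lemma comp_transpose {Θ Δ Γ : C} {σ : Δ ⟶ Γ} {A : Ty Γ} {B : Ty (ext A)} (k : Elt σ (Pi A B))
    (m : Θ ⟶ ext (sub σ A)) {σ' : Θ ⟶ Γ} (k' : Elt σ' (Pi A B)) (a : Elt σ' A)
    (hk : m ≫ proj (sub σ A) ≫ k.1 = k'.1) (ha : m ≫ q σ A = a.1) :
    m ≫ (transpose k).1 = (applyOver k' a).1 := by
  unfold transpose
  rw [pre_applyOver]
  refine applyOver_congr ?_ hk ha
  rw [← a.2, ← ha, Category.assoc, q_proj]

/-- The β-rule combined with the naturality of abstraction, so that it also applies after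
restriction along `m`. -/
lemma applyOver_pre_lamOver {Θ Δ Γ : C} (m : Θ ⟶ Δ) {σ : Δ ⟶ Γ} {A : Ty Γ} {B : Ty (ext A)}
    (b : Elt (q σ A) B) (a : Elt (m ≫ σ) A) :
    (applyOver (Elt.pre m (lamOver b)) a).1 = (lift σ m a.1 a.2).1 ≫ b.1 := by
  have h₁ : (lift (m ≫ σ) (𝟙 Θ) a.hom (by rw [a.w, Category.id_comp])).hom ≫
      extCast (sub_comp m σ A) ≫ q m (sub σ A) = (lift σ m a.hom a.w).hom := by
    apply lift_ext
    · simp only [Category.assoc, lift_q]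
      rw [q_comp', extCast_trans_assoc, extCast_refl, Category.id_comp (q _ _), lift_q]
    · simp only [Category.assoc, q_proj, lift_proj]
      rw [← Category.assoc (extCast _), extCast_proj, ← Category.assoc, lift_proj,
        Category.id_comp]
  have hw : (extCast (sub_comp m σ A) ≫ q m (sub σ A) ≫ b.hom) ≫ proj B = q (m ≫ σ) A := by
    rw [Category.assoc, Category.assoc, b.2, q_comp', extCast_trans_assoc, extCast_refl,
      Category.id_comp]
  have h₂ : Elt.pre m (lamOver b) = lamOver ⟨_, hw⟩ := by
    apply Elt.ext
    exact pre_lamOver m _ hw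
  rw [h₂, ← h₁, applyOver_lamOver]
  simp

/-- Application in a pulled back product type. -/
lemma applyOver_sub {Θ Δ Γ : C} {τ : Θ ⟶ Δ} {σ : Δ ⟶ Γ} {A : Ty Γ} {B : Ty (ext A)}
    (K : Elt τ (Pi (sub σ A) (sub (q σ A) B))) (a : Elt τ (sub σ A))
    (k' : Elt (τ ≫ σ) (Pi A B)) (hk : K.1 ≫ extCast (sub_Pi σ A B).symm ≫ q σ (Pi A B) = k'.1)
    (a' : Elt (τ ≫ σ) A) (ha : a.1 ≫ q σ A = a'.1) :
    (applyOver K a).1 ≫ q (q σ A) B = (applyOver k' a').1 := by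
  have hB : sub (q τ (sub σ A)) (sub (q σ A) B) = sub (q τ (sub σ A) ≫ q σ A) B :=
    (sub_comp _ _ _).symm
  have hq : q τ (Pi (sub σ A) (sub (q σ A) B)) ≫ extCast (sub_Pi σ A B).symm =
      extCast (by rw [sub_Pi σ A B]) ≫ q τ (sub σ (Pi A B)) := q_extCast _ _
  unfold applyOver
  simp only [Category.assoc]
  rw [q_comp', ← Category.assoc, ← extCast_pi hB]
  refine (app_presentation k' a' _ (sub_comp τ σ A).symm _ (q_comp' τ σ A) _
    (extCast (by rw [← hB, ← sub_Pi, ← sub_Pi, ← sub_comp]) ≫ q (τ ≫ σ) (Pi A B))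
    (fun h => rfl) ?_ _ ?_)
  · rw [← hk]
    simp only [Sec.cast, Category.assoc, extCast_trans_assoc]
    have : K.1 = (lift τ (𝟙 Θ) K.1 (by rw [K.2, Category.id_comp])).1 ≫
      q τ (Pi (sub σ A) (sub (q σ A) B)) := by rw [lift_q]
    conv_rhs => rw [this]
    rw [Category.assoc, reassoc_of% hq, q_comp' τ σ (Pi A B), extCast_trans_assoc]
  · rw [← ha, ← Category.assoc, lift_q]

/-- The section of the pulled back product type corresponding to a map to a product type. -/
noncomputable def piSec {Δ Γ : C} {σ : Δ ⟶ Γ} {A : Ty Γ} {B : Ty (ext A)} (k : Elt σ (Pi A B)) :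
    Sec (Pi (sub σ A) (sub (q σ A) B)) :=
  Sec.cast (sub_Pi σ A B) (lift σ (𝟙 Δ) k.1 (by rw [k.2, Category.id_comp]))

lemma piSec_q {Δ Γ : C} {σ : Δ ⟶ Γ} {A : Ty Γ} {B : Ty (ext A)} (k : Elt σ (Pi A B)) :
    (piSec k).1 ≫ extCast (sub_Pi σ A B).symm ≫ q σ (Pi A B) = k.1 := by
  simp [piSec, Sec.cast, extCast_trans_assoc]

lemma appVar_piSec {Δ Γ : C} {σ : Δ ⟶ Γ} {A : Ty Γ} {B : Ty (ext A)} (k : Elt σ (Pi A B)) :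
    (appVar (piSec k)).1 ≫ q (q σ A) B = (transpose k).1 := by
  unfold appVar transpose
  refine applyOver_sub _ _ _ ?_ _ ?_
  · simp only [Category.assoc, piSec_q]; rfl
  · rw [Category.id_comp]; rfl

/-- A map `Δ ⟶ Γ.Π(A,B)` is a section of the substituted product type over `Δ`, where the η-rule for
sections is available. -/
lemma lamOver_transpose (hη : PiEta C) {Δ Γ : C} {σ : Δ ⟶ Γ} {A : Ty Γ} {B : Ty (ext A)}
    (k : Elt σ (Pi A B)) : lamOver (transpose k) = k := by
  have h : lift (q σ A) (𝟙 _) (transpose k).1 (by rw [(transpose k).2, Category.id_comp]) =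
      appVar (piSec k) := by
    apply Elt.ext
    apply lift_ext
    · rw [lift_q, appVar_piSec]
    · rw [lift_proj, (appVar _).2]
  apply Elt.ext
  unfold lamOver
  simp only [h]
  rw [hη]
  simpa [Sec.cast] using piSec_q k

/-- The universal element of a product type. -/
def genericElt {Γ : C} (A : Ty Γ) : Elt (proj A) A := ⟨𝟙 _, Category.id_comp _⟩

/-- The dependent product of dependent projections given by `Π`. -/
noncomputable def piProduct (hη : PiEta C) {Γ : C} (A : Ty Γ) (B : Ty (ext A)) :
    DependentProduct (proj A) (proj B) where
  obj := ext (Pi A B)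
  hom := proj (Pi A B)
  pb := ext (sub (proj (Pi A B)) A)
  fst := proj _
  snd := q _ A
  isPullback := (ContextualCategory.isPullback _ _).flip
  ev := (transpose (genericElt (Pi A B))).1
  ev_comp := (transpose _).2
  universal := fun {Z V} f v₁ v₂ hV g hg => by
    -- Abstraction needs the canonical pullback, so the given `V` is replaced by it. β then yields
    -- existence and η uniqueness.
    let i : V ≅ ext (sub f A) := hV.flip.isoIsPullback _ _ (ContextualCategory.isPullback f A)
    have i₁ : i.inv ≫ v₁ = proj (sub f A) := hV.flip.isoIsPullback_inv_snd _ _ _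
    have i₂ : i.inv ≫ v₂ = q f A := hV.flip.isoIsPullback_inv_fst _ _ _
    have j₁ : i.hom ≫ proj (sub f A) = v₁ := hV.flip.isoIsPullback_hom_snd _ _ _
    have j₂ : i.hom ≫ q f A = v₂ := hV.flip.isoIsPullback_hom_fst _ _ _
    let b : Elt (q f A) B := ⟨i.inv ≫ g, by rw [Category.assoc, hg, i₂]⟩
    have w : v₂ ≫ proj A = (v₁ ≫ (lamOver b).1) ≫ proj (Pi A B) := by
      rw [Category.assoc, (lamOver b).2, hV.w]
    refine ⟨(lamOver b).1, ⟨(lamOver b).2, (lift (proj (Pi A B)) _ v₂ w).1, lift_proj _ _ _ _,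
      lift_q _ _ _ _, ?_⟩, ?_⟩
    · refine (comp_transpose _ _ (Elt.pre v₁ (lamOver b)) ⟨v₂, hV.w.symm⟩ ?_
        (lift_q _ _ _ _)).trans ?_
      · rw [← Category.assoc, lift_proj]; exact Category.comp_id _
      · rw [applyOver_pre_lamOver]
        have : (lift f v₁ v₂ hV.w.symm).1 = i.hom := by
          apply lift_ext
          · rw [lift_q, j₂]
          · rw [lift_proj, j₁]
        simp [this, b]
    · rintro k ⟨rfl, m, h₁, h₂, h₃⟩
      let k' : Elt (k ≫ proj (Pi A B)) (Pi A B) := ⟨k, rfl⟩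
      have : k' = lamOver b := by
        rw [← lamOver_transpose hη k']
        congr 1
        apply Elt.ext
        change _ = i.inv ≫ g
        rw [← h₃, ← Category.assoc]
        refine (comp_transpose _ _ (Elt.pre (proj (sub (k ≫ proj (Pi A B)) A)) k') (varElt _ _)
          ?_ ?_).symm
        · rw [Category.assoc, ← Category.assoc m, h₁, Category.assoc, reassoc_of% i₁]
          congr 1
          exact Category.comp_id _
        · rw [Category.assoc, h₂, i₂]; rfl
      exact congrArg Elt.hom this

/-- The hypothesis speaks about sections only. Maps `Z ⟶ Γ.Π(A,B)` are therefore turned into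
sections of the product type substituted to `Z`, the transposes into applications to a variable, and
the resulting identification is mapped forward again. -/
lemma piProduct_extensional [IdStructure C] (hη : PiEta C) (hext : FunExt C) {Γ : C} (A : Ty Γ)
    (B : Ty (ext A)) : (piProduct hη A B).Extensional (fibrations C) := by
  intro Z V (k : Z ⟶ ext (Pi A B)) (k' : Z ⟶ ext (Pi A B)) v₁
    (m : V ⟶ ext (sub (proj (Pi A B)) A)) (m' : V ⟶ ext (sub (proj (Pi A B)) A)) hV hk hm hm' hmm H
  change IsPullback v₁ (m ≫ q _ _) (k ≫ proj _) _ at hV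
  change k ≫ proj _ = k' ≫ proj _ at hk
  change m ≫ proj _ = v₁ ≫ k at hm
  change m' ≫ proj _ = v₁ ≫ k' at hm'
  change m ≫ q _ _ = m' ≫ q _ _ at hmm
  change FibreHomotopic _ _ (m ≫ (transpose (genericElt (Pi A B))).1)
    (m' ≫ (transpose (genericElt (Pi A B))).1) at H
  change FibreHomotopic _ (proj (Pi A B)) _ _
  let i : V ≅ ext (sub (k ≫ proj (Pi A B)) A) :=
    hV.flip.isoIsPullback _ _ (ContextualCategory.isPullback _ A)
  have i₁ : i.inv ≫ v₁ = proj (sub (k ≫ proj (Pi A B)) A) := hV.flip.isoIsPullback_inv_snd _ _ _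
  have i₂ : i.inv ≫ m ≫ q _ A = q (k ≫ proj (Pi A B)) A := hV.flip.isoIsPullback_inv_fst _ _ _
  let κ : Elt (k ≫ proj (Pi A B)) (Pi A B) := ⟨k, rfl⟩
  let κ' : Elt (k ≫ proj (Pi A B)) (Pi A B) := ⟨k', hk.symm⟩
  have e : i.inv ≫ m ≫ (transpose (genericElt (Pi A B))).1 = (transpose κ).1 := by
    rw [← Category.assoc]
    refine comp_transpose _ _ (Elt.pre (proj (sub (k ≫ proj (Pi A B)) A)) κ) (varElt _ _) ?_ ?_
    · rw [Category.assoc, ← Category.assoc m, hm, Category.assoc, reassoc_of% i₁]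
      congr 1
      exact Category.comp_id _
    · rw [Category.assoc, i₂]; rfl
  have e' : i.inv ≫ m' ≫ (transpose (genericElt (Pi A B))).1 = (transpose κ').1 := by
    rw [← Category.assoc]
    refine comp_transpose _ _ (Elt.pre (proj (sub (k ≫ proj (Pi A B)) A)) κ') (varElt _ _) ?_ ?_
    · rw [Category.assoc, ← Category.assoc m', hm', Category.assoc, reassoc_of% i₁]
      congr 1
      exact Category.comp_id _
    · rw [Category.assoc, ← hmm, i₂]; rfl
  have H₁ := H.pre i.inv
  rw [e, e', ← appVar_piSec, ← appVar_piSec] at H₁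
  -- An identification in `B` with both ends over the same point is an identification in the
  -- substituted family, by stability of `Id`.
  have H₂ := (idHomotopic_of_fibreHomotopic H₁).lift
    (((appVar (piSec κ)).2).trans ((appVar (piSec κ')).2).symm)
  obtain ⟨h⟩ := hext _ _ H₂.exists_sec
  have H₃ := (IdHomotopic.of_elt h).fibreHomotopic.map (fibrations_isClan C) (fibrations_proj _)
    (extCast (sub_Pi _ A B).symm ≫ q _ (Pi A B)) (k ≫ proj (Pi A B)) (by
      rw [Category.assoc, q_proj, ← Category.assoc, extCast_proj])
  simpa [piSec_q] using H₃

end Products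

/-! ## The tribe of a contextual category -/

section ContextualTribe

open ContextualCategory Tribe SigmaStructure IdStructure PiStructure

variable {C : Type u} [Category.{v} C] [ContextualCategory.{w} C]
variable [SigmaStructure C] [IdStructure C] [PiStructure C]

lemma exists_pi_display_display (hη : PiEta C) (hext : FunExt C) {X Y E : C} {p : X ⟶ Y}
    {q : E ⟶ X} (hp : IsDisplay p) (hq : IsDisplay q) :
    ∃ P : DependentProduct p q, fibrations C P.hom ∧ P.Extensional (fibrations C) := by
  obtain ⟨A, e, he⟩ := hp
  obtain ⟨B, d, hd⟩ := hq.comp_iso e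
  exact ⟨(piProduct hη A B).ofIso e he d hd, fibrations_proj _,
    DependentProduct.Extensional.ofIso (fibrations_isClan C) (piProduct_extensional hη hext A B)
      hq.fibrations e he d hd⟩

/-- Induction on the length of `q` with a single projection as base: the next factor is pulled back
along the evaluation map, and its dependent product is taken along a base change of `p`, which is
again a display map. -/
lemma exists_pi_display (hη : PiEta C) (hext : FunExt C) {X E : C} {q : E ⟶ X}
    (hq : fibrations C q) : ∀ {Y : C} {p : X ⟶ Y}, IsDisplay p →
      ∃ P : DependentProduct p q, fibrations C P.hom := by
  refine fibrations_induction (R := fun {E X} q => ∀ {Y : C} {p : X ⟶ Y}, IsDisplay p →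
      ∃ P : DependentProduct p q, fibrations C P.hom) ?_ ?_ hq
  · intro E X q _ Y p hp
    exact ⟨.ofIsIso p q, fibrations_of_isIso (𝟙 Y)⟩
  · intro E₂ E₁ X q₂ q₁ hq₂ _ ih Y p hp
    obtain ⟨P₁, h₁⟩ := ih hp
    obtain ⟨W, a, b, hW⟩ := hq₂.exists_pullback P₁.ev
    obtain ⟨P₂, h₂, -⟩ := exists_pi_display_display hη hext (hp.base_change P₁.isPullback.flip)
      (hq₂.base_change hW.flip)
    exact ⟨.compDomain P₁ hW.flip P₂, fibrations_comp h₂ h₁⟩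

/-- Extensionality does not iterate along a composite `q` as existence does, because the images of
the two maps in the first dependent product are only homotopic. Writing `q` as a retract of a single
projection avoids this. -/
lemma extensional_of_display (hη : PiEta C) (hext : FunExt C) {X Y E : C} {p : X ⟶ Y}
    {q : E ⟶ X} (hp : IsDisplay p) (hq : fibrations C q) (P : DependentProduct p q) :
    P.Extensional (fibrations C) := by
  rcases isIso_or_exists_retract hq with h | ⟨T, s, r, hsr, hs, hr⟩
  · exact DependentProduct.Extensional.of_retract (fibrations_isClan C) hq (P' := .ofIsIso p q)
      (fibrations_of_isIso (𝟙 Y))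
      (DependentProduct.Extensional.ofIsIso p q) (Category.id_comp _)
      (Category.id_comp _) (Category.id_comp _)
  · obtain ⟨P', h, h'⟩ := exists_pi_display_display hη hext hp (isDisplay_proj T)
    exact DependentProduct.Extensional.of_retract (fibrations_isClan C) hq h h' hs hr hsr

/-- Dependent products along a composite base are iterated. The first stage is again a general
fibration, which is why arbitrary `q` over a single display map had to be settled beforehand. -/
lemma exists_pi_extensional (hη : PiEta C) (hext : FunExt C) {X Y : C} {p : X ⟶ Y}
    (hp : fibrations C p) : ∀ {E : C} {q : E ⟶ X}, fibrations C q →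
      ∃ P : DependentProduct p q, fibrations C P.hom ∧ P.Extensional (fibrations C) := by
  refine fibrations_induction (R := fun {X Y} p => ∀ {E : C} {q : E ⟶ X}, fibrations C q →
      ∃ P : DependentProduct p q, fibrations C P.hom ∧ P.Extensional (fibrations C)) ?_ ?_ hp
  · intro X Y p _ E q hq
    exact ⟨.ofIsIsoBase p q, fibrations_comp hq (fibrations_of_isIso p),
      DependentProduct.Extensional.ofIsIsoBase (fibrations_isClan C) p q hq⟩
  · intro X Y Z p₁ p₂ hp₁ hp₂ ih E q hq
    obtain ⟨P₁, h₁⟩ := exists_pi_display hη hext hq hp₁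
    obtain ⟨P₂, h₂, h₂'⟩ := ih h₁
    obtain ⟨W, a, b, hW⟩ := (hp₁.base_change P₁.isPullback.flip).exists_pullback P₂.ev
    exact ⟨.compBase (fun f => (fibrations_isClan C).exists_pullback f p₂ hp₂) P₁ P₂ hW, h₂,
      DependentProduct.Extensional.compBase _ (extensional_of_display hη hext hp₁ hq P₁) h₂' hW⟩

lemma exists_pi_fibrations (hη : PiEta C) (hext : FunExt C) {X Y E : C} (p : X ⟶ Y)
    (q : E ⟶ X) (hp : fibrations C p) (hq : fibrations C q) :
    ∃ P : DependentProduct p q, fibrations C P.hom := by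
  obtain ⟨P, h, -⟩ := exists_pi_extensional hη hext hp hq
  exact ⟨P, h⟩

/-- Two dependent products of the same data are isomorphic over the base. -/
lemma Tribe.DependentProduct.exists_iso {D : Type u} [Category.{v} D] {X Y E : D} {p : X ⟶ Y}
    {q : E ⟶ X} (P P' : DependentProduct p q) : ∃ e : P.obj ≅ P'.obj, e.hom ≫ P'.hom = P.hom := by
  obtain ⟨S, n, hS, h₁, h₂, h₃⟩ := P.exists_map P' (𝟙 E) (Category.id_comp _)
  obtain ⟨R, n', hR, h₁', h₂', h₃'⟩ := P'.exists_map P (𝟙 E) (Category.id_comp _)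
  exact ⟨⟨S, R, P.map_comp_eq_id P' (Category.id_comp _) hS h₁ h₂ h₃ hR h₁' h₂' h₃',
    P'.map_comp_eq_id P (Category.id_comp _) hR h₁' h₂' h₃' hS h₁ h₂ h₃⟩, hS⟩

/-- Dependent products are unique up to isomorphism over the base, so what holds for the constructed
one holds for all. -/
lemma fibrations_pi (hη : PiEta C) (hext : FunExt C) {X Y E : C} {p : X ⟶ Y}
    {q : E ⟶ X} (hp : fibrations C p) (hq : fibrations C q) (P : DependentProduct p q) :
    fibrations C P.hom ∧ P.Extensional (fibrations C) := by
  obtain ⟨P', h, h'⟩ := exists_pi_extensional hη hext hp hq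
  obtain ⟨e, he⟩ := P.exists_iso P'
  refine ⟨he ▸ fibrations_comp (fibrations_of_isIso e.hom) h, ?_⟩
  exact DependentProduct.Extensional.of_retract (fibrations_isClan C) hq h h'
    (Category.id_comp _) (Category.id_comp _) (Category.id_comp _)

lemma fibrations_frobenius (hη : PiEta C) (hext : FunExt C) : Frobenius (fibrations C) :=
  anodyne_stable_of_exists_pi (fibrations_isClan C) (exists_pi_fibrations hη hext)

/-- Based path induction: the map `(a, refl)` from `Γ` to the paths out of a section `a` is
anodyne. -/
lemma exists_based_path (hη : PiEta C) (hext : FunExt C) {Γ : C} {A : Ty Γ} (a : Sec A) :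
    ∃ (S : C) (u : Γ ⟶ S) (t : S ⟶ ext A), Anodyne (fibrations C) u ∧ fibrations C t ∧
      u ≫ t = a.1 := by
  -- The paths out of `a` form a two-step extension `S` of `Γ`, whereas identity types are available
  -- for single types. `T` is the corresponding sum, of which `S` is a retract by `s` and `ρ`.
  let T := Sig (wk A A) (Id A)
  let S := ext (sub (q a.1 (wk A A)) (Id A))
  let b : S ⟶ ext (Id A) := q (q a.1 (wk A A)) (Id A)
  let π : S ⟶ Γ := proj _ ≫ proj _
  have hS : IsPullback b π (idSrc A) a.1 :=
    (ContextualCategory.isPullback _ _).paste_vert (ContextualCategory.isPullback a.1 (wk A A))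
  let u : Γ ⟶ S := hS.lift (a.1 ≫ (IdStructure.refl A).1) (𝟙 Γ) (by simp)
  have ub : u ≫ b = a.1 ≫ (IdStructure.refl A).1 := hS.lift_fst _ _ _
  have uπ : u ≫ π = 𝟙 Γ := hS.lift_snd _ _ _
  have hp : (SigmaStructure.pair (wk A A) (Id A)).1 ≫ proj T = idSrc A :=
    (SigmaStructure.pair _ _).2
  have hu : unpair (wk A A) (Id A) ≫ idSrc A = proj T := unpair_proj_proj _ _
  have hT := ContextualCategory.isPullback a.1 T
  let s : S ⟶ ext (sub a.1 T) := hT.lift (b ≫ (SigmaStructure.pair (wk A A) (Id A)).1) π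
    (by rw [Category.assoc, hp, hS.w])
  have s₁ : s ≫ q a.1 T = b ≫ (SigmaStructure.pair (wk A A) (Id A)).1 := hT.lift_fst _ _ _
  have s₂ : s ≫ proj _ = π := hT.lift_snd _ _ _
  let ρ : ext (sub a.1 T) ⟶ S := hS.lift (q a.1 T ≫ unpair (wk A A) (Id A)) (proj _)
    (by rw [Category.assoc, hu, hT.w])
  have hsρ : s ≫ ρ = 𝟙 S := by
    apply hS.hom_ext
    · rw [Category.assoc, hS.lift_fst, reassoc_of% s₁, pair_unpair]; simp
    · rw [Category.assoc, hS.lift_snd, s₂]; simp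
  -- Contraction of singletons: by `J`, every pair `(y, p)` is identified in `T` with `(x, refl)`,
  -- and this identification is reflexivity when `p` is.
  obtain ⟨H', hr, hH⟩ := exists_lift (anodyne_refl A) (fibrations_proj (Id T))
    (t := (IdStructure.refl A).1 ≫ (SigmaStructure.pair (wk A A) (Id A)).1 ≫ (IdStructure.refl T).1)
    (b := (isPullback_wk T).lift (idSrc A ≫ (IdStructure.refl A).1 ≫
      (SigmaStructure.pair (wk A A) (Id A)).1)
      (SigmaStructure.pair (wk A A) (Id A)).1 (by simp [hp])) (by
        apply (isPullback_wk T).hom_ext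
        · simp only [Category.assoc, IsPullback.lift_fst, (IdStructure.refl T).2, (diagSec T).2]
          rw [← Category.assoc (IdStructure.refl A).1 (idSrc A), refl_idSrc, Category.id_comp]
          exact congrArg ((IdStructure.refl A).1 ≫ ·) (Category.comp_id _)
        · simp only [Category.assoc, IsPullback.lift_snd]
          rw [← Category.assoc (IdStructure.refl T).1, (IdStructure.refl T).2, diagSec_q,
            Category.comp_id])
  have H₀ : H' ≫ idSrc T = idSrc A ≫ (IdStructure.refl A).1 ≫
      (SigmaStructure.pair (wk A A) (Id A)).1 := by
    rw [idSrc, reassoc_of% hH, IsPullback.lift_fst]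
  have H₁ : H' ≫ idTgt T = (SigmaStructure.pair (wk A A) (Id A)).1 := by
    rw [idTgt, reassoc_of% hH, IsPullback.lift_snd]
  -- The contraction is restricted to the base point `a`, which gives the deformation of `S` onto
  -- the image of `u`.
  obtain ⟨H, hH, h₀, h₁⟩ := exists_idMap_lift (f := a.1) (A := T) (s := π ≫ u ≫ s) (t := s)
    (H := b ≫ H') (by simp only [Category.assoc, s₂, uπ]; simp)
    (by simp only [Category.assoc, H₀, s₁, reassoc_of% ub, reassoc_of% hS.w])
    (by rw [Category.assoc, H₁, s₁])
  refine ⟨S, u, b ≫ idTgt A, ?_, ?_, by rw [reassoc_of% ub, refl_idTgt, Category.comp_id]⟩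
  · refine anodyne_of_deformation (fibrations_isClan C) (fibrations_frobenius hη hext) π uπ s ρ
      hsρ (anodyne_refl (sub a.1 T)) (refl_idSrc _) (refl_idTgt _) H h₀ h₁ ?_
    -- The deformation is strictly constant on `Γ` because `H'` was chosen to restrict to
    -- reflexivity along `refl`.
    apply (isPullback_idMap a.1 T).hom_ext
    · simp only [Category.assoc, hH, refl_idMap, reassoc_of% ub, hr, reassoc_of% s₁]
    · apply (isPullback_wk _).hom_ext
      · have := congrArg (u ≫ ·) h₀
        simp only [Category.assoc, reassoc_of% uπ] at this ⊢
        refine this.trans ?_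
        have h := refl_idSrc (sub a.1 T)
        rw [idSrc] at h
        rw [h, Category.comp_id]
      · have := congrArg (u ≫ ·) h₁
        simp only [Category.assoc] at this ⊢
        refine this.trans ?_
        have h := refl_idTgt (sub a.1 T)
        rw [idTgt] at h
        rw [h, Category.comp_id]
  -- As `a` is a section, substituting it into the weakened type returns `A` up to isomorphism, so
  -- the endpoint map is a projection followed by an isomorphism.
  · have h : IsPullback (q a.1 (wk A A) ≫ q (proj A) A) (proj (sub a.1 (wk A A)))
        (proj A) (𝟙 Γ) := by
      have := (ContextualCategory.isPullback a.1 (wk A A)).paste_horiz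
        (ContextualCategory.isPullback (proj A) A)
      rwa [a.2] at this
    have : IsIso (q a.1 (wk A A) ≫ q (proj A) A) := h.isIso_fst_of_isIso
    have e : b ≫ idTgt A = proj _ ≫ q a.1 (wk A A) ≫ q (proj A) A := by
      rw [idTgt, reassoc_of% (q_proj (q a.1 (wk A A)) (Id A))]
    rw [e]
    exact (isDisplay_proj _).comp_fibrations (fibrations_of_isIso _)

/-- Induction on the length of the codomain. Over a context of length zero every map is a fibration;
the last type of a longer context is handled by adjoining the paths out of a section. -/
lemma exists_factorisation (hη : PiEta C) (hext : FunExt C) {X Y : C} (f : X ⟶ Y) :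
    ∃ (Z : C) (i : X ⟶ Z) (p : Z ⟶ Y), Anodyne (fibrations C) i ∧ fibrations C p ∧
      i ≫ p = f := by
  obtain ⟨n, hn⟩ : ∃ n, len Y = n := ⟨_, rfl⟩
  induction n generalizing Y with
  | zero =>
    obtain rfl := (len_eq_zero_iff Y).1 hn
    exact ⟨X, 𝟙 X, f, anodyne_of_isIso _, fibrations_root f, Category.id_comp _⟩
  | succ n ih =>
    obtain ⟨Y, A, rfl⟩ := exists_ext Y (by omega)
    rw [len_ext] at hn
    obtain ⟨Z, i, p, hi, hp, h⟩ := ih (f ≫ proj A) (by omega)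
    -- `f` is a partial section, on the image of `i`, of the type pulled back to `Z`; since `i` is
    -- anodyne it extends to all of `Z`.
    obtain ⟨a, h₁, h₂⟩ := exists_lift hi (fibrations_proj (sub p A))
      (t := (lift p i f h.symm).1) (b := 𝟙 Z) (by rw [lift_proj, Category.comp_id])
    obtain ⟨S, u, t, hu, ht, h₃⟩ := exists_based_path hη hext (⟨a, h₂⟩ : Sec (sub p A))
    refine ⟨S, i ≫ u, t ≫ q p A, anodyne_comp hi hu, fibrations_comp ht ?_, ?_⟩
    · exact (fibrations_isClan C).base_change (ContextualCategory.isPullback p A).flip hp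
    · rw [Category.assoc, reassoc_of% h₃, reassoc_of% h₁, lift_q]

lemma fibrations_hasPaths (hη : PiEta C) (hext : FunExt C) : HasPaths (fibrations C) :=
  hasPaths_of_factorisation (fibrations_isClan C) (exists_factorisation hη hext)

/-- The fibrations of a contextual category form a `π`-tribe. -/
theorem fibrations_isPiTribe (hη : PiEta C) (hext : FunExt C) : IsPiTribe (fibrations C) where
  isMultiplicative := (fibrations_isClan C).isMultiplicative
  exists_terminal := rootIsTerminal.hasTerminal
  terminal_fib := fibrations_terminal
  exists_pullback := fun f g hg => by
    obtain ⟨P, a, b, h⟩ := (fibrations_isClan C).exists_pullback f g hg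
    exact h.hasPullback
  stable := (fibrations_isClan C).stable
  factorisation := exists_factorisation hη hext
  anodyne_stable := fibrations_frobenius hη hext
  exists_pi := exists_pi_fibrations hη hext
  pi_preserves := fun p q₁ q₂ hp hq₁ hq₂ e he heq P₁ P₂ k hk m hm₁ hm₂ hm₃ =>
    isHomotopyEquiv_pi (fibrations_hasPaths hη hext) p q₁ q₂ e he heq P₁ P₂
      (fibrations_pi hη hext hp hq₁ P₁).1 (fibrations_pi hη hext hp hq₂ P₂).1
      (fibrations_pi hη hext hp hq₁ P₁).2 (fibrations_pi hη hext hp hq₂ P₂).2 k hk m hm₁ hm₂ hm₃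

end ContextualTribe

/-! ## Exponentials in slices -/

namespace Tribe

section SliceHoms

variable {D : Type u} [Category.{v} D]

lemma isPullback_of_overFanIsLimit {X : D} {A B : Over X} (c : BinaryFan A B) (hc : IsLimit c) :
    IsPullback c.fst.left c.snd.left A.hom B.hom := by
  refine ⟨⟨(Over.w c.fst).trans (Over.w c.snd).symm⟩, ⟨PullbackCone.IsLimit.mk _
    (fun s => (hc.lift (BinaryFan.mk (P := Over.mk (s.fst ≫ A.hom)) (Over.homMk s.fst)
      (Over.homMk s.snd s.condition.symm))).left)
    (fun s => congrArg (fun f => f.left) (hc.fac (BinaryFan.mk (P := Over.mk (s.fst ≫ A.hom))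
      (Over.homMk s.fst) (Over.homMk s.snd s.condition.symm)) ⟨.left⟩))
    (fun s => congrArg (fun f => f.left) (hc.fac (BinaryFan.mk (P := Over.mk (s.fst ≫ A.hom))
      (Over.homMk s.fst) (Over.homMk s.snd s.condition.symm)) ⟨.right⟩))
    (fun s m h₁ h₂ => ?_)⟩⟩
  have hm : m ≫ c.pt.hom = s.fst ≫ A.hom := by
    rw [← h₁]
    exact (congrArg (m ≫ ·) (Over.w c.fst).symm).trans (Category.assoc _ _ _).symm
  have : (Over.homMk m hm : Over.mk (s.fst ≫ A.hom) ⟶ c.pt) =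
      hc.lift (BinaryFan.mk (P := Over.mk (s.fst ≫ A.hom)) (Over.homMk s.fst)
      (Over.homMk s.snd s.condition.symm)) := by
    apply BinaryFan.IsLimit.hom_ext hc
    · exact Eq.trans (by ext; exact h₁) (hc.fac (BinaryFan.mk (P := Over.mk (s.fst ≫ A.hom))
        (Over.homMk s.fst) (Over.homMk s.snd s.condition.symm)) ⟨.left⟩).symm
    · exact Eq.trans (by ext; exact h₂) (hc.fac (BinaryFan.mk (P := Over.mk (s.fst ≫ A.hom))
        (Over.homMk s.fst) (Over.homMk s.snd s.condition.symm)) ⟨.right⟩).symm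
  exact congrArg (fun f => f.left) this

/-- An exponential of `g` by `p` in the slice over `Y`, described in terms of the ambient
category. -/
structure SliceHom {X Y G : D} (p : X ⟶ Y) (g : G ⟶ Y) where
  obj : D
  hom : obj ⟶ Y
  pb : D
  fst : pb ⟶ obj
  snd : pb ⟶ X
  isPullback : IsPullback fst snd hom p
  ev : pb ⟶ G
  ev_comp : ev ≫ g = snd ≫ p
  universal : ∀ {Z V : D} (f : Z ⟶ Y) (v₁ : V ⟶ Z) (v₂ : V ⟶ X), IsPullback v₁ v₂ f p →
    ∀ h : V ⟶ G, h ≫ g = v₂ ≫ p → ∃! k : Z ⟶ obj, k ≫ hom = f ∧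
      ∃ m : V ⟶ pb, m ≫ fst = v₁ ≫ k ∧ m ≫ snd = v₂ ∧ m ≫ ev = h

namespace SliceHom

variable {X Y G : D} {p : X ⟶ Y} {g : G ⟶ Y}

/-- Evaluation of generalised elements. -/
noncomputable def apply (S : SliceHom p g) {Z : D} (k : Z ⟶ S.obj) (a : Z ⟶ X)
    (h : k ≫ S.hom = a ≫ p) : Z ⟶ G :=
  S.isPullback.lift k a h ≫ S.ev

lemma comp_ev (S : SliceHom p g) {Z : D} (m : Z ⟶ S.pb) {k : Z ⟶ S.obj} {a : Z ⟶ X}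
    (hk : m ≫ S.fst = k) (ha : m ≫ S.snd = a) :
    m ≫ S.ev = S.apply k a (by rw [← hk, ← ha, Category.assoc, Category.assoc,
      S.isPullback.w]) := by
  unfold apply
  congr 1
  apply S.isPullback.hom_ext <;> simp [hk, ha]

lemma comp_apply (S : SliceHom p g) {Z Z' : D} (m : Z' ⟶ Z) (k : Z ⟶ S.obj) (a : Z ⟶ X)
    (h : k ≫ S.hom = a ≫ p) :
    m ≫ S.apply k a h = S.apply (m ≫ k) (m ≫ a) (by simp [h]) := by
  unfold apply
  rw [← Category.assoc]
  congr 1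
  apply S.isPullback.hom_ext <;> simp

lemma apply_comp (S : SliceHom p g) {Z : D} (k : Z ⟶ S.obj) (a : Z ⟶ X)
    (h : k ≫ S.hom = a ≫ p) : S.apply k a h ≫ g = a ≫ p := by
  rw [apply, Category.assoc, S.ev_comp, IsPullback.lift_snd_assoc]

/-- Both maps solve the same universal problem, that of transposing the common value on the pullback
of `p`. -/
lemma hom_ext (S : SliceHom p g) {Z V : D}
    {k k' : Z ⟶ S.obj} (hk : k ≫ S.hom = k' ≫ S.hom) {v₁ : V ⟶ Z} {v₂ : V ⟶ X}
    (hV : IsPullback v₁ v₂ (k ≫ S.hom) p)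
    (h : S.apply (v₁ ≫ k) v₂ (by simp [hV.w]) = S.apply (v₁ ≫ k') v₂ (by simp [← hV.w, hk])) :
    k = k' := by
  obtain ⟨l, -, hl⟩ := S.universal (k ≫ S.hom) v₁ v₂ hV _ (S.apply_comp (v₁ ≫ k) v₂
    (by simp [hV.w]))
  rw [hl k ⟨rfl, S.isPullback.lift _ _ _, IsPullback.lift_fst _ _ _ _,
      IsPullback.lift_snd _ _ _ _, rfl⟩, hl k' ⟨hk.symm,
      S.isPullback.lift _ _ (by simp [← hV.w, hk]), IsPullback.lift_fst _ _ _ _,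
      IsPullback.lift_snd _ _ _ _, h.symm⟩]

lemma exists_curry (S : SliceHom p g) {Z V : D} (f : Z ⟶ Y) (v₁ : V ⟶ Z) (v₂ : V ⟶ X)
    (hV : IsPullback v₁ v₂ f p) (h : V ⟶ G) (hh : h ≫ g = v₂ ≫ p) :
    ∃ (k : Z ⟶ S.obj) (hk : k ≫ S.hom = f),
      S.apply (v₁ ≫ k) v₂ (by rw [Category.assoc, hk, hV.w]) = h := by
  obtain ⟨k, ⟨hk, m, h₁, h₂, h₃⟩, -⟩ := S.universal f v₁ v₂ hV h hh
  exact ⟨k, hk, by rw [← h₃, S.comp_ev m h₁ h₂]⟩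

/-- Exponentials from dependent products. -/
def ofDependentProduct {E : D} {q : E ⟶ X} (P : DependentProduct p q) {x : E ⟶ G}
    (h : IsPullback x q g p) : SliceHom p g where
  obj := P.obj
  hom := P.hom
  pb := P.pb
  fst := P.fst
  snd := P.snd
  isPullback := P.isPullback
  ev := P.ev ≫ x
  ev_comp := by rw [Category.assoc, h.w, ← Category.assoc, P.ev_comp]
  universal := fun f v₁ v₂ hV e he => by
    obtain ⟨k, ⟨hk, m, h₁, h₂, h₃⟩, hu⟩ := P.universal f v₁ v₂ hV (h.lift e v₂ he) (by simp)
    refine ⟨k, ⟨hk, m, h₁, h₂, by rw [reassoc_of% h₃]; simp⟩, ?_⟩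
    rintro k' ⟨hk', m', h₁', h₂', h₃'⟩
    refine hu k' ⟨hk', m', h₁', h₂', ?_⟩
    apply h.hom_ext
    · simpa using h₃'
    · simpa [P.ev_comp] using h₂'

/-- Dependent products from exponentials. -/
noncomputable def toDependentProduct (S : SliceHom p g) {E : D} {q : E ⟶ X} {x : E ⟶ G}
    (h : IsPullback x q g p) : DependentProduct p q where
  obj := S.obj
  hom := S.hom
  pb := S.pb
  fst := S.fst
  snd := S.snd
  isPullback := S.isPullback
  ev := h.lift S.ev S.snd S.ev_comp
  ev_comp := by simp
  universal := fun f v₁ v₂ hV e he => by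
    obtain ⟨k, ⟨hk, m, h₁, h₂, h₃⟩, hu⟩ := S.universal f v₁ v₂ hV (e ≫ x)
      (by rw [Category.assoc, h.w, reassoc_of% he])
    refine ⟨k, ⟨hk, m, h₁, h₂, ?_⟩, ?_⟩
    · apply h.hom_ext
      · simpa using h₃
      · simpa [he] using h₂
    rintro k' ⟨hk', m', h₁', h₂', h₃'⟩
    exact hu k' ⟨hk', m', h₁', h₂', by simp [← h₃']⟩

/-- The product of an exponential with its source, in the slice. -/
def prod (S : SliceHom p g) : BinaryFan (Over.mk S.hom) (Over.mk p) :=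
  BinaryFan.mk (Over.homMk (U := Over.mk (S.snd ≫ p)) (V := Over.mk S.hom) S.fst S.isPullback.w)
    (Over.homMk (U := Over.mk (S.snd ≫ p)) (V := Over.mk p) S.snd rfl)

/-- The universal property of `SliceHom.prod`. -/
noncomputable def prodIsLimit (S : SliceHom p g) : IsLimit S.prod :=
  overFanIsLimit (a := Over.homMk (U := Over.mk (S.snd ≫ p)) (V := Over.mk S.hom) S.fst
    S.isPullback.w) (b := Over.homMk (U := Over.mk (S.snd ≫ p)) (V := Over.mk p) S.snd rfl)
    S.isPullback

lemma prodIsLimit_lift_left (S : SliceHom p g) {Z : Over Y} (k : Z ⟶ Over.mk S.hom)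
    (a : Z ⟶ Over.mk p) (m : Z.left ⟶ S.pb) (h : m ≫ S.fst = k.left) (h' : m ≫ S.snd = a.left) :
    (S.prodIsLimit.lift (BinaryFan.mk k a)).left = m := by
  apply S.isPullback.hom_ext
  · exact (congrArg (fun f => f.left) (S.prodIsLimit.fac (BinaryFan.mk k a) ⟨.left⟩)).trans h.symm
  · exact (congrArg (fun f => f.left) (S.prodIsLimit.fac (BinaryFan.mk k a) ⟨.right⟩)).trans h'.symm

/-- Exponentials give internal hom objects of the slice. -/
noncomputable def toInternalHom (S : SliceHom p g) : InternalHom (Over.mk p) (Over.mk g) where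
  obj := Over.mk S.hom
  prod := S.prod
  isLimit := S.prodIsLimit
  ev := Over.homMk S.ev S.ev_comp
  universal := fun {Z} c hc e => by
    have hV := isPullback_of_overFanIsLimit c hc
    obtain ⟨k, ⟨hk, m, h₁, h₂, h₃⟩, hu⟩ := S.universal Z.hom c.fst.left c.snd.left hV e.left
      ((Over.w e).trans (Over.w c.snd).symm)
    refine ⟨Over.homMk k hk, ?_, ?_⟩
    · ext
      exact (congrArg (· ≫ S.ev) (S.prodIsLimit_lift_left (c.fst ≫ Over.homMk k hk) c.snd m
        h₁ h₂)).trans h₃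
    · intro k' h'
      have hw : (c.fst.left ≫ k'.left) ≫ S.hom = c.snd.left ≫ p :=
        (Category.assoc _ _ _).trans ((congrArg (c.fst.left ≫ ·) (Over.w k')).trans hV.w)
      ext
      have h₄ := S.isPullback.lift_fst _ _ hw
      have h₅ := S.isPullback.lift_snd _ _ hw
      refine hu _ ⟨Over.w k', S.isPullback.lift _ _ hw, h₄, h₅, ?_⟩
      refine Eq.trans ?_ (congrArg (fun f => f.left) h')
      exact (congrArg (· ≫ S.ev) (S.prodIsLimit_lift_left (c.fst ≫ k') c.snd _ h₄ h₅)).symm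

lemma toInternalHom_apply_left (S : SliceHom p g) {Z : Over Y} (k : Z ⟶ Over.mk S.hom)
    (a : Z ⟶ Over.mk p) : (S.toInternalHom.apply k a).left =
      S.apply k.left a.left ((Over.w k).trans (Over.w a).symm) := by
  exact congrArg (· ≫ S.ev) (S.prodIsLimit_lift_left k a _ (IsPullback.lift_fst _ _ _ _)
    (IsPullback.lift_snd _ _ _ _))

end SliceHom

/-- A pullback of underlying maps is a pullback in the slice. -/
lemma isPullback_over {X : D} {P A B E : Over X} {a : P ⟶ A} {b : P ⟶ B} {f : A ⟶ E}
    {g : B ⟶ E} (h : IsPullback a.left b.left f.left g.left) : IsPullback a b f g :=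
  IsPullback.of_map (Over.forget X) (by ext; exact h.w) h

variable {Fib : MorphismProperty D}

/-- A map over `X` with a right inverse up to homotopy has a right inverse over `X` up to fibrewise
homotopy. -/
lemma exists_fibrewise_section (hc : IsClan Fib) (hF : Frobenius Fib) (hP : HasPaths Fib)
    (hfac : ∀ {X Y : D} (f : X ⟶ Y), ∃ (Z : D) (i : X ⟶ Z) (p : Z ⟶ Y),
      Anodyne Fib i ∧ Fib p ∧ i ≫ p = f) {X E E' X₀ : D} {q : E ⟶ X} {q' : E' ⟶ X}
    (hq : Fib q) {f : E ⟶ E'} (hf : f ≫ q' = q) (m : E' ⟶ E) {q₀ : E' ⟶ X₀} (hq₀ : Fib q₀)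
    (h : FibreHomotopic Fib q₀ (m ≫ f) (𝟙 E')) :
    ∃ s : E' ⟶ E, s ≫ q = q' ∧ FibreHomotopic Fib q' (s ≫ f) (𝟙 E') := by
  -- Neither `m` nor its homotopy need respect the projections to `X`. The fibration `p` acquires a
  -- strict section `t` by transport, and `j` acquires a retraction `ρ` over `X` because `q` is a
  -- fibration; `t ≫ ρ` then lies over `X`.
  obtain ⟨E'', j, p, hj, hp, rfl⟩ := hfac f
  obtain ⟨K, P, π₀, π₁, e, r, hK, he, hr, h₀, h₁⟩ := hP q₀ hq₀
  obtain ⟨H, h₂, h₃⟩ := h.2 π₀ π₁ hK e r he h₀ h₁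
  obtain ⟨t, ht⟩ := exists_section_of_homotopy hc hF hp hr h₀ h₁ (m ≫ j) H (by simpa using h₂) h₃
  obtain ⟨ρ, h₄, h₅⟩ := exists_lift hj hq (t := 𝟙 E) (b := p ≫ q') (by simp [← hf])
  refine ⟨t ≫ ρ, by rw [Category.assoc, h₅, reassoc_of% ht], ?_⟩
  have := (FibreHomotopic.of_anodyne_comp_eq (q := q') hj (a := ρ ≫ j ≫ p) (b := p)
    (by rw [reassoc_of% h₄]) (by rw [← h₅, Category.assoc, Category.assoc, ← hf,
      Category.assoc])).pre t
  rwa [ht, ← Category.assoc] at this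

/-- Homotopies of exponentials induced by a deformation of the target. -/
lemma SliceHom.fibreHomotopic (hc : IsClan Fib) (hF : Frobenius Fib)
    (hpi : ∀ {X Y E : D} {p : X ⟶ Y} {q : E ⟶ X}, Fib p → Fib q → ∀ P : DependentProduct p q,
      P.Extensional Fib) {X Y G A : D} {p : X ⟶ Y} {g : G ⟶ Y} (hp : Fib p) (hg : Fib g)
    (S : SliceHom p g) {i : A ⟶ G} (hi : Anodyne Fib i) {κ : G ⟶ G} (hκ : κ ≫ g = g)
    (h : i ≫ κ = i) (k : S.obj ⟶ S.obj) (hk : k ≫ S.hom = S.hom)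
    (hk' : S.apply (S.fst ≫ k) S.snd (by rw [Category.assoc, hk, S.isPullback.w]) = S.ev ≫ κ) :
    FibreHomotopic Fib S.hom k (𝟙 _) := by
  -- The exponential is the dependent product of the pullback `E` of `g` to `X`. The pullback of `i`
  -- to `E` is still anodyne and the map induced by `κ` fixes it, so that map is homotopic to the
  -- identity over `X`; extensionality carries this homotopy to the exponential.
  obtain ⟨E, x, q, hE⟩ := hc.exists_pullback g p hp
  have hq : Fib q := hc.base_change hE hg
  have hx : Fib x := hc.base_change hE.flip hp
  obtain ⟨W, b, y, hW⟩ := hc.exists_pullback i x hx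
  have hy : Anodyne Fib y := hF hW hx hi
  let κ' : E ⟶ E := hE.lift (x ≫ κ) q (by rw [Category.assoc, hκ, hE.w])
  have h₁ : FibreHomotopic Fib q κ' (𝟙 E) := by
    refine FibreHomotopic.of_anodyne_comp_eq hy ?_ (by simp [κ'])
    apply hE.hom_ext
    · rw [Category.assoc, hE.lift_fst, ← hW.w_assoc, h, Category.comp_id, hW.w]
    · simp [κ']
  let P := S.toDependentProduct hE
  refine hpi hp hq P k (𝟙 _) S.fst (S.isPullback.lift (S.fst ≫ k) S.snd
    (by rw [Category.assoc, hk, S.isPullback.w])) (𝟙 _) ?_ ?_ (IsPullback.lift_fst _ _ _ _) ?_ ?_ ?_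
  · change IsPullback S.fst (_ ≫ S.snd) (k ≫ S.hom) p
    rw [IsPullback.lift_snd]
    exact hk.symm ▸ S.isPullback
  · change k ≫ S.hom = _ ≫ S.hom
    rw [hk]; simp
  · change _ ≫ S.fst = _
    rw [Category.id_comp]; exact (Category.comp_id _).symm
  · change _ ≫ S.snd = _ ≫ S.snd
    rw [IsPullback.lift_snd, Category.id_comp]
  · have := h₁.pre (hE.lift S.ev S.snd S.ev_comp)
    convert this using 1
    · apply hE.hom_ext
      · simp only [P, toDependentProduct, Category.assoc, κ', IsPullback.lift_fst]
        rw [IsPullback.lift_fst_assoc, ← hk']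
        rfl
      · simp [P, toDependentProduct, κ']
    · simp [P, toDependentProduct]

end SliceHoms

end Tribe

/-! ## Function types and their path types as exponentials -/

section FunctionObjects

open ContextualCategory Tribe SigmaStructure IdStructure PiStructure

variable {C : Type u} [Category.{v} C] [ContextualCategory.{w} C] [PiStructure C]

/-- Application of generalised functions to generalised elements. -/
noncomputable def evalArr {Θ Z : C} {A B : Ty Θ} (k : Z ⟶ ext (arr A B)) (a : Z ⟶ ext A)
    (h : k ≫ proj _ = a ≫ proj A) : Z ⟶ ext B :=
  (applyArr (⟨k, h⟩ : Elt (a ≫ proj A) (arr A B)) ⟨a, rfl⟩).1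

lemma applyArr_hom {Θ Z : C} {A B : Ty Θ} {σ : Z ⟶ Θ} (k : Elt σ (arr A B)) (a : Elt σ A) :
    (applyArr k a).1 = evalArr k.1 a.1 (k.2.trans a.2.symm) :=
  applyArr_congr a.2.symm rfl rfl

@[simp] lemma evalArr_proj {Θ Z : C} {A B : Ty Θ} (k : Z ⟶ ext (arr A B)) (a : Z ⟶ ext A)
    (h : k ≫ proj _ = a ≫ proj A) : evalArr k a h ≫ proj B = a ≫ proj A := (applyArr _ _).2

lemma evalArr_congr {Θ Z : C} {A B : Ty Θ} {k k' : Z ⟶ ext (arr A B)} {a a' : Z ⟶ ext A}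
    (hk : k = k') (ha : a = a') (h : k ≫ proj _ = a ≫ proj A) :
    evalArr k a h = evalArr k' a' (by rw [← hk, ← ha, h]) := by
  subst hk ha; rfl

lemma comp_evalArr {Θ Z Z' : C} {A B : Ty Θ} (m : Z' ⟶ Z) (k : Z ⟶ ext (arr A B)) (a : Z ⟶ ext A)
    (h : k ≫ proj _ = a ≫ proj A) :
    m ≫ evalArr k a h = evalArr (m ≫ k) (m ≫ a) (by simp [h]) := by
  unfold evalArr
  rw [pre_applyArr]
  exact applyArr_congr (Category.assoc _ _ _).symm rfl rfl

lemma evalArr_lamArr {Θ N Z : C} {A B : Ty Θ} {n : N ⟶ Θ} (c : Elt (proj (sub n A) ≫ n) B)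
    (k : Z ⟶ N) (a : Z ⟶ ext A) (h : a ≫ proj A = k ≫ n) (h' : (k ≫ (lamArr c).1) ≫ proj _ = _) :
    evalArr (k ≫ (lamArr c).1) a h' = (lift n k a h).1 ≫ c.1 :=
  (applyArr_hom (Elt.pre k (lamArr c)) ⟨a, h⟩).symm.trans (applyArr_pre_lamArr k c ⟨a, h⟩)

lemma evalArr_compArr {Θ N Z : C} {A B D : Ty Θ} {n : N ⟶ Θ} (g : Elt n (arr A B))
    (f : Elt n (arr B D)) (k : Z ⟶ N) (a : Z ⟶ ext A) (h : a ≫ proj A = k ≫ n)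
    (h' : (k ≫ (compArr g f).1) ≫ proj _ = _) :
    evalArr (k ≫ (compArr g f).1) a h' =
      evalArr (k ≫ f.1) (evalArr (k ≫ g.1) a (by rw [Category.assoc, g.2, h]))
        (by rw [Category.assoc, f.2, evalArr_proj, h]) := by
  refine (evalArr_lamArr _ k a h _).trans ?_
  rw [applyArr_hom, comp_evalArr]
  refine evalArr_congr (by simp [Elt.pre, reassoc_of% lift_proj n k a h]) ?_ _
  rw [applyArr_hom, comp_evalArr]
  exact evalArr_congr (by simp [Elt.pre, reassoc_of% lift_proj n k a h]) (lift_q _ _ _ _) _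

lemma evalArr_castFn {Θ N Z : C} {A B : Ty Θ} (n : N ⟶ Θ) (e : sub n A = sub n B) (k : Z ⟶ N)
    (a : Z ⟶ ext A) (h : a ≫ proj A = k ≫ n) (h' : (k ≫ (castFn n e).1) ≫ proj _ = _) :
    evalArr (k ≫ (castFn n e).1) a h' = (lift n k a h).1 ≫ extCast e ≫ q n B :=
  evalArr_lamArr _ k a h _

/-- The identity function is the composite of two coercions along a trivial equality, and those
evaluate to the identity by β. -/
lemma evalArr_idOver {Θ N Z : C} {A : Ty Θ} (n : N ⟶ Θ) (k : Z ⟶ N) (a : Z ⟶ ext A)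
    (h : a ≫ proj A = k ≫ n) (h' : (k ≫ (idOver n A).1) ≫ proj _ = _) :
    evalArr (k ≫ (idOver n A).1) a h' = a := by
  have e : ∀ b (hb : b ≫ proj A = k ≫ n) h₂,
      evalArr (k ≫ (castFn n (rfl : sub n A = sub n A)).1) b h₂ = b := by
    intro b hb h₂
    rw [evalArr_castFn n rfl k b hb]
    simp
  have h₂ : (k ≫ (castFn n (rfl : sub n A = sub n A)).1) ≫ proj _ = a ≫ proj A := by
    rw [Category.assoc, (castFn n _).2, h]
  have := evalArr_compArr (castFn n (rfl : sub n A = sub n A)) (castFn n rfl) k a h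
    (by rw [Category.assoc, (compArr _ _).2, h])
  simp only [e a h h₂] at this
  simpa only [compArr_castFn n (rfl : sub n A = sub n A)] using this

/-- Function types are exponentials in slices. -/
noncomputable def arrHom (hη : PiEta C) {Θ : C} (A B : Ty Θ) : SliceHom (proj A) (proj B) :=
  SliceHom.ofDependentProduct (piProduct @hη A (wk A B)) (ContextualCategory.isPullback (proj A) B)

lemma arrHom_apply (hη : PiEta C) {Θ Z : C} {A B : Ty Θ} (k : Z ⟶ ext (arr A B)) (a : Z ⟶ ext A)
    (h : k ≫ proj _ = a ≫ proj A) : (arrHom @hη A B).apply k a h = evalArr k a h := by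
  have h₁ := (arrHom @hη A B).isPullback.lift_fst k a h
  have h₂ := (arrHom @hη A B).isPullback.lift_snd k a h
  refine (Category.assoc _ _ _).symm.trans (congrArg (· ≫ q (proj A) B) ?_)
  refine comp_transpose (genericElt (arr A B)) _ _ ⟨a, rfl⟩ ?_ h₂
  change _ ≫ proj (sub (proj (arr A B)) A) = _ at h₁
  refine (congrArg (_ ≫ ·) (Category.comp_id _)).trans h₁

lemma evalArr_ext (hη : PiEta C) {Θ Z V : C} {A B : Ty Θ} {k k' : Z ⟶ ext (arr A B)}
    {f : Z ⟶ Θ} (hk : k ≫ proj _ = f) (hk' : k' ≫ proj _ = f) {v₁ : V ⟶ Z} {v₂ : V ⟶ ext A}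
    (hV : IsPullback v₁ v₂ f (proj A))
    (h : evalArr (v₁ ≫ k) v₂ (by rw [Category.assoc, hk, hV.w]) =
      evalArr (v₁ ≫ k') v₂ (by rw [Category.assoc, hk', hV.w])) : k = k' := by
  subst hk
  refine (arrHom @hη A B).hom_ext hk'.symm hV ?_
  refine (arrHom_apply @hη _ _ _).trans (h.trans (arrHom_apply @hη _ _ _).symm)

lemma exists_curryArr (hη : PiEta C) {Θ Z V : C} {A B : Ty Θ} (f : Z ⟶ Θ) {v₁ : V ⟶ Z}
    {v₂ : V ⟶ ext A} (hV : IsPullback v₁ v₂ f (proj A)) (h : V ⟶ ext B)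
    (hh : h ≫ proj B = v₂ ≫ proj A) :
    ∃ (k : Z ⟶ ext (arr A B)) (hk : k ≫ proj _ = f),
      evalArr (v₁ ≫ k) v₂ (by rw [Category.assoc, hk, hV.w]) = h := by
  obtain ⟨k, hk, hk'⟩ := (arrHom @hη A B).exists_curry f v₁ v₂ hV h hh
  exact ⟨k, hk, (arrHom_apply @hη _ _ _).symm.trans hk'⟩

/-! ### Pointwise identifications -/

section Paths

/-- Two parallel functions. -/
abbrev arrPairProj {Θ : C} (A B : Ty Θ) : ext (wk (arr A B) (arr A B)) ⟶ Θ :=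
  proj (wk (arr A B) (arr A B)) ≫ proj (arr A B)

/-- The value of the first of two parallel functions. -/
noncomputable def valueFst {Θ : C} (A B : Ty Θ) :
    Elt (proj (sub (arrPairProj A B) A) ≫ arrPairProj A B) B :=
  ⟨evalArr (proj _ ≫ proj (wk (arr A B) (arr A B))) (q (arrPairProj A B) A)
    (by rw [q_proj, Category.assoc]), by rw [evalArr_proj, q_proj]⟩

/-- The value of the second of two parallel functions. -/
noncomputable def valueSnd {Θ : C} (A B : Ty Θ) :
    Elt (proj (sub (arrPairProj A B) A) ≫ arrPairProj A B) B :=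
  ⟨evalArr (proj _ ≫ q (proj (arr A B)) (arr A B)) (q (arrPairProj A B) A)
    (by rw [q_proj, Category.assoc, q_proj]), by rw [evalArr_proj, q_proj]⟩

lemma comp_valueFst {Θ Z : C} (A B : Ty Θ) (m : Z ⟶ ext (sub (arrPairProj A B) A))
    {k : Z ⟶ ext (arr A B)} {a : Z ⟶ ext A} (hk : m ≫ proj _ ≫ proj (wk (arr A B) (arr A B)) = k)
    (ha : m ≫ q (arrPairProj A B) A = a) (h : k ≫ proj _ = a ≫ proj A) :
    m ≫ (valueFst A B).1 = evalArr k a h := by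
  subst hk ha
  exact comp_evalArr _ _ _ _

lemma comp_valueSnd {Θ Z : C} (A B : Ty Θ) (m : Z ⟶ ext (sub (arrPairProj A B) A))
    {k : Z ⟶ ext (arr A B)} {a : Z ⟶ ext A} (hk : m ≫ proj _ ≫ q (proj (arr A B)) (arr A B) = k)
    (ha : m ≫ q (arrPairProj A B) A = a) (h : k ≫ proj _ = a ≫ proj A) :
    m ≫ (valueSnd A B).1 = evalArr k a h := by
  subst hk ha
  exact comp_evalArr _ _ _ _

variable [IdStructure C]

/-- The type of pointwise identifications of two functions. -/
noncomputable def pointwiseId {Θ : C} (A B : Ty Θ) : Ty (ext (wk (arr A B) (arr A B))) :=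
  Pi (sub (arrPairProj A B) A) (sub (pairElt (valueFst A B) (valueSnd A B)) (Id B))

/-- Evaluation of pointwise identifications. -/
noncomputable def pathEval {Θ : C} (A B : Ty Θ) :
    Elt (q (proj (pointwiseId A B)) (sub (arrPairProj A B) A))
      (sub (pairElt (valueFst A B) (valueSnd A B)) (Id B)) :=
  transpose (genericElt (Pi (sub (arrPairProj A B) A)
    (sub (pairElt (valueFst A B) (valueSnd A B)) (Id B))))

/-- The type of pointwise identifications is the exponential of the path object. -/
noncomputable def pathHom (hη : PiEta C) {Θ : C} (A B : Ty Θ) :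
    SliceHom (proj A) (idProj B) where
  obj := ext (pointwiseId A B)
  hom := proj (pointwiseId A B) ≫ arrPairProj A B
  pb := ext (sub (proj (pointwiseId A B)) (sub (arrPairProj A B) A))
  fst := proj _
  snd := q (proj (pointwiseId A B)) _ ≫ q (arrPairProj A B) A
  isPullback := (ContextualCategory.isPullback (proj (pointwiseId A B)) _).flip.paste_vert
    (ContextualCategory.isPullback (arrPairProj A B) A).flip
  ev := (pathEval A B).1 ≫ q (pairElt (valueFst A B) (valueSnd A B)) (Id B)
  ev_comp := by
    rw [← idSrc_proj', Category.assoc, reassoc_of% (q_pairElt_idSrc (valueFst A B) (valueSnd A B)),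
      reassoc_of% (pathEval A B).2, (valueFst A B).2, Category.assoc,
      q_proj]
  universal := fun {Z V} f v₁ v₂ hV h hh => by
    let s := valueFst A B
    let t := valueSnd A B
    let ev := (pathEval A B).1
    have hev : ev ≫ proj _ = q (proj (pointwiseId A B)) _ := (pathEval A B).2
    have hh₀ : (h ≫ idSrc B) ≫ proj B = v₂ ≫ proj A := by rw [Category.assoc, idSrc_proj', hh]
    have hh₁ : (h ≫ idTgt B) ≫ proj B = v₂ ≫ proj A := by rw [Category.assoc, idTgt_proj, hh]
    -- A family of paths is curried in two stages: first its endpoints, giving a pair of functions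
    -- `n`, then the paths themselves as dependent functions over `n`.
    obtain ⟨a, ha, ha'⟩ := exists_curryArr @hη f hV (h ≫ idSrc B) hh₀
    obtain ⟨b, hb, hb'⟩ := exists_curryArr @hη f hV (h ≫ idTgt B) hh₁
    let n : Z ⟶ ext (wk (arr A B) (arr A B)) := (isPullback_wk _).lift a b (ha.trans hb.symm)
    have hn₀ : n ≫ proj _ = a := IsPullback.lift_fst _ _ _ _
    have hn₁ : n ≫ q _ _ = b := IsPullback.lift_snd _ _ _ _
    have hn : n ≫ arrPairProj A B = f := by rw [← Category.assoc, hn₀, ha]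
    let l := (lift (arrPairProj A B) (v₁ ≫ n) v₂ (by rw [Category.assoc, hn, hV.w])).1
    have hl : l ≫ q _ A = v₂ := lift_q _ _ _ _
    have hl' : l ≫ proj _ = v₁ ≫ n := lift_proj _ _ _ _
    have hL : IsPullback v₁ l n (proj (sub (arrPairProj A B) A)) := by
      refine IsPullback.of_bot ?_ hl'.symm (ContextualCategory.isPullback _ A).flip
      rwa [hl, hn]
    have w : h ≫ proj (Id B) = l ≫ pairElt s t := by
      apply (isPullback_wk B).hom_ext
      · rw [Category.assoc, Category.assoc, pairElt_proj, comp_valueFst A B l (k := v₁ ≫ a)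
          (by rw [reassoc_of% hl', hn₀]) hl (by rw [Category.assoc, ha, hV.w])]
        exact ha'.symm
      · rw [Category.assoc, Category.assoc, pairElt_q, comp_valueSnd A B l (k := v₁ ≫ b)
          (by rw [reassoc_of% hl', hn₁]) hl (by rw [Category.assoc, hb, hV.w])]
        exact hb'.symm
    let e := (lift (pairElt s t) l h w).1
    have he : e ≫ q _ _ = h := lift_q _ _ _ _
    have he' : e ≫ proj _ = l := lift_proj _ _ _ _
    obtain ⟨k, ⟨hk, m, h₁, h₂, h₃⟩, hu⟩ : ∃! k : Z ⟶ ext (pointwiseId A B), k ≫ proj _ = n ∧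
        ∃ m : V ⟶ ext (sub (proj (pointwiseId A B)) (sub (arrPairProj A B) A)),
          m ≫ proj _ = v₁ ≫ k ∧ m ≫ q _ _ = l ∧ m ≫ ev = e :=
      (piProduct @hη (sub (arrPairProj A B) A) (sub (pairElt s t) (Id B))).universal n v₁ l hL e he'
    refine ⟨k, ⟨by rw [← Category.assoc, hk, hn], m, h₁, by rw [← Category.assoc, h₂, hl],
      by rw [← Category.assoc, h₃, he]⟩, ?_⟩
    rintro k' ⟨hk', m', h₁', h₂', h₃'⟩
    have h₄ : m' ≫ q (proj (pointwiseId A B)) _ ≫ proj _ = v₁ ≫ k' ≫ proj (pointwiseId A B) := by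
      rw [q_proj, reassoc_of% h₁']
    -- The endpoints of a competitor are functions with prescribed values, hence determined; only
    -- then does uniqueness for `Π` apply.
    have hkn : k' ≫ proj (pointwiseId A B) = n := by
      apply (isPullback_wk _).hom_ext
      · rw [hn₀]
        refine evalArr_ext hη (by rw [Category.assoc, Category.assoc]; exact hk') ha hV ?_
        have h₅ : h ≫ idSrc B = (m' ≫ q (proj (pointwiseId A B)) _) ≫
            (valueFst A B).1 := by
          rw [← h₃', Category.assoc, Category.assoc, q_pairElt_idSrc, reassoc_of% hev,
            Category.assoc]
        rw [ha', h₅]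
        symm
        apply comp_valueFst
        · rw [Category.assoc, reassoc_of% h₄, Category.assoc]
        · rw [Category.assoc, h₂']
      · rw [hn₁]
        refine evalArr_ext hη (by rw [Category.assoc, Category.assoc, q_proj]; exact hk') hb hV ?_
        have h₅ : h ≫ idTgt B = (m' ≫ q (proj (pointwiseId A B)) _) ≫
            (valueSnd A B).1 := by
          rw [← h₃', Category.assoc, Category.assoc, q_pairElt_idTgt, reassoc_of% hev,
            Category.assoc]
        rw [hb', h₅]
        symm
        apply comp_valueSnd
        · rw [Category.assoc, reassoc_of% h₄, Category.assoc]
        · rw [Category.assoc, h₂']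
    have hl₂ : m' ≫ q (proj (pointwiseId A B)) _ = l := by
      apply lift_ext
      · rw [Category.assoc, h₂', hl]
      · rw [Category.assoc, h₄, hkn, hl']
    refine hu k' ⟨hkn, m', h₁', hl₂, ?_⟩
    apply lift_ext
    · rw [Category.assoc, he]; exact h₃'
    · rw [he', Category.assoc, hev, hl₂]

lemma pathHom_ev_idSrc (hη : PiEta C) {Θ : C} (A B : Ty Θ) (h) : (pathHom @hη A B).ev ≫ idSrc B =
    evalArr ((pathHom @hη A B).fst ≫ proj (pointwiseId A B) ≫ proj _) (pathHom @hη A B).snd h := by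
  change ((pathEval A B).1 ≫ _) ≫ _ = _
  rw [Category.assoc, q_pairElt_idSrc, reassoc_of% (pathEval A B).2]
  refine comp_valueFst _ _ _ ?_ rfl _
  rw [reassoc_of% (q_proj (proj (pointwiseId A B)) (sub (arrPairProj A B) A))]
  rfl

lemma pathHom_ev_idTgt (hη : PiEta C) {Θ : C} (A B : Ty Θ) (h) : (pathHom @hη A B).ev ≫ idTgt B =
    evalArr ((pathHom @hη A B).fst ≫ proj (pointwiseId A B) ≫ q _ _) (pathHom @hη A B).snd h := by
  change ((pathEval A B).1 ≫ _) ≫ _ = _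
  rw [Category.assoc, q_pairElt_idTgt, reassoc_of% (pathEval A B).2]
  refine comp_valueSnd _ _ _ ?_ rfl _
  rw [reassoc_of% (q_proj (proj (pointwiseId A B)) (sub (arrPairProj A B) A))]
  rfl

end Paths

end FunctionObjects

/-! ## Maps with a section up to homotopy -/

section HomotopySections

open ContextualCategory Tribe SigmaStructure IdStructure PiStructure

variable {C : Type u} [Category.{v} C] [ContextualCategory.{w} C]

/-- Homotopic maps in the tribe of a contextual category. -/
abbrev RootHomotopic {Z E : C} (a b : Z ⟶ E) : Prop :=
  FibreHomotopic (fibrations C) (rootIsTerminal.from E) a b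

lemma Tribe.FibreHomotopic.rootHomotopic {X E Z : C} {q : E ⟶ X} (hq : fibrations C q)
    {a b : Z ⟶ E} (h : FibreHomotopic (fibrations C) q a b) : RootHomotopic a b := by
  have := h.map (fibrations_isClan C) hq (q := rootIsTerminal.from E) (𝟙 E)
    (rootIsTerminal.from X) (rootIsTerminal.hom_ext _ _)
  simpa using this

/-- The map `f` has a section up to homotopy. -/
def HasHomotopySection {X Y : C} (f : X ⟶ Y) : Prop :=
  ∃ s : Y ⟶ X, RootHomotopic (s ≫ f) (𝟙 Y)

lemma HasHomotopySection.of_section {X Y : C} {f : X ⟶ Y} (s : Y ⟶ X) (h : s ≫ f = 𝟙 Y) :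
    HasHomotopySection f := ⟨s, .of_eq _ h⟩

/-- Every object is fibrant, so an anodyne map has a strict retraction. The other composite agrees
with the identity on `f`, hence is homotopic to it. -/
lemma HasHomotopySection.of_anodyne {X Y : C} {f : X ⟶ Y} (hf : Anodyne (fibrations C) f) :
    HasHomotopySection f := by
  obtain ⟨ρ, h, -⟩ := exists_lift hf (fibrations_root (rootIsTerminal.from X)) (t := 𝟙 X)
    (b := rootIsTerminal.from Y)
    (rootIsTerminal.hom_ext _ _)
  exact ⟨ρ, .of_anodyne_comp_eq hf (by rw [reassoc_of% h, Category.comp_id])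
    (rootIsTerminal.hom_ext _ _)⟩

variable [SigmaStructure C] [IdStructure C] [PiStructure C]

lemma Tribe.FibreHomotopic.trans' (hη : PiEta C) (hext : FunExt C) {X E Z : C} {q : E ⟶ X}
    (hq : fibrations C q) {a b c : Z ⟶ E} (h : FibreHomotopic (fibrations C) q a b)
    (h' : FibreHomotopic (fibrations C) q b c) : FibreHomotopic (fibrations C) q a c :=
  HasPaths.trans (fibrations_hasPaths hη hext) (fibrations_isClan C) (fibrations_frobenius hη hext)
    hq h h'

lemma HasHomotopySection.comp (hη : PiEta C) (hext : FunExt C) {X Y Z : C} {f : X ⟶ Y} {g : Y ⟶ Z}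
    (hf : HasHomotopySection f) (hg : HasHomotopySection g) : HasHomotopySection (f ≫ g) := by
  obtain ⟨s, hs⟩ := hf
  obtain ⟨t, ht⟩ := hg
  refine ⟨t ≫ s, FibreHomotopic.trans' hη hext (fibrations_root _) ?_ ht⟩
  have := (hs.pre t).map (fibrations_isClan C) (fibrations_root _) g (𝟙 root)
    (rootIsTerminal.hom_ext _ _) (q := rootIsTerminal.from Z)
  simpa using this

/-- Maps with a section up to homotopy are stable under base change along fibrations. -/
lemma HasHomotopySection.base_change (hη : PiEta C) (hext : FunExt C) {X Y X' Y' : C} {f : X ⟶ Y}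
    {f' : X' ⟶ Y'} {g : Y' ⟶ Y} {g' : X' ⟶ X} (h : IsPullback g' f' f g) (hg : fibrations C g)
    (hf : HasHomotopySection f) : HasHomotopySection f' := by
  have hc := fibrations_isClan C
  have hF : Frobenius (fibrations C) := fibrations_frobenius hη hext
  obtain ⟨s, hs⟩ := hf
  -- The two factors are pulled back separately: `j` stays anodyne because `g` is a fibration, and
  -- `p` has a strict section, which pulls back.
  obtain ⟨Z, j, p, hj, hp, rfl⟩ := exists_factorisation hη hext f
  obtain ⟨K, P, π₀, π₁, e, r, hK, he, hr, h₀, h₁⟩ :=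
    fibrations_hasPaths hη hext _ (fibrations_root (rootIsTerminal.from Y))
  obtain ⟨H, h₂, h₃⟩ := hs.2 π₀ π₁ hK e r he h₀ h₁
  obtain ⟨t, ht⟩ := exists_section_of_homotopy hc hF hp hr h₀ h₁ (s ≫ j) H
    (by simpa using h₂) h₃
  obtain ⟨W, x, y, hW⟩ := hc.exists_pullback p g hg
  have hj' : IsPullback g' (hW.lift (g' ≫ j) f' (by simpa using h.w)) j x := by
    refine IsPullback.of_bot ?_ (by simp) hW
    simpa using h
  have : HasHomotopySection (hW.lift (g' ≫ j) f' (by simpa using h.w) ≫ y) :=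
    HasHomotopySection.comp hη hext
      (.of_anodyne (hF hj' (hc.base_change hW.flip hg) hj))
      (.of_section (hW.lift (g ≫ t) (𝟙 _) (by simp [ht])) (by simp))
  simpa using this

/-- The fibre product of two maps over `M` which have sections up to homotopy. -/
lemma HasHomotopySection.pullback_map (hη : PiEta C) (hext : FunExt C) {L L' R R' M K Q : C}
    {f : L ⟶ L'} {g : R ⟶ R'} {l : L' ⟶ M} {r : R' ⟶ M} (hl : fibrations C l)
    (hr : fibrations C (g ≫ r)) {a : K ⟶ L} {b : K ⟶ R} (hK : IsPullback a b (f ≫ l) (g ≫ r))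
    {a' : Q ⟶ L'} {b' : Q ⟶ R'} (hQ : IsPullback a' b' l r) {k : K ⟶ Q} (h₁ : k ≫ a' = a ≫ f)
    (h₂ : k ≫ b' = b ≫ g) (hf : HasHomotopySection f) (hg : HasHomotopySection g) :
    HasHomotopySection k := by
  have hc := fibrations_isClan C
  -- The two legs are changed one at a time, through the fibre product of `L'` and `R`; each step is
  -- a base change along a fibration.
  obtain ⟨E, x, y, hE⟩ := hc.exists_pullback l (g ≫ r) hr
  have hw : (a ≫ f) ≫ l = b ≫ g ≫ r := by simpa using hK.w
  have e₁ : IsPullback a (hE.lift (a ≫ f) b hw) f x := by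
    refine IsPullback.of_bot ?_ (by simp) hE
    simpa using hK
  have hw' : x ≫ l = (y ≫ g) ≫ r := by simpa using hE.w
  have e₂ : IsPullback y (hQ.lift x (y ≫ g) hw') g b' := by
    refine IsPullback.of_bot ?_ (by simp) hQ.flip
    simpa using hE.flip
  have : k = hE.lift (a ≫ f) b hw ≫ hQ.lift x (y ≫ g) hw' := by
    apply hQ.hom_ext <;> simp [h₁, h₂]
  rw [this]
  exact .comp hη hext (hf.base_change hη hext e₁ (hc.base_change hE.flip hr))
    (hg.base_change hη hext e₂ (hc.base_change hQ hl))

end HomotopySections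

/-! ### Homotopy sections under substitution -/

section Substitution

open ContextualCategory Tribe IdStructure

variable {C : Type u} [Category.{v} C] [ContextualCategory.{w} C] [IdStructure C]

/-- Substitution in a map between types with a homotopy section. -/
lemma exists_sub_homotopySection {Δ Γ : C} (n : Δ ⟶ Γ) {T T' : Ty Γ} 
    {φ : ext T ⟶ ext T'} {ψ : ext T' ⟶ ext T} (hφ : φ ≫ proj _ = proj _) (hψ : ψ ≫ proj _ = proj _)
    (h : IdHomotopic T' (ψ ≫ φ) (𝟙 _)) :
    ∃ φ' : ext (sub n T) ⟶ ext (sub n T'), φ' ≫ proj _ = proj _ ∧ φ' ≫ q n T' = q n T ≫ φ ∧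
      HasHomotopySection φ' := by
  let φ' := (lift n (proj (sub n T)) (q n T ≫ φ) (by rw [Category.assoc, hφ, q_proj])).1
  let ψ' := (lift n (proj (sub n T')) (q n T' ≫ ψ) (by rw [Category.assoc, hψ, q_proj])).1
  have h₁ : φ' ≫ proj _ = proj _ := lift_proj _ _ _ _
  have h₂ : φ' ≫ q n T' = q n T ≫ φ := lift_q _ _ _ _
  have h₃ : ψ' ≫ proj _ = proj _ := lift_proj _ _ _ _
  have h₄ : ψ' ≫ q n T = q n T' ≫ ψ := lift_q _ _ _ _
  refine ⟨φ', h₁, h₂, ψ', ?_⟩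
  have : IdHomotopic (sub n T') (ψ' ≫ φ') (𝟙 _) := by
    apply IdHomotopic.lift
    · rw [Category.assoc, h₁, h₃, Category.id_comp]
    · rw [Category.assoc, h₂, reassoc_of% h₄, Category.id_comp]
      obtain ⟨H, e₀, e₁⟩ := h
      exact ⟨q n T' ≫ H, by rw [Category.assoc, e₀], by rw [Category.assoc, e₁, Category.comp_id]⟩
  exact this.fibreHomotopic.rootHomotopic (fibrations_proj _)

end Substitution

/-! ## Comparison of the two path types of a function type -/

section PathComparison

open ContextualCategory Tribe SigmaStructure IdStructure PiStructure

variable {C : Type u} [Category.{v} C] [ContextualCategory.{w} C] [PiStructure C] [IdStructure C]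

/-- Application of generalised pointwise identifications. -/
noncomputable def evalPath (hη : PiEta C) {Θ Z : C} {A B : Ty Θ} (k : Z ⟶ ext (pointwiseId A B))
    (a : Z ⟶ ext A) (h : k ≫ proj _ ≫ arrPairProj A B = a ≫ proj A) : Z ⟶ ext (Id B) :=
  (pathHom @hη A B).apply k a h

lemma evalPath_congr (hη : PiEta C) {Θ Z : C} {A B : Ty Θ} {k k' : Z ⟶ ext (pointwiseId A B)}
    {a a' : Z ⟶ ext A} (hk : k = k') (ha : a = a')
    (h : k ≫ proj _ ≫ arrPairProj A B = a ≫ proj A) :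
    evalPath @hη k a h = evalPath @hη k' a' (by rw [← hk, ← ha, h]) := by
  subst hk ha; rfl

lemma comp_evalPath (hη : PiEta C) {Θ Z Z' : C} {A B : Ty Θ} (m : Z' ⟶ Z)
    (k : Z ⟶ ext (pointwiseId A B)) (a : Z ⟶ ext A)
    (h : k ≫ proj _ ≫ arrPairProj A B = a ≫ proj A) :
    m ≫ evalPath @hη k a h = evalPath @hη (m ≫ k) (m ≫ a) (by simp [← h]) :=
  (pathHom @hη A B).comp_apply _ _ _ _

lemma evalPath_idSrc (hη : PiEta C) {Θ Z : C} {A B : Ty Θ} (k : Z ⟶ ext (pointwiseId A B))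
    (a : Z ⟶ ext A) (h : k ≫ proj _ ≫ arrPairProj A B = a ≫ proj A) :
    evalPath @hη k a h ≫ idSrc B = evalArr (k ≫ proj (pointwiseId A B) ≫ proj _) a
      (by simpa using h) := by
  unfold evalPath SliceHom.apply
  rw [Category.assoc, pathHom_ev_idSrc @hη A B (by
    simpa [pathHom] using (pathHom @hη A B).isPullback.w), comp_evalArr]
  exact evalArr_congr ((IsPullback.lift_fst_assoc _ _ _ _ _)) (IsPullback.lift_snd _ _ _ _) _

lemma evalPath_idTgt (hη : PiEta C) {Θ Z : C} {A B : Ty Θ} (k : Z ⟶ ext (pointwiseId A B))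
    (a : Z ⟶ ext A) (h : k ≫ proj _ ≫ arrPairProj A B = a ≫ proj A) :
    evalPath @hη k a h ≫ idTgt B = evalArr (k ≫ proj (pointwiseId A B) ≫ q _ _) a
      (by simpa [q_proj] using h) := by
  unfold evalPath SliceHom.apply
  rw [Category.assoc, pathHom_ev_idTgt @hη A B (by
    simpa [pathHom, q_proj] using (pathHom @hη A B).isPullback.w), comp_evalArr]
  exact evalArr_congr ((IsPullback.lift_fst_assoc _ _ _ _ _)) (IsPullback.lift_snd _ _ _ _) _

lemma exists_curryPath (hη : PiEta C) {Θ Z V : C} {A B : Ty Θ} (f : Z ⟶ Θ) {v₁ : V ⟶ Z}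
    {v₂ : V ⟶ ext A} (hV : IsPullback v₁ v₂ f (proj A)) (h : V ⟶ ext (Id B))
    (hh : h ≫ idProj B = v₂ ≫ proj A) :
    ∃ (k : Z ⟶ ext (pointwiseId A B)) (hk : k ≫ proj _ ≫ arrPairProj A B = f),
      evalPath @hη (v₁ ≫ k) v₂ (by rw [Category.assoc, hk, hV.w]) = h :=
  (pathHom @hη A B).exists_curry f v₁ v₂ hV h hh

/-- Constant paths of functions. -/
lemma exists_constPath (hη : PiEta C) {Θ : C} (A B : Ty Θ) :
    ∃ (c : ext (arr A B) ⟶ ext (pointwiseId A B)) (_ : c ≫ proj _ = (diagSec (arr A B)).1),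
      ∀ {Z : C} (k : Z ⟶ ext (arr A B)) (a : Z ⟶ ext A) (h : k ≫ proj _ = a ≫ proj A)
        (h' : (k ≫ c) ≫ proj _ ≫ arrPairProj A B = a ≫ proj A),
        evalPath @hη (k ≫ c) a h' = evalArr k a h ≫ (refl B).1 := by
  let v₁ : ext (sub (proj (arr A B)) A) ⟶ ext (arr A B) := proj _
  let v₂ : ext (sub (proj (arr A B)) A) ⟶ ext A := q _ _
  have hV : IsPullback v₁ v₂ (proj (arr A B)) (proj A) :=
    (ContextualCategory.isPullback _ _).flip
  have hp : (refl B).1 ≫ idProj B = proj B := by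
    rw [← idSrc_proj', reassoc_of% (refl_idSrc B)]
  obtain ⟨c, hc, hc'⟩ := exists_curryPath @hη (proj (arr A B)) hV
    (evalArr v₁ v₂ hV.w ≫ (refl B).1) (by rw [Category.assoc, hp, evalArr_proj])
  have hw : (v₁ ≫ c) ≫ proj _ ≫ arrPairProj A B = v₂ ≫ proj A := by rw [Category.assoc, hc, hV.w]
  refine ⟨c, ?_, ?_⟩
  -- Source and target of the constant path are functions with the same values as the given one,
  -- hence equal to it by η.
  · apply (isPullback_wk _).hom_ext
    · rw [(diagSec _).2]
      refine evalArr_ext hη (f := proj _) (by rw [Category.assoc, Category.assoc]; exact hc)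
        (Category.id_comp _) hV ?_
      have := evalPath_idSrc @hη (v₁ ≫ c) v₂ hw
      rw [hc', Category.assoc, refl_idSrc, Category.comp_id] at this
      exact (evalArr_congr (by simp) rfl _).trans (this.symm.trans (evalArr_congr (by simp) rfl _))
    · rw [diagSec_q]
      refine evalArr_ext hη (f := proj _) (by rw [Category.assoc, Category.assoc, q_proj]; exact hc)
        (Category.id_comp _) hV ?_
      have := evalPath_idTgt @hη (v₁ ≫ c) v₂ hw
      rw [hc', Category.assoc, refl_idTgt, Category.comp_id] at this
      exact (evalArr_congr (by simp) rfl _).trans (this.symm.trans (evalArr_congr (by simp) rfl _))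
  · intro Z k a h h'
    have := congrArg (hV.lift k a h ≫ ·) hc'
    simp only [comp_evalPath] at this
    rw [← Category.assoc (hV.lift k a h) (evalArr _ _ _), comp_evalArr] at this
    refine Eq.trans ?_ (this.trans ?_)
    · exact evalPath_congr @hη (by rw [hV.lift_fst_assoc]) (hV.lift_snd _ _ _).symm _
    · congr 1
      exact evalArr_congr (hV.lift_fst _ _ _) (hV.lift_snd _ _ _) _

/-- Function extensionality, as a comparison of identifications of functions with pointwise
identifications. -/
lemma exists_path_comparison [SigmaStructure C] (hη : PiEta C) (hext : FunExt C) {Θ : C}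
    (A B : Ty Θ) :
    ∃ (φ : ext (Id (arr A B)) ⟶ ext (pointwiseId A B))
      (ψ : ext (pointwiseId A B) ⟶ ext (Id (arr A B)))
      (_ : φ ≫ proj _ = proj _) (_ : ψ ≫ proj _ = proj _),
      IdHomotopic (pointwiseId A B) (ψ ≫ φ) (𝟙 _) ∧
      ∀ {Z : C} (k : Z ⟶ ext (arr A B)) (a : Z ⟶ ext A) (h : k ≫ proj _ = a ≫ proj A)
        (h' : (k ≫ (refl (arr A B)).1 ≫ φ) ≫ proj _ ≫ arrPairProj A B = a ≫ proj A),
        evalPath @hη (k ≫ (refl (arr A B)).1 ≫ φ) a h' = evalArr k a h ≫ (refl B).1 := by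
  obtain ⟨c, hc, hc'⟩ := exists_constPath @hη A B
  -- `φ` is defined by `J`, sending reflexivity to the constant path.
  obtain ⟨φ, h₁, h₂⟩ := exists_lift (anodyne_refl (arr A B)) (fibrations_proj (pointwiseId A B))
    (t := c) (b := proj (Id (arr A B))) (hc.trans (refl (arr A B)).2.symm)
  have hS : fibrations C (pathHom @hη A B).hom :=
    fibrations_comp (fibrations_proj _) (fibrations_comp (fibrations_proj _) (fibrations_proj _))
  -- `k` replaces a pointwise identification by the constant path at its source. It is induced by
  -- the deformation of `Id B` onto reflexivity, so it is homotopic to the identity over `Θ`.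
  let k : ext (pointwiseId A B) ⟶ ext (pointwiseId A B) := (proj _ ≫ proj _) ≫ c
  have hk : k ≫ (pathHom @hη A B).hom = (pathHom @hη A B).hom := by
    change ((proj _ ≫ proj _) ≫ c) ≫ proj (pointwiseId A B) ≫ arrPairProj A B =
      proj _ ≫ arrPairProj A B
    simp [reassoc_of% hc, reassoc_of% (diagSec (arr A B)).2]
  have hκ : (idSrc B ≫ (refl B).1) ≫ idProj B = idProj B := by
    rw [← idSrc_proj', Category.assoc, reassoc_of% (refl_idSrc B)]
  have hg : fibrations C (idProj B) :=
    fibrations_comp (fibrations_proj _) (fibrations_comp (fibrations_proj _) (fibrations_proj _))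
  have H : FibreHomotopic (fibrations C) (pathHom @hη A B).hom k (𝟙 (ext (pointwiseId A B))) := by
    refine SliceHom.fibreHomotopic (fibrations_isClan C) (fibrations_frobenius hη hext)
      (fun hp hq P => (fibrations_pi hη hext hp hq P).2) (fibrations_proj A) hg (pathHom @hη A B)
      (anodyne_refl B) hκ (by rw [reassoc_of% (refl_idSrc B)]) k hk ?_
    have hw : ((pathHom @hη A B).fst ≫ proj (pointwiseId A B) ≫ proj _) ≫ proj _ =
        (pathHom @hη A B).snd ≫ proj A := by
      simpa [pathHom] using (pathHom @hη A B).isPullback.w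
    rw [← Category.assoc, pathHom_ev_idSrc @hη A B hw]
    refine Eq.trans ?_ (hc' _ _ hw ?_)
    · congr 1
      exact (Category.assoc _ _ _).symm
    · rw [Category.assoc, reassoc_of% hc, reassoc_of% (diagSec (arr A B)).2]
      exact hw
  -- Reflexivity at the source is a section of `φ` up to homotopy, but it moves the target function
  -- and so lies only over `Θ`. It is corrected to lie over the pair of functions.
  obtain ⟨ψ, hψ, hψ'⟩ := exists_fibrewise_section (fibrations_isClan C)
    (fibrations_frobenius hη hext) (fibrations_hasPaths hη hext) (exists_factorisation hη hext)
    (fibrations_proj (Id (arr A B))) h₂ ((proj _ ≫ proj _) ≫ (IdStructure.refl (arr A B)).1) hS (by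
      rw [Category.assoc, h₁]; exact H)
  refine ⟨φ, ψ, h₂, hψ, idHomotopic_of_fibreHomotopic hψ', fun k a h h' => ?_⟩
  simp only [h₁]
  exact hc' k a h _

end PathComparison

/-! ## Objects of equivalences -/

section EquivalenceObjects

open ContextualCategory Tribe SigmaStructure IdStructure PiStructure

variable {C : Type u} [Category.{v} C] [ContextualCategory.{w} C] [PiStructure C] [IdStructure C]

/-- The path object given by an identity type. -/
noncomputable def idPath {Θ : C} (B : Ty Θ) :
    PathObject ((fibrations C).over (X := Θ)) (Over.mk (proj B)) :=
  overPathObject (isPullback_wk B) (fibrations_proj (Id B)) (anodyne_refl B) (refl_idSrc B)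
    (refl_idTgt B)

/-- The internal hom of the slice given by a function type. -/
noncomputable def arrInternalHom (hη : PiEta C) {Θ : C} (A B : Ty Θ) :
    InternalHom (Over.mk (proj A)) (Over.mk (proj B)) :=
  (arrHom @hη A B).toInternalHom

lemma arrInternalHom_apply_left (hη : PiEta C) {Θ : C} {A B : Ty Θ} {Z : Over Θ}
    (k : Z ⟶ Over.mk (proj (arr A B))) (a : Z ⟶ Over.mk (proj A)) :
    ((arrInternalHom @hη A B).apply k a).left =
      evalArr k.left a.left ((Over.w k).trans (Over.w a).symm) :=
  ((arrHom @hη A B).toInternalHom_apply_left k a).trans (arrHom_apply @hη _ _ _)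

/-- The internal hom of the slice into a path object. -/
noncomputable def pathInternalHom (hη : PiEta C) {Θ : C} (A B : Ty Θ) :
    InternalHom (Over.mk (proj A)) (idPath B).obj :=
  (pathHom @hη A B).toInternalHom

lemma pathInternalHom_apply_left (hη : PiEta C) {Θ : C} {A B : Ty Θ} {Z : Over Θ}
    (k : Z ⟶ Over.mk (proj (pointwiseId A B) ≫ arrPairProj A B)) (a : Z ⟶ Over.mk (proj A)) :
    ((pathInternalHom @hη A B).apply k a).left =
      evalPath @hη k.left a.left ((Over.w k).trans (Over.w a).symm) :=
  (pathHom @hη A B).toInternalHom_apply_left k a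

/-- The map classifying the composite `f g` and the identity. -/
noncomputable abbrev compConst {Θ N : C} {A B : Ty Θ} {n : N ⟶ Θ} (f : Elt n (arr A B))
    (g : Elt n (arr B A)) : N ⟶ ext (wk (arr B B) (arr B B)) :=
  pairElt (compArr g f) (idOver n B)

/-- The object of right homotopy inverses, as a context extension by pointwise identifications. -/
noncomputable def rInvObject (hη : PiEta C) {Θ N : C} {A B : Ty Θ} (n : N ⟶ Θ)
    (f : Elt n (arr A B)) (g : Elt n (arr B A))
    (h : IsPullback f.1 g.1 (proj (arr A B)) (proj (arr B A))) :
    RInvObject (idPath B) (arrInternalHom @hη A B) (arrInternalHom @hη B A) where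
  HBB := arrInternalHom @hη B B
  HBP := pathInternalHom @hη B B
  prod := BinaryFan.mk (Over.homMk (U := Over.mk n) (V := Over.mk (proj (arr A B))) f.1 f.2)
    (Over.homMk (U := Over.mk n) (V := Over.mk (proj (arr B A))) g.1 g.2)
  prodIsLimit := overFanIsLimit h
  sq := BinaryFan.mk (Over.homMk (U := Over.mk (arrPairProj B B)) (V := Over.mk (proj (arr B B)))
      (proj _) rfl)
    (Over.homMk (U := Over.mk (arrPairProj B B)) (V := Over.mk (proj (arr B B))) (q _ _)
      (q_proj _ _))
  sqIsLimit := overFanIsLimit (isPullback_wk (arr B B))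
  compConst := Over.homMk (U := Over.mk n) (V := Over.mk (arrPairProj B B)) (compConst f g) (by
    change pairElt _ _ ≫ _ ≫ _ = _
    rw [← Category.assoc, pairElt_proj]
    exact (compArr g f).2)
  compConst_fst := fun {Z} k b => by
    ext
    have hb : b.left ≫ proj B = k.left ≫ n := (Over.w b).trans (Over.w k).symm
    refine (arrInternalHom_apply_left @hη _ _).trans ?_
    refine Eq.trans ?_ (arrInternalHom_apply_left @hη _ _).symm
    refine (evalArr_congr (k' := k.left ≫ (compArr g f).1)
      (congrArg (k.left ≫ ·) (pairElt_proj _ _)) rfl _).trans ?_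
    refine (evalArr_compArr g f k.left b.left hb _).trans ?_
    exact evalArr_congr rfl (arrInternalHom_apply_left @hη (k ≫ Over.homMk g.1 g.2) b).symm _
  compConst_snd := fun {Z} k b => by
    ext
    have hb : b.left ≫ proj B = k.left ≫ n := (Over.w b).trans (Over.w k).symm
    refine (arrInternalHom_apply_left @hη _ _).trans ?_
    refine (evalArr_congr (k' := k.left ≫ (idOver n B).1)
      (congrArg (k.left ≫ ·) (pairElt_q _ _)) rfl _).trans ?_
    exact evalArr_idOver n k.left b.left hb _
  ends := Over.homMk (U := Over.mk (proj (pointwiseId B B) ≫ arrPairProj B B))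
    (V := Over.mk (arrPairProj B B)) (proj (pointwiseId B B)) rfl
  ends_fst := fun {Z} k b => by
    ext
    refine (arrInternalHom_apply_left @hη _ _).trans ?_
    refine Eq.trans ?_ (congrArg (· ≫ idSrc B) (pathInternalHom_apply_left @hη k b)).symm
    exact (evalPath_idSrc @hη _ _ _).symm
  ends_snd := fun {Z} k b => by
    ext
    refine (arrInternalHom_apply_left @hη _ _).trans ?_
    refine Eq.trans ?_ (congrArg (· ≫ idTgt B) (pathInternalHom_apply_left @hη k b)).symm
    exact (evalPath_idTgt @hη _ _ _).symm
  obj := Over.mk (proj (sub (compConst f g) (pointwiseId B B)) ≫ n)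
  toPath := Over.homMk (U := Over.mk (proj (sub (compConst f g) (pointwiseId B B)) ≫ n))
    (V := Over.mk (proj (pointwiseId B B) ≫ arrPairProj B B)) (q (compConst f g) _) (by
      change q _ _ ≫ proj _ ≫ arrPairProj B B = _
      rw [reassoc_of% (q_proj (compConst f g) (pointwiseId B B)), ← Category.assoc (pairElt _ _),
        pairElt_proj, (compArr g f).2]
      rfl)
  toProd := Over.homMk (U := Over.mk (proj (sub (compConst f g) (pointwiseId B B)) ≫ n))
    (V := Over.mk n) (proj _) rfl
  isPullback := isPullback_over (ContextualCategory.isPullback (compConst f g) (pointwiseId B B))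

lemma isPullback_fnVar {Θ : C} (A B : Ty Θ) : IsPullback (fnVar A B).1 (fnVar' A B).1
    (proj (arr A B)) (proj (arr B A)) :=
  (ContextualCategory.isPullback (proj (arr A B)) (arr B A)).flip

/-- Left homotopy inverses, with pointwise homotopies. -/
noncomputable abbrev leftInverses {Θ : C} (A B : Ty Θ) : Ty (ext (wk (arr A B) (arr B A))) :=
  sub (compConst (fnVar' A B) (fnVar A B)) (pointwiseId A A)

/-- Right homotopy inverses, with pointwise homotopies. -/
noncomputable abbrev rightInverses {Θ : C} (A B : Ty Θ) : Ty (ext (wk (arr A B) (arr B A))) :=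
  sub (compConst (fnVar A B) (fnVar' A B)) (pointwiseId B B)

/-- The second inverse of a left invertible function. -/
noncomputable abbrev secondInverse {Θ : C} (A B : Ty Θ) : Ty (ext (leftInverses A B)) :=
  sub (proj (leftInverses A B) ≫ (fnVar A B).1) (wk (arr A B) (arr B A))

/-- The homotopy of the right inverse of a left invertible function. -/
noncomputable abbrev secondHomotopy {Θ : C} (A B : Ty Θ) : Ty (ext (secondInverse A B)) :=
  sub (q (proj (leftInverses A B) ≫ (fnVar A B).1) (wk (arr A B) (arr B A))) (rightInverses A B)

lemma isPullback_secondHomotopy {Θ : C} (A B : Ty Θ) :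
    IsPullback (proj (secondHomotopy A B) ≫ proj (secondInverse A B)) (q _ (rightInverses A B))
      (proj (leftInverses A B) ≫ (fnVar A B).1) (proj (rightInverses A B) ≫ (fnVar A B).1) :=
  ((ContextualCategory.isPullback _ (rightInverses A B)).paste_vert
    (ContextualCategory.isPullback (proj (leftInverses A B) ≫ (fnVar A B).1) _)).flip

/-- The object of equivalences between two context extensions. -/
noncomputable def eqObject (hη : PiEta C) {Θ : C} (A B : Ty Θ) :
    EqObject ((fibrations C).over (X := Θ)) (Over.mk (proj A)) (Over.mk (proj B)) where
  PA := idPath A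
  PB := idPath B
  HAB := arrInternalHom @hη A B
  HBA := arrInternalHom @hη B A
  rInv := rInvObject @hη (fnPairProj A B) (fnVar A B) (fnVar' A B) (isPullback_fnVar A B)
  lInv := rInvObject @hη (fnPairProj A B) (fnVar' A B) (fnVar A B) (isPullback_fnVar A B).flip
  obj := Over.mk ((proj (secondHomotopy A B) ≫ proj (secondInverse A B)) ≫
    proj (leftInverses A B) ≫ fnPairProj A B)
  toL := Over.homMk (V := Over.mk (proj (leftInverses A B) ≫ fnPairProj A B))
    (proj (secondHomotopy A B) ≫ proj (secondInverse A B)) rfl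
  toR := Over.homMk (V := Over.mk (proj (rightInverses A B) ≫ fnPairProj A B))
    (q _ (rightInverses A B)) (by
      have := congrArg (· ≫ proj (arr A B)) (isPullback_secondHomotopy A B).w
      simp only [Category.assoc] at this
      exact this.symm.trans (Category.assoc _ _ _).symm)
  isPullback := isPullback_over (isPullback_secondHomotopy A B)

variable [SigmaStructure C]

/-- Comparison of identifications and pointwise identifications in a sum. -/
lemma exists_sig_comparison (hη : PiEta C) (hext : FunExt C) {Θ M : C} {A : Ty Θ} (W : Ty M)
    {n : ext W ⟶ Θ} (s t : Elt n (arr A A)) :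
    ∃ φ : ext (Sig W (sub (pairElt s t) (Id (arr A A)))) ⟶
        ext (sub (pairElt s t) (pointwiseId A A)),
      HasHomotopySection φ ∧ φ ≫ proj _ ≫ proj W = proj _ ∧
      ∀ {Δ : C} {σ : Δ ⟶ M} (m : Elt σ W) (e : Elt m.1 (sub (pairElt s t) (Id (arr A A)))),
        (pairOver m e).1 ≫ φ ≫ proj _ = m.1 ∧
        (e.1 ≫ q (pairElt s t) (Id (arr A A)) = (m.1 ≫ s.1) ≫ (IdStructure.refl (arr A A)).1 →
          ∀ {Z : C} (k : Z ⟶ Δ) (a : Z ⟶ ext A) (_ : a ≫ proj A = k ≫ m.1 ≫ n) (h'),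
            evalPath @hη (k ≫ (pairOver m e).1 ≫ φ ≫ q (pairElt s t) (pointwiseId A A)) a h' =
              evalArr (k ≫ m.1 ≫ s.1) a (by simpa [s.2] using Eq.symm ‹_›) ≫
                (IdStructure.refl A).1) := by
  obtain ⟨φ, ψ, h₁, h₂, h₃, h₄⟩ := exists_path_comparison @hη @hext A A
  obtain ⟨φ', h₅, h₆, h₇⟩ := exists_sub_homotopySection (pairElt s t) h₁ h₂ h₃
  -- Unpairing has the strict section `pair`, and `φ'` has a homotopy section by function
  -- extensionality.
  refine ⟨unpair W (sub (pairElt s t) (Id (arr A A))) ≫ φ',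
    .comp hη hext (.of_section _ (pair_unpair _ _)) h₇, ?_, ?_⟩
  · rw [Category.assoc, reassoc_of% h₅]
    exact unpair_proj_proj _ _
  · intro Δ σ m e
    constructor
    · rw [Category.assoc, reassoc_of% (pairOver_unpair m e), h₅]
      exact e.2
    · intro he Z k a h h'
      refine (evalPath_congr @hη (k' := (k ≫ m.1 ≫ s.1) ≫ (IdStructure.refl (arr A A)).1 ≫ φ) ?_ rfl
        _).trans (h₄ _ a _ _)
      rw [Category.assoc, reassoc_of% (pairOver_unpair m e), h₆, reassoc_of% he]
      simp

/-- The two ends of a reflexivity coincide, so a restricted identification that is reflexivity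
forces a strict equality. -/
lemma comp_eq_of_refl {Θ Δ Z : C} {A : Ty Θ} {n : Δ ⟶ Θ} {s t : Elt n A} {m : Z ⟶ Δ}
    (e : Elt m (sub (pairElt s t) (Id A)))
    (he : e.1 ≫ q (pairElt s t) (Id A) = (m ≫ s.1) ≫ (IdStructure.refl A).1) :
    m ≫ s.1 = m ≫ t.1 := by
  have := congrArg (· ≫ idTgt A) he
  simp only [Category.assoc, refl_idTgt, Category.comp_id] at this
  rw [← this, q_pairElt_idTgt, reassoc_of% e.2]

/-- The pair of inverse functions along an equality of types. -/
noncomputable abbrev castPair {Δ Θ : C} (σ : Δ ⟶ Θ) {A B : Ty Θ} (h : sub σ A = sub σ B) :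
    Elt (castFn σ h).1 (wk (arr A B) (arr B A)) :=
  fnPair (castFn σ h) (castFn σ h.symm)

/-- The function underlying an equivalence together with the proof that it is an equivalence. -/
noncomputable def unpairEquiv {Θ : C} (A B : Ty Θ) : ext (EquivTy A B) ⟶ ext (IsEquivTy A B) :=
  unpair (arr A B) (IsEquivTy A B)

lemma unpairEquiv_proj_proj {Θ : C} (A B : Ty Θ) :
    unpairEquiv A B ≫ proj (IsEquivTy A B) ≫ proj (arr A B) = proj (EquivTy A B) :=
  unpair_proj_proj _ _

/-- Pairing is a strict section of unpairing, by the computation rule of `split`; no η-rule is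
involved. -/
lemma hasHomotopySection_unpairEquiv {Θ : C} (A B : Ty Θ) :
    HasHomotopySection (unpairEquiv A B) := .of_section _ (pair_unpair (arr A B) (IsEquivTy A B))

/-- The left and the right inverse of an equivalence. -/
noncomputable def unpairIsEquiv {Θ : C} (A B : Ty Θ) :
    ext (IsEquivTy A B) ⟶ ext (wk (LInv A B) (RInv A B)) :=
  unpair (LInv A B) (wk (LInv A B) (RInv A B))

lemma unpairIsEquiv_proj_proj {Θ : C} (A B : Ty Θ) :
    unpairIsEquiv A B ≫ proj (wk (LInv A B) (RInv A B)) ≫ proj (LInv A B) = proj (IsEquivTy A B) :=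
  unpair_proj_proj _ _

lemma hasHomotopySection_unpairIsEquiv {Θ : C} (A B : Ty Θ) :
    HasHomotopySection (unpairIsEquiv A B) :=
  .of_section _ (pair_unpair (LInv A B) (wk (LInv A B) (RInv A B)))

/-- The components of the identity equivalence. -/
lemma exists_castEquiv_components {Δ Θ : C} (σ : Δ ⟶ Θ) {A B : Ty Θ} (h : sub σ A = sub σ B) :
    ∃ (l : Elt (castPair σ h).1 (sub (pairElt (compArr (fnVar A B) (fnVar' A B))
        (idOver (fnPairProj A B) A)) (Id (arr A A))))
      (r : Elt (castPair σ h).1 (sub (pairElt (compArr (fnVar' A B) (fnVar A B))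
        (idOver (fnPairProj A B) B)) (Id (arr B B)))),
      l.1 ≫ q _ (Id (arr A A)) = ((castPair σ h).1 ≫ (compArr (fnVar A B) (fnVar' A B)).1) ≫
        (IdStructure.refl (arr A A)).1 ∧
      r.1 ≫ q _ (Id (arr B B)) = ((castPair σ h).1 ≫ (compArr (fnVar' A B) (fnVar A B)).1) ≫
        (IdStructure.refl (arr B B)).1 ∧
      (castEquiv σ h).1 ≫ unpairEquiv A B ≫ unpairIsEquiv A B ≫ proj _ =
        (pairOver (castPair σ h) l).1 ∧
      (castEquiv σ h).1 ≫ unpairEquiv A B ≫ unpairIsEquiv A B ≫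
        q (proj (LInv A B)) (RInv A B) = (pairOver (castPair σ h) r).1 := by
  have hid : ∀ D : Ty Θ, σ ≫ (idArr D).1 = (castPair σ h).1 ≫ (idOver (fnPairProj A B) D).1 :=
    fun D => (by rw [← Category.assoc, fnPair_hom_proj] :
      (castPair σ h).1 ≫ fnPairProj A B ≫ (idArr D).1 = σ ≫ (idArr D).1).symm
  have hl : (castPair σ h).1 ≫ (compArr (fnVar A B) (fnVar' A B)).1 =
      (castPair σ h).1 ≫ (idOver (fnPairProj A B) A).1 := by
    rw [pre_compArr, compArr_congr (fnPair_hom_proj _ _) (g' := castFn σ h)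
      (f' := castFn σ h.symm) (fnPair_hom_fnVar _ _) (fnPair_hom_fnVar' _ _), compArr_castFn]
    exact hid A
  have hr : (castPair σ h).1 ≫ (compArr (fnVar' A B) (fnVar A B)).1 =
      (castPair σ h).1 ≫ (idOver (fnPairProj A B) B).1 := by
    rw [pre_compArr, compArr_congr (fnPair_hom_proj _ _) (g' := castFn σ h.symm)
      (f' := castFn σ h) (fnPair_hom_fnVar' _ _) (fnPair_hom_fnVar _ _), compArr_castFn]
    exact hid B
  let l : Elt (castFn σ h).1 (LInv A B) := pairOver (castPair σ h) (reflOver _ _ _ hl)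
  let r : Elt (castFn σ h).1 (RInv A B) := pairOver (castPair σ h) (reflOver _ _ _ hr)
  let lr := lift (proj (LInv A B)) l.1 r.1 (r.2.trans l.2.symm)
  have e₁ : (castEquiv σ h).1 ≫ unpairEquiv A B = (pairOver l lr).1 := pairOver_unpair _ _
  have e₂ : (pairOver l lr).1 ≫ unpairIsEquiv A B = lr.1 := pairOver_unpair _ _
  refine ⟨reflOver _ _ _ hl, reflOver _ _ _ hr, lift_q _ _ _ _, lift_q _ _ _ _, ?_, ?_⟩
  · rw [reassoc_of% e₁]
    exact ((Category.assoc _ _ _).symm.trans (congrArg (· ≫ proj _) e₂)).trans (lift_proj _ _ _ _)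
  · rw [reassoc_of% e₁]
    exact ((Category.assoc _ _ _).symm.trans (congrArg (· ≫ q _ _) e₂)).trans (lift_q _ _ _ _)

/-- The object of equivalences compared with the type of equivalences. -/
lemma exists_eqObject_comparison (hη : PiEta C) (hext : FunExt C) {Θ : C} (A B : Ty Θ) :
    ∃ φ : ext (EquivTy A B) ⟶ ext (secondHomotopy A B), HasHomotopySection φ ∧
      φ ≫ (proj (secondHomotopy A B) ≫ proj (secondInverse A B)) ≫
        proj (leftInverses A B) ≫ fnPairProj A B = proj _ ∧
      ∀ {Δ : C} (σ : Δ ⟶ Θ) (h : sub σ A = sub σ B),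
        ((castEquiv σ h).1 ≫ φ ≫ (proj _ ≫ proj _) ≫ proj (leftInverses A B) =
          (castPair σ h).1) ∧
        ((castEquiv σ h).1 ≫ φ ≫ q _ (rightInverses A B) ≫ proj _ = (castPair σ h).1) ∧
        (∀ {Z : C} (k : Z ⟶ Δ) (a : Z ⟶ ext A) (_ : a ≫ proj A = k ≫ σ) (h'),
          evalPath @hη (k ≫ (castEquiv σ h).1 ≫ φ ≫ (proj _ ≫ proj _) ≫
            q _ (pointwiseId A A)) a h' = a ≫ (IdStructure.refl A).1) ∧
        (∀ {Z : C} (k : Z ⟶ Δ) (b : Z ⟶ ext B) (_ : b ≫ proj B = k ≫ σ) (h'),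
          evalPath @hη (k ≫ (castEquiv σ h).1 ≫ φ ≫ q _ (rightInverses A B) ≫
            q _ (pointwiseId B B)) b h' = b ≫ (IdStructure.refl B).1) := by
  obtain ⟨φl, hl, hl', hl''⟩ := exists_sig_comparison @hη @hext (wk (arr A B) (arr B A))
    (compArr (fnVar A B) (fnVar' A B)) (idOver (fnPairProj A B) A)
  obtain ⟨φr, hr, hr', hr''⟩ := exists_sig_comparison @hη @hext (wk (arr A B) (arr B A))
    (compArr (fnVar' A B) (fnVar A B)) (idOver (fnPairProj A B) B)
  let ul : ext (LInv A B) ⟶ ext (leftInverses A B) := φl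
  let ur : ext (RInv A B) ⟶ ext (rightInverses A B) := φr
  have hul : ul ≫ proj (leftInverses A B) ≫ (fnVar A B).1 = proj (LInv A B) := hl'
  have hur : ur ≫ proj (rightInverses A B) ≫ (fnVar A B).1 = proj (RInv A B) := hr'
  let K := wk (LInv A B) (RInv A B)
  -- Both objects of equivalences are fibre products, over the type of functions, of left and right
  -- inverses; `κ` is the map of fibre products induced by the comparisons on the two sides.
  have hK : IsPullback (proj K) (q (proj (LInv A B)) (RInv A B))
      (ul ≫ proj (leftInverses A B) ≫ (fnVar A B).1)
      (ur ≫ proj (rightInverses A B) ≫ (fnVar A B).1) := by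
    rw [hul, hur]
    exact (ContextualCategory.isPullback _ _).flip
  let κ : ext K ⟶ ext (secondHomotopy A B) := (isPullback_secondHomotopy A B).lift
    (proj K ≫ ul) (q (proj (LInv A B)) (RInv A B) ≫ ur) (by simpa using hK.w)
  have hκ₁ : κ ≫ proj _ ≫ proj _ = proj K ≫ ul := IsPullback.lift_fst _ _ _ _
  have hκ₂ : κ ≫ q _ (rightInverses A B) = q (proj (LInv A B)) (RInv A B) ≫ ur :=
    IsPullback.lift_snd _ _ _ _
  have hκ : HasHomotopySection κ := .pullback_map hη hext
    (fibrations_comp (fibrations_proj _) (fibrations_proj _))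
    (hur ▸ fibrations_proj _) hK (isPullback_secondHomotopy A B) hκ₁ hκ₂ hl hr
  refine ⟨unpairEquiv A B ≫ unpairIsEquiv A B ≫ κ,
    .comp hη hext (hasHomotopySection_unpairEquiv A B)
      (.comp hη hext (hasHomotopySection_unpairIsEquiv A B) hκ), ?_, ?_⟩
  · have e₁ : κ ≫ (proj (secondHomotopy A B) ≫ proj (secondInverse A B)) ≫
        proj (leftInverses A B) ≫ fnPairProj A B = (proj K ≫ proj (LInv A B)) ≫ proj (arr A B) := by
      rw [← Category.assoc κ, hκ₁, ← hul]
      simp only [fnVar, fnPairProj, Category.assoc]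
    rw [Category.assoc, Category.assoc, e₁, Category.assoc,
      reassoc_of% (unpairIsEquiv_proj_proj A B), unpairEquiv_proj_proj]
  · intro Δ σ h
    obtain ⟨l, r, h₁, h₂, h₃, h₄⟩ := exists_castEquiv_components σ h
    have hm : (castPair σ h).1 ≫ fnPairProj A B = σ := fnPair_hom_proj _ _
    have e₁ : (castEquiv σ h).1 ≫ (unpairEquiv A B ≫ unpairIsEquiv A B ≫ κ) ≫
        proj (secondHomotopy A B) ≫ proj (secondInverse A B) =
        (pairOver (castPair σ h) l).1 ≫ ul := by
      simp only [Category.assoc]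
      rw [hκ₁]
      have := congrArg (· ≫ ul) h₃
      simp only [Category.assoc] at this
      exact this
    have e₂ : (castEquiv σ h).1 ≫ (unpairEquiv A B ≫ unpairIsEquiv A B ≫ κ) ≫
        q _ (rightInverses A B) = (pairOver (castPair σ h) r).1 ≫ ur := by
      simp only [Category.assoc]
      rw [hκ₂]
      have := congrArg (· ≫ ur) h₄
      simp only [Category.assoc] at this
      exact this
    refine ⟨?_, ?_, fun k a ha h' => ?_, fun k b hb h' => ?_⟩
    · have := congrArg (· ≫ proj (leftInverses A B)) e₁
      simp only [Category.assoc] at this ⊢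
      exact this.trans ((Category.assoc _ _ _).trans (hl'' _ l).1)
    · have := congrArg (· ≫ proj (rightInverses A B)) e₂
      simp only [Category.assoc] at this ⊢
      exact this.trans ((Category.assoc _ _ _).trans (hr'' _ r).1)
    · have := congrArg (fun x => k ≫ x ≫ q _ (pointwiseId A A)) e₁
      simp only [Category.assoc] at this
      have := this.trans (congrArg (k ≫ ·) (Category.assoc _ _ _))
      simp only [Category.assoc] at h' ⊢
      refine (evalPath_congr @hη this rfl _).trans (((hl'' _ l).2 h₁ k a (by rw [hm, ha])
        (by rw [← this]; simpa only [Category.assoc] using h')).trans ?_)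
      · refine congrArg (· ≫ (IdStructure.refl _).1) ?_
        -- For the identity equivalence the composite with the inverse is strictly the identity, so
        -- its value at `a` is `a`.
        refine (evalArr_congr (congrArg (k ≫ ·) (comp_eq_of_refl l h₁)) rfl _).trans ?_
        refine (evalArr_congr (Category.assoc _ _ _).symm rfl _).trans ?_
        exact evalArr_idOver (fnPairProj A B) (k ≫ (castPair σ h).1) a (by
          rw [Category.assoc, hm, ha]) _
    · have := congrArg (fun x => k ≫ x ≫ q _ (pointwiseId B B)) e₂
      simp only [Category.assoc] at this
      have := this.trans (congrArg (k ≫ ·) (Category.assoc _ _ _))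
      simp only [Category.assoc] at h' ⊢
      refine (evalPath_congr @hη this rfl _).trans (((hr'' _ r).2 h₂ k b (by rw [hm, hb])
        (by rw [← this]; simpa only [Category.assoc] using h')).trans ?_)
      · refine congrArg (· ≫ (IdStructure.refl _).1) ?_
        refine (evalArr_congr (congrArg (k ≫ ·) (comp_eq_of_refl r h₂)) rfl _).trans ?_
        refine (evalArr_congr (Category.assoc _ _ _).symm rfl _).trans ?_
        exact evalArr_idOver (fnPairProj A B) (k ≫ (castPair σ h).1) b (by
          rw [Category.assoc, hm, hb]) _

end EquivalenceObjects

/-! ## Univalence -/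

section Univalence

open ContextualCategory Tribe SigmaStructure IdStructure PiStructure

variable {C : Type u} [Category.{v} C] [ContextualCategory.{w} C]

lemma extCast_q_q {Γ X Δ : C} (A : Ty Γ) {d : Δ ⟶ X} {f g : X ⟶ Γ} (hfg : d ≫ f = d ≫ g)
    (h : sub d (sub f A) = sub d (sub g A)) :
    extCast h ≫ q d (sub g A) ≫ q g A = q d (sub f A) ≫ q f A := by
  have key : ∀ (x y : Δ ⟶ Γ) (_ : x = y) (T : Ty Δ) (h₁ : T = sub x A) (h₂ : T = sub y A),
      extCast h₁ ≫ q x A = extCast h₂ ≫ q y A := by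
    rintro x _ rfl T h₁ h₂; rfl
  rw [q_comp', extCast_trans_assoc, q_comp']
  exact key _ _ hfg.symm _ _ _

/-- A split monomorphism with a section up to homotopy, is a homotopy equivalence. -/
lemma HasHomotopySection.isHomotopyEquiv [SigmaStructure C] [IdStructure C] [PiStructure C]
    (hη : PiEta C) (hext : FunExt C) {X Y : C} {f : X ⟶ Y} (hf : HasHomotopySection f) (π : Y ⟶ X)
    (hπ : f ≫ π = 𝟙 X) : IsHomotopyEquiv (fibrations C) f := by
  obtain ⟨z, hz⟩ := hf
  have hP : HasPaths (fibrations C) := fibrations_hasPaths hη hext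
  refine ⟨z, ?_, hP.homotopic rootIsTerminal (fibrations_root _) hz⟩
  refine hP.homotopic rootIsTerminal (fibrations_root _) ?_ (q := rootIsTerminal.from X)
  -- Composing `z ≫ f ~ 𝟙` with `f` on one side and with the retraction `π` on the other cancels the
  -- extra `f`.
  have := (hz.pre f).map (fibrations_isClan C) (fibrations_root _) (q := rootIsTerminal.from X) π
    (𝟙 root) (rootIsTerminal.hom_ext _ _)
  simpa [hπ] using this

section

variable [PiStructure C]

/-- β at the generic element of `T`. -/
lemma evalArr_lam {X : C} {T V : Ty X} (b : Sec (wk T V)) (h) :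
    evalArr (proj T ≫ (lam b).1) (𝟙 (ext T)) h = b.1 ≫ q (proj T) V := by
  have hw : (proj T ≫ (lam b).1) ≫ proj _ = proj T := by
    rw [Category.assoc, (lam b).2, Category.comp_id]
  have e : Sec.cast (sub_Pi (proj T) T (wk T V)) (lift (proj T) (𝟙 (ext T)) (proj T ≫ (lam b).1)
      (by rw [hw, Category.id_comp])) = lam (Sec.sub (q (proj T) T) b) := sub_lam _ _
  refine (applyArr_hom (⟨_, hw⟩ : Elt (proj T) (arr T V)) ⟨𝟙 _, Category.id_comp _⟩).symm.trans ?_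
  unfold applyArr applyOver
  simp only [e, beta]
  unfold Sec.sub
  simp only [Category.assoc, lift_q]
  rw [← Category.assoc, lift_q, Category.id_comp]

/-- Along a common section `d` of `f` and `g` both pullbacks of `A` become `A`, with embeddings `i`
and `j`; the coercion carries one embedding to the other. -/
lemma evalArr_castFn_diagonal {Γ X : C} (A : Ty Γ) {d : Γ ⟶ X} {f g : X ⟶ Γ} (hf : d ≫ f = 𝟙 Γ)
    (hg : d ≫ g = 𝟙 Γ) (h : sub d (sub f A) = sub d (sub g A)) {i : ext A ⟶ ext (sub f A)}
    {j : ext A ⟶ ext (sub g A)} (hi : i ≫ q f A = 𝟙 _) (hi' : i ≫ proj _ = proj A ≫ d)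
    (hj : j ≫ q g A = 𝟙 _) (hj' : j ≫ proj _ = proj A ≫ d) (hw) :
    evalArr (proj A ≫ (castFn d h).1) i hw = j := by
  rw [evalArr_castFn d h (proj A) i hi']
  apply lift_ext
  · rw [Category.assoc, Category.assoc, extCast_q_q A (hf.trans hg.symm), ← Category.assoc, lift_q,
      hi, hj]
  · rw [Category.assoc, Category.assoc, q_proj, ← Category.assoc (extCast h), extCast_proj,
      ← Category.assoc, lift_proj, hj']

end

variable [SigmaStructure C] [IdStructure C] [PiStructure C]

/-- The right inverse of a function and its homotopy. -/
noncomputable def unpairRInv {Θ : C} (A B : Ty Θ) : ext (RInv A B) ⟶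
    ext (sub (pairElt (compArr (fnVar' A B) (fnVar A B)) (idOver (fnPairProj A B) B))
      (Id (arr B B))) :=
  unpair (wk (arr A B) (arr B A)) _

lemma unpairRInv_proj_fnVar {Θ : C} (A B : Ty Θ) :
    unpairRInv A B ≫ proj _ ≫ (fnVar A B).1 = proj (RInv A B) :=
  unpair_proj_proj (wk (arr A B) (arr B A)) _

/-- Functions which are equivalences have homotopy sections. -/
lemma hasHomotopySection_of_isEquiv {X : C} {T V : Ty X} (b : Sec (wk T V))
    (s : Sec (sub (lam b : Sec (arr T V)).1 (IsEquivTy T V))) :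
    HasHomotopySection (b.1 ≫ q (proj T) V) := by
  let c := compArr (fnVar' T V) (fnVar T V)
  -- Only the right inverse and its identification are extracted from the equivalence: they provide
  -- the homotopy section.
  let x : X ⟶ ext (sub (pairElt c (idOver (fnPairProj T V) V)) (Id (arr V V))) :=
    s.1 ≫ q _ _ ≫ unpairIsEquiv T V ≫ q (proj (LInv T V)) (RInv T V) ≫ unpairRInv T V
  let m := x ≫ proj _
  have hm : m ≫ (fnVar T V).1 = (lam b).1 := by
    simp only [m, x, Category.assoc]
    rw [unpairRInv_proj_fnVar, q_proj, unpairIsEquiv_proj_proj, q_proj, ← Category.assoc, s.2,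
      Category.id_comp]
  have hn : m ≫ fnPairProj T V = 𝟙 X := by
    have := congrArg (· ≫ proj _) hm
    simpa [(lam b).2, fnVar] using this
  have H : IdHomotopic (arr V V) (m ≫ c.1) (m ≫ (idOver (fnPairProj T V) V).1) :=
    IdHomotopic.of_elt ⟨x, rfl⟩
  have hg : (proj V ≫ m ≫ (fnVar' T V).1) ≫ proj _ = 𝟙 (ext V) ≫ proj V := by
    rw [Category.assoc, Category.assoc, (fnVar' T V).2, hn, Category.comp_id, Category.id_comp]
  refine ⟨evalArr (proj V ≫ m ≫ (fnVar' T V).1) (𝟙 _) hg, ?_⟩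
  have hd : ∀ e : Elt (fnPairProj T V) (arr V V),
      (proj V ≫ m ≫ e.1) ≫ proj _ = 𝟙 (ext V) ≫ proj V := fun e => by
    rw [Category.assoc, Category.assoc, e.2, hn, Category.comp_id, Category.id_comp]
  let l : Elt (fnPairProj T V) (arr V V) → (ext V ⟶ ext (sub (proj V) (arr V V))) := fun e =>
    (lift (proj V) (𝟙 _) (proj V ≫ m ≫ e.1) (hd e)).1
  have H' : IdHomotopic (sub (proj V) (arr V V)) (l c) (l (idOver _ V)) := by
    apply IdHomotopic.lift
    · simp only [l, lift_proj]
    · obtain ⟨K, h₀, h₁⟩ := H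
      exact ⟨proj V ≫ K, by simp only [l, lift_q, Category.assoc, h₀],
        by simp only [l, lift_q, Category.assoc, h₁]⟩
  -- An identification of functions becomes a homotopy of maps by evaluating both functions at the
  -- generic element of `V`.
  have ht := H'.fibreHomotopic.map (fibrations_isClan C) (fibrations_proj _)
    (q := rootIsTerminal.from (ext V)) (evalArr (q (proj V) (arr V V)) (proj _) (q_proj _ _))
    (rootIsTerminal.from _) (rootIsTerminal.hom_ext _ _)
  have hl : ∀ e, l e ≫ evalArr (q (proj V) (arr V V)) (proj _) (q_proj _ _) =
      evalArr (proj V ≫ m ≫ e.1) (𝟙 _) (hd e) := fun e => by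
    rw [comp_evalArr]
    exact evalArr_congr (lift_q _ _ _ _) (lift_proj _ _ _ _) _
  rw [hl, hl] at ht
  have e₁ : ∀ (e : Elt (fnPairProj T V) (arr V V)) h', evalArr (proj V ≫ m ≫ e.1) (𝟙 _) (hd e) =
      evalArr ((proj V ≫ m) ≫ e.1) (𝟙 _) h' := fun e h' =>
    evalArr_congr (Category.assoc _ _ _).symm rfl _
  have hk : 𝟙 (ext V) ≫ proj V = (proj V ≫ m) ≫ fnPairProj T V := by
    rw [Category.assoc, hn, Category.comp_id, Category.id_comp]
  have e₂ : evalArr (proj V ≫ m ≫ (idOver (fnPairProj T V) V).1) (𝟙 _) (hd _) = 𝟙 _ := by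
    rw [e₁ _ (by rw [Category.assoc (proj V)]; exact hd _)]
    exact evalArr_idOver _ _ _ hk _
  have e₃ : evalArr (proj V ≫ m ≫ c.1) (𝟙 _) (hd _) =
      evalArr (proj V ≫ m ≫ (fnVar' T V).1) (𝟙 _) hg ≫ b.1 ≫ q (proj T) V := by
    rw [e₁ _ (by rw [Category.assoc (proj V)]; exact hd _)]
    refine (evalArr_compArr _ _ _ _ hk _).trans ?_
    rw [← evalArr_lam b (by rw [Category.assoc, (lam b).2, Category.comp_id, Category.id_comp]),
      comp_evalArr]
    refine evalArr_congr ?_ ?_ _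
    · rw [Category.assoc, hm, ← Category.assoc, evalArr_proj, Category.id_comp]
    · rw [Category.comp_id]
      exact evalArr_congr (Category.assoc _ _ _) rfl _
  rwa [e₂, e₃] at ht

/-- The map from identifications to equivalences. -/
noncomputable def idToEquivMap {Γ : C} (A : Ty Γ) (B : Ty (ext A)) :
    ext (Id A) ⟶ ext (famEquiv A B) :=
  (idToEquiv A B).1 ≫ q (proj (Id A)) (famEquiv A B)

lemma refl_idToEquivMap {Γ : C} (A : Ty Γ) (B : Ty (ext A)) :
    (IdStructure.refl A).1 ≫ idToEquivMap A B = (castEquiv (diagSec A).1 (diagSec_fam A B)).1 := by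
  unfold idToEquivMap idToEquiv
  rw [← Category.assoc, refl_J]
  exact lift_q _ _ _ _

/-- This is all that is needed of univalence; the left inverse plays no role. -/
lemma hasHomotopySection_idToEquivMap {U : Ty (root : C)} {El : Ty (ext U)}
    (h : IsUnivalentUniverse U El) : HasHomotopySection (idToEquivMap U El) := by
  obtain ⟨s⟩ := h
  exact hasHomotopySection_of_isEquiv (idToEquiv U El) s

/-- The type family of a univalent universe is a univalent fibration. -/
theorem isUnivalentFibration_of_isUnivalentUniverse (hη : PiEta C) (hext : FunExt C)
    {U : Ty (root : C)} {El : Ty (ext U)} (hU : IsUnivalentUniverse U El) :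
    IsUnivalentFibration (fibrations C) (proj El) := by
  let d := (diagSec U).1
  have hd₁ : d ≫ proj (wk U U) = 𝟙 _ := (diagSec U).2
  have hd₂ : d ≫ q (proj U) U = 𝟙 _ := diagSec_q U
  let A := sub (proj (wk U U)) El
  let B := sub (q (proj U) U) El
  obtain ⟨φ, hφ, hφ', hφ''⟩ := exists_eqObject_comparison @hη @hext A B
  obtain ⟨h₁, h₂, h₃, h₄⟩ := hφ'' d (diagSec_fam U El)
  let δ : ext U ⟶ ext (secondHomotopy A B) := (castEquiv d (diagSec_fam U El)).1 ≫ φ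
  let i := lift (proj (wk U U)) (proj El ≫ d) (𝟙 (ext El))
    (by rw [Category.assoc, hd₁, Category.comp_id, Category.id_comp])
  let j := lift (q (proj U) U) (proj El ≫ d) (𝟙 (ext El))
    (by rw [Category.assoc, hd₂, Category.comp_id, Category.id_comp])
  have hi : i.1 ≫ q _ El = 𝟙 _ := lift_q _ _ _ _
  have hj : j.1 ≫ q _ El = 𝟙 _ := lift_q _ _ _ _
  have hδ : δ ≫ (proj (secondHomotopy A B) ≫ proj (secondInverse A B)) ≫
      proj (leftInverses A B) ≫ fnPairProj A B = d := by
    rw [Category.assoc, hφ']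
    exact (castEquiv d _).2
  have hmap : δ ≫ q _ (rightInverses A B) ≫ proj _ ≫ (fnVar A B).1 =
      (castFn d (diagSec_fam U El)).1 := by
    rw [← fnPair_hom_fnVar (castFn d (diagSec_fam U El)) (castFn d (diagSec_fam U El).symm), ← h₂]
    simp only [δ, Category.assoc]
    rfl
  have hright : δ ≫ q _ (rightInverses A B) ≫ proj _ ≫ (fnVar' A B).1 =
      (castFn d (diagSec_fam U El).symm).1 := by
    rw [← fnPair_hom_fnVar' (castFn d (diagSec_fam U El)) (castFn d (diagSec_fam U El).symm), ← h₂]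
    simp only [δ, Category.assoc]
    rfl
  have hleft : δ ≫ (proj _ ≫ proj _) ≫ proj (leftInverses A B) ≫ (fnVar' A B).1 =
      (castFn d (diagSec_fam U El).symm).1 := by
    rw [← fnPair_hom_fnVar' (castFn d (diagSec_fam U El)) (castFn d (diagSec_fam U El).symm), ← h₁]
    simp only [δ, Category.assoc]
    rfl
  let D : UnivalenceData (fibrations C) (proj El) :=
    { sq := BinaryFan.mk (proj (wk U U)) (q (proj U) U)
      isLimit := fanIsLimit rootIsTerminal (isPullback_wk U)
      E₁ := Over.mk (proj A)
      E₂ := Over.mk (proj B)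
      s₁ := q (proj (wk U U)) El
      s₂ := q (q (proj U) U) El
      isPullback₁ := ContextualCategory.isPullback _ El
      isPullback₂ := ContextualCategory.isPullback _ El
      Q := eqObject @hη A B
      dia := d
      dia_fst := hd₁
      dia_snd := hd₂
      δ := Over.homMk (U := Over.mk d) δ hδ
      i₁ := Over.homMk (U := Over.mk (proj El ≫ d)) (V := Over.mk (proj A)) i.1 i.2
      i₁_s₁ := hi
      i₂ := Over.homMk (U := Over.mk (proj El ≫ d)) (V := Over.mk (proj B)) j.1 j.2
      i₂_s₂ := hj
      -- Over the diagonal, the functions classified by `δ` are coercions, so they exchange the two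
      -- embeddings of `E` into its pullbacks.
      δ_map := by
        ext
        refine (arrInternalHom_apply_left @hη _ _).trans ((evalArr_congr (congrArg (proj El ≫ ·)
          hmap) rfl _).trans (evalArr_castFn_diagonal El hd₁ hd₂ _ hi i.2 hj j.2 ?_))
        rw [Category.assoc, (castFn d _).2]; exact i.2.symm
      δ_right := by
        ext
        refine (arrInternalHom_apply_left @hη _ _).trans ((evalArr_congr (congrArg (proj El ≫ ·)
          hright) rfl _).trans (evalArr_castFn_diagonal El hd₂ hd₁ _ hj j.2 hi i.2 ?_))
        rw [Category.assoc, (castFn d _).2]; exact j.2.symm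
      δ_left := by
        ext
        refine (arrInternalHom_apply_left @hη _ _).trans ((evalArr_congr (congrArg (proj El ≫ ·)
          hleft) rfl _).trans (evalArr_castFn_diagonal El hd₂ hd₁ _ hj j.2 hi i.2 ?_))
        rw [Category.assoc, (castFn d _).2]; exact j.2.symm
      δ_rightHomotopy := by
        ext
        refine (pathInternalHom_apply_left @hη _ _).trans ?_
        refine (evalPath_congr @hη (congrArg (proj El ≫ ·) (Category.assoc _ _ _)) rfl _).trans ?_
        exact h₄ (proj El) j.1 j.2 _
      δ_leftHomotopy := by
        ext
        refine (pathInternalHom_apply_left @hη _ _).trans ?_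
        refine (evalPath_congr @hη (congrArg (proj El ≫ ·) (Category.assoc _ _ _)) rfl _).trans ?_
        exact h₃ (proj El) i.1 i.2 _ }
  refine ⟨fibrations_proj El, D, ?_⟩
  -- By the computation rule of `J`, `idToEquivMap` sends reflexivity to the identity equivalence,
  -- from which `δ` was defined.
  have e : δ = (IdStructure.refl U).1 ≫ idToEquivMap U El ≫ φ := by
    have := congrArg (· ≫ φ) (refl_idToEquivMap U El)
    exact this.symm.trans (Category.assoc _ _ _)
  have : HasHomotopySection δ := by
    rw [e]
    exact .comp hη hext (.of_anodyne (anodyne_refl U))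
      (.comp hη hext (hasHomotopySection_idToEquivMap hU) hφ)
  -- The retraction is the structure map to `U × U` followed by the first projection.
  exact this.isHomotopyEquiv hη hext (((proj (secondHomotopy A B) ≫ proj (secondInverse A B)) ≫
      proj (leftInverses A B) ≫ fnPairProj A B) ≫ proj (wk U U)) (by
    rw [← Category.assoc, hδ, hd₁])

end Univalence

/-! ## Enough univalent fibrations -/

namespace Tribe

section Terminal

variable {D : Type u} [Category.{v} D] {Fib : MorphismProperty D} {T : D}

/-- A terminal object is the product of itself with itself. -/
def terminalFanIsLimit (hT : IsTerminal T) : IsLimit (BinaryFan.mk (𝟙 T) (𝟙 T)) :=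
  BinaryFan.IsLimit.mk _ (fun _ _ => hT.from _) (fun _ _ => hT.hom_ext _ _)
    (fun _ _ => hT.hom_ext _ _) (fun _ _ _ _ _ => hT.hom_ext _ _)

lemma terminalIsPullback (hT : IsTerminal T) (f g : T ⟶ T) : IsPullback (𝟙 T) (𝟙 T) f g := by
  rw [hT.hom_ext f (𝟙 T), hT.hom_ext g (𝟙 T)]
  exact IsPullback.id_vert _

/-- The path object of a terminal object. -/
def terminalPathObject (hT : IsTerminal T) (h : Fib (𝟙 T)) : PathObject Fib T where
  sq := BinaryFan.mk (𝟙 T) (𝟙 T)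
  isLimit := terminalFanIsLimit hT
  obj := T
  r := 𝟙 T
  ends := 𝟙 T
  anodyne := anodyne_of_isIso _
  fib := h
  r_fst := hT.hom_ext _ _
  r_snd := hT.hom_ext _ _

/-- The internal hom of a terminal object with itself. -/
def terminalInternalHom (hT : IsTerminal T) : InternalHom T T where
  obj := T
  prod := BinaryFan.mk (𝟙 T) (𝟙 T)
  isLimit := terminalFanIsLimit hT
  ev := 𝟙 T
  universal _ _ _ := ⟨hT.from _, hT.hom_ext _ _, fun _ _ => hT.hom_ext _ _⟩

/-- The object of right inverses between terminal objects. -/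
def terminalRInvObject (hT : IsTerminal T) (h : Fib (𝟙 T)) :
    RInvObject (terminalPathObject hT h) (terminalInternalHom hT) (terminalInternalHom hT) where
  HBB := terminalInternalHom hT
  HBP := terminalInternalHom hT
  prod := BinaryFan.mk (𝟙 T) (𝟙 T)
  prodIsLimit := terminalFanIsLimit hT
  sq := BinaryFan.mk (𝟙 T) (𝟙 T)
  sqIsLimit := terminalFanIsLimit hT
  compConst := 𝟙 T
  compConst_fst _ _ := hT.hom_ext _ _
  compConst_snd _ _ := hT.hom_ext _ _
  ends := 𝟙 T
  ends_fst _ _ := hT.hom_ext _ _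
  ends_snd _ _ := hT.hom_ext _ _
  obj := T
  toPath := 𝟙 T
  toProd := 𝟙 T
  isPullback := IsPullback.id_vert _

/-- The object of equivalences between terminal objects. -/
def terminalEqObject (hT : IsTerminal T) (h : Fib (𝟙 T)) : EqObject Fib T T where
  PA := terminalPathObject hT h
  PB := terminalPathObject hT h
  HAB := terminalInternalHom hT
  HBA := terminalInternalHom hT
  rInv := terminalRInvObject hT h
  lInv := terminalRInvObject hT h
  obj := T
  toL := 𝟙 T
  toR := 𝟙 T
  isPullback := terminalIsPullback hT _ _

/-- The identity of a terminal object is a univalent fibration. -/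
lemma isUnivalentFibration_id (hT : IsTerminal T) (h : Fib (𝟙 T)) :
    IsUnivalentFibration Fib (𝟙 T) := by
  have hO : IsTerminal (Over.mk (𝟙 T)) := Over.mkIdTerminal
  let δ : Over.mk (𝟙 T) ⟶ (terminalEqObject (Fib := Fib.over (X := T)) hO h).obj := 𝟙 _
  let i : Over.mk (𝟙 T ≫ 𝟙 T) ⟶ Over.mk (𝟙 T) := hO.from _
  refine ⟨h, ⟨BinaryFan.mk (𝟙 T) (𝟙 T), terminalFanIsLimit hT, Over.mk (𝟙 T), Over.mk (𝟙 T), 𝟙 T,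
    𝟙 T, IsPullback.id_vert _, IsPullback.id_vert _, terminalEqObject hO h, 𝟙 T,
    hT.hom_ext _ _, hT.hom_ext _ _, δ, i, hT.hom_ext _ _, i, hT.hom_ext _ _,
    hO.hom_ext _ _, hO.hom_ext _ _, hO.hom_ext _ _, hO.hom_ext _ _, hO.hom_ext _ _⟩, 𝟙 T,
    ?_, ?_⟩
  · exact ⟨terminalPathObject hT h, 𝟙 T, hT.hom_ext _ _, hT.hom_ext _ _⟩
  · exact ⟨terminalPathObject hT h, 𝟙 T, hT.hom_ext _ _, hT.hom_ext _ _⟩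

lemma pullbacksOf_id_iff (hT : IsTerminal T) {A X : D} (f : A ⟶ X) :
    pullbacksOf (𝟙 T) f ↔ IsIso f := by
  constructor
  · rintro ⟨t, χ, h⟩
    exact h.isIso_snd_of_isIso
  · intro _
    exact ⟨hT.from A, hT.from X, IsPullback.of_vert_isIso ⟨hT.hom_ext _ _⟩⟩

/-- The pullbacks of an identity are the isomorphisms, and the dependent product of an isomorphism
is an isomorphism. -/
lemma isClosedClass_pullbacksOf_id (hT : IsTerminal T) : IsClosedClass (pullbacksOf (𝟙 T)) := by
  refine ⟨⟨fun f g hf hg => ?_⟩, fun p f hp hf P => ?_⟩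
  · rw [pullbacksOf_id_iff hT] at *
    infer_instance
  · rw [pullbacksOf_id_iff hT] at *
    obtain ⟨e, he⟩ := P.exists_iso (.ofIsIso p f)
    have : P.hom = e.hom := by rw [← he]; exact Category.comp_id _
    rw [this]
    exact e.isIso_hom

end Terminal

end Tribe

section EnoughUnivalentFibrations

open ContextualCategory Tribe SigmaStructure IdStructure PiStructure

variable {C : Type u} [Category.{v} C] [ContextualCategory.{w} C]

/-- If the `Σ`-structure satisfies the `η`-rule, fibrations are isomorphisms or isomorphic to
dependent projections. -/
lemma isIso_or_isDisplay [SigmaStructure C] (hs : SigmaEta C) {X E : C} {f : E ⟶ X}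
    (hf : fibrations C f) : IsIso f ∨ IsDisplay f := by
  refine fibrations_induction (R := fun f => IsIso f ∨ IsDisplay f) (fun f hf => Or.inl hf) ?_ hf
  intro X Y Z p f hp _ ih
  right
  rcases ih with _ | ⟨A, e, rfl⟩
  · exact hp.comp_iso (asIso f)
  · obtain ⟨B, d, hd⟩ := hp.comp_iso e
    have := hs A B
    -- The η-rule enters here: two consecutive projections are isomorphic to the projection of the
    -- sum.
    refine ⟨Sig A B, d ≪≫ asIso (pair A B).1, ?_⟩
    rw [Iso.trans_hom, asIso_hom, Category.assoc, (pair A B).2, ← Category.assoc, hd,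
      Category.assoc]

lemma pullbacksOf_proj_of_iso {U : Ty (root : C)} {El : Ty (ext U)} {X E : C} {f : E ⟶ X}
    {χ : X ⟶ ext U} (e : E ≅ ext (sub χ El)) (he : e.hom ≫ proj _ = f) :
    pullbacksOf (proj El) f :=
  ⟨e.hom ≫ q χ El, χ, (ContextualCategory.isPullback χ El).of_iso e.symm (Iso.refl _)
    (Iso.refl _) (Iso.refl _) (by simp) (by simp [← he]) (by simp) (by simp)⟩

/-- The isomorphism `d` permits rebasing the upper of two composable maps onto the canonical
extension replacing the source of the lower one, so that its code is a family over that extension.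
-/
lemma exists_iso_of_pullbacksOf_proj {U : Ty (root : C)} {El : Ty (ext U)} {X X' E : C} {f : E ⟶ X}
    (hf : pullbacksOf (proj El) f) (d : X ≅ X') :
    ∃ (χ : X' ⟶ ext U) (e : E ≅ ext (sub χ El)), e.hom ≫ proj _ = f ≫ d.hom := by
  obtain ⟨t, χ, h⟩ := hf
  have h' : IsPullback t (f ≫ d.hom) (proj El) (d.inv ≫ χ) :=
    h.of_iso (Iso.refl _) (Iso.refl _) d (Iso.refl _) (by simp) (by simp) (by simp) (by simp)
  exact ⟨_, h'.isoIsPullback _ _ (ContextualCategory.isPullback _ El), by simp⟩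

variable [SigmaStructure C] [IdStructure C] [PiStructure C]

/-- Two composable maps of the class have codes `a` and `b`. By η for `Σ` the composite is the
projection of a sum, and any dependent product is isomorphic to the one given by `Π`; the codes
`hU.sigma a b` and `hU.pi a b` classify them. -/
lemma isClosedClass_pullbacksOf_proj (hη : PiEta C) (hs : SigmaEta C) {U : Ty (root : C)}
    {El : Ty (ext U)} (hU : UniverseClosed U El) : IsClosedClass (pullbacksOf (proj El)) := by
  refine ⟨⟨fun {X Y Z} f g hf hg => ?_⟩, fun {X Y E} p f hp hf P => ?_⟩
  · obtain ⟨a, d, hd⟩ := exists_iso_of_pullbacksOf_proj hg (Iso.refl Z)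
    obtain ⟨b, e, he⟩ := exists_iso_of_pullbacksOf_proj hf d
    have := hs (sub a El) (sub b El)
    refine pullbacksOf_proj_of_iso (χ := hU.sigma a b)
      (e ≪≫ asIso (pair (sub a El) (sub b El)).1 ≪≫
        eqToIso (congrArg ext (hU.El_sigma a b).symm)) ?_
    have h₁ : eqToHom (congrArg ext (hU.El_sigma a b).symm) ≫ proj _ = proj _ :=
      extCast_proj (hU.El_sigma a b).symm
    rw [Iso.trans_hom, Iso.trans_hom, asIso_hom, eqToIso.hom, Category.assoc, Category.assoc, h₁,
      (SigmaStructure.pair _ _).2, ← Category.assoc, he, Category.assoc, hd]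
    simp
  · obtain ⟨a, d, hd⟩ := exists_iso_of_pullbacksOf_proj hp (Iso.refl Y)
    obtain ⟨b, e, he⟩ := exists_iso_of_pullbacksOf_proj hf d
    obtain ⟨i, hi⟩ := P.exists_iso ((piProduct @hη (sub a El) (sub b El)).ofIso d
      (by simpa using hd) e he)
    refine pullbacksOf_proj_of_iso (χ := hU.pi a b)
      (i ≪≫ eqToIso (congrArg ext (hU.El_pi a b).symm)) ?_
    have h₁ : eqToHom (congrArg ext (hU.El_pi a b).symm) ≫ proj _ = proj _ :=
      extCast_proj (hU.El_pi a b).symm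
    exact (Category.assoc _ _ _).trans ((congrArg (i.hom ≫ ·) h₁).trans hi)

/-- If there are enough univalent universes, there are enough univalent fibrations. -/
theorem hasEnoughUnivalentFibrations (hη : PiEta C) (hext : FunExt C) (hs : SigmaEta C)
    (hU : HasEnoughUnivalentUniverses C) : HasEnoughUnivalentFibrations (fibrations C) := by
  intro A X f hf
  rcases isIso_or_isDisplay @hs hf with h | ⟨A, e, he⟩
  · exact ⟨root, root, 𝟙 root, isUnivalentFibration_id rootIsTerminal (fibrations_of_isIso _),
      (pullbacksOf_id_iff rootIsTerminal f).2 h, isClosedClass_pullbacksOf_id rootIsTerminal⟩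
  -- A family with one member suffices, since the fibration has been reduced to a single projection.
  · obtain ⟨U, El, ⟨hc⟩, hu, hχ⟩ := hU 1 (fun _ => X) (fun _ => A)
    obtain ⟨χ, rfl⟩ := hχ 0
    exact ⟨_, _, proj El, isUnivalentFibration_of_isUnivalentUniverse hη hext hu,
      pullbacksOf_proj_of_iso e he, isClosedClass_pullbacksOf_proj @hη @hs hc⟩

end EnoughUnivalentFibrations

theorem mainTheorem8 {C : Type u} [Category.{v} C] [ContextualCategory.{w} C]
    [SigmaStructure C] [IdStructure C] [PiStructure C] (hη : PiEta C) (hext : FunExt C) :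
    Tribe.IsPiTribe (fibrations C) ∧
    (∀ (U : ContextualCategory.Ty (ContextualCategory.root : C))
        (El : ContextualCategory.Ty (ContextualCategory.ext U)), IsUnivalentUniverse U El →
      Tribe.IsUnivalentFibration (fibrations C) (ContextualCategory.proj El)) ∧
    (SigmaEta C → HasEnoughUnivalentUniverses C →
      Tribe.HasEnoughUnivalentFibrations (fibrations C)) := by
  exact ⟨fibrations_isPiTribe hη hext,
    fun _ _ hU => isUnivalentFibration_of_isUnivalentUniverse hη hext hU,
    fun hs hU => hasEnoughUnivalentFibrations hη hext hs hU⟩
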